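/- Let $\mathbf{k}$ be a field of characteristic $0$, let $P$ be a $\mathbf{k}$-linear (symmetric) operad, and let $n \ge 0$. Notation. For a vector space $U$ let $P\{U\}=\bigoplus_{r\ge 0}P([r])\otimes_{\mathbf{k}[\mathfrak{S}_r]}U^{\otimes r}$ be the free $P$-algebra on $U$. Put $\mathbf{W}=\bigoplus_{i\ge 1}\mathbf{k}e_i=\bigcup_{m}\mathbf{k}^m$, $\mathbf{V}_m=P\{\mathbf{k}^m\}$ and $\mathbf{V}=P\{\mathbf{W}\}=\bigcup_m\mathbf{V}_m$. Let $\mathfrak{h}_m$ be the Lie algebra of all $P$-algebra derivations of $\mathbf{V}_m$; extending a derivation of $\mathbf{V}_m$ by $0$ on the generators $e_i$ with $i>m$ gives inclusions $\mathfrak{h}_m\subset\mathfrak{h}_{m+1}$, and $\mathfrak{h}=\bigcup_m\mathfrak{h}_m$ acts on $\mathbf{V}$ by derivations (so $\mathfrak{h}$ consists of the derivations of $\mathbf{V}$ killing all but finitely many of the $e_i$). A representation of $\mathfrak{h}$ (resp. $\mathfrak{h}_n$) is \emph{polynomial} if it is a subquotient of a direct sum of tensor powers $\mathbf{V}^{\otimes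 d}$ (resp. $\mathbf{V}_n^{\otimes d}$), $d\ge 0$; $\mathrm{Rep}^{\mathrm{pol}}(\mathfrak{h})$ and $\mathrm{Rep}^{\mathrm{pol}}(\mathfrak{h}_n)$ denote the (abelian) full subcategories of polynomial representations. The Lie algebra $\mathfrak{gl}=\bigcup_m\mathfrak{gl}_m$ acts on $\mathbf{W}$, hence on $\mathbf{V}$ by derivations, which gives a homomorphism $\mathfrak{gl}\to\mathfrak{h}$; let $\mathfrak{gl}_{\infty-n}\subset\mathfrak{gl}$ be the subalgebra of matrices supported on the rows and columns with index $>n$. For an $\mathfrak{h}$-module $M$ let $$\Gamma_n(M)=M^{\mathfrak{gl}_{\infty-n}}$$ be the space of invariants, which is an $\mathfrak{h}_n$-module since $\mathfrak{h}_n$ commutes with $\mathfrak{gl}_{\infty-n}$ in $\mathfrak{h}$. Let $\mathcal{K}_n\subset\mathrm{Rep}^{\mathrm{pol}}(\mathfrak{h})$ be the full subcategory of those $M$ for which every simple subquotient of $M$ as a $\mathfrak{gl}$-module is isomorphic to $\mathbf{S}_\lambda(\mathbf{W})$ for a partition $\lambda$ with more than $n$ rows, where $\mathbf{S}_\lambda$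 is the Schur functor. Then: (1) If $M$ is a polynomial $\mathfrak{h}$-module then $\Gamma_n(M)$ is a polynomial $\mathfrak{h}_n$-module; $\mathcal{K}_n$ is a Serre subcategory of $\mathrm{Rep}^{\mathrm{pol}}(\mathfrak{h})$; the functor $\Gamma_n\colon\mathrm{Rep}^{\mathrm{pol}}(\mathfrak{h})\to\mathrm{Rep}^{\mathrm{pol}}(\mathfrak{h}_n)$ inverts every morphism whose kernel and cokernel lie in $\mathcal{K}_n$; and the functor $$\mathrm{Rep}^{\mathrm{pol}}(\mathfrak{h})/\mathcal{K}_n\longrightarrow\mathrm{Rep}^{\mathrm{pol}}(\mathfrak{h}_n)$$ that it induces on the Serre quotient, by the universal property of the latter, is an equivalence of categories. (2) If $\mathrm{Rep}^{\mathrm{pol}}(\mathfrak{h})$ is locally noetherian (a Grothendieck abelian category with a set of noetherian generators), then so is $\mathrm{Rep}^{\mathrm{pol}}(\mathfrak{h}_n)$. -/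

import Mathlib

universe u

attribute [local instance 100] LieRing.ofAssociativeRing

/-- A linear (symmetric) operad over `k`, in coordinate-free form: a functor `S ↦ obj S` from
finite sets and bijections to `k`-vector spaces, with an identity operation in arity one and
composition maps `P(T) ⊗ ⨂_{t ∈ T} P(S_t) → P(⨆_{t ∈ T} S_t)`, subject to naturality,
associativity and the identity axioms. A decomposition of a finite set into parts indexed by `T`
is written as a sigma type. -/
structure LinearOperad (k : Type u) [Field k] where
  /-- the space of operations with inputs labelled by `S` -/
  obj (S : Type) [Finite S] : Type u
  [addCommGroup (S : Type) [Finite S] : AddCommGroup (obj S)]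
  [module (S : Type) [Finite S] : Module k (obj S)]
  /-- relabelling of inputs -/
  map {S T : Type} [Finite S] [Finite T] (e : S ≃ T) : obj S →ₗ[k] obj T
  map_refl {S : Type} [Finite S] (p : obj S) : map (Equiv.refl S) p = p
  map_trans {S T U : Type} [Finite S] [Finite T] [Finite U] (e : S ≃ T) (f : T ≃ U) (p : obj S) :
    map (e.trans f) p = map f (map e p)
  /-- the identity operation -/
  one : obj Unit
  /-- operadic composition, linear in the outer operation and multilinear in the inner ones -/
  comp {T : Type} [Finite T] {S : T → Type} [∀ t, Finite (S t)] :
    obj T →ₗ[k] MultilinearMap k (fun t => obj (S t)) (obj (Σ t, S t))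
  comp_map {T : Type} [Finite T] {S S' : T → Type} [∀ t, Finite (S t)] [∀ t, Finite (S' t)]
    (e : ∀ t, S t ≃ S' t) (p : obj T) (q : ∀ t, obj (S t)) :
    comp p (fun t => map (e t) (q t)) = map (Equiv.sigmaCongrRight e) (comp p q)
  map_comp {T T' : Type} [Finite T] [Finite T'] {S : T' → Type} [∀ t, Finite (S t)]
    (e : T ≃ T') (p : obj T) (q : ∀ t, obj (S t)) :
    comp (map e p) q = map (Equiv.sigmaCongrLeft e) (comp p (fun t => q (e t)))
  assoc {T : Type} [Finite T] {S : T → Type} [∀ t, Finite (S t)] {R : ∀ t, S t → Type}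
    [∀ t s, Finite (R t s)] (p : obj T) (q : ∀ t, obj (S t)) (r : ∀ t s, obj (R t s)) :
    map (Equiv.sigmaAssoc R) (comp (comp p q) (fun x : Σ t, S t => r x.1 x.2)) =
      comp p (fun t => comp (q t) (r t))
  one_comp {S : Type} [Finite S] (p : obj S) :
    map (Equiv.uniqueSigma (fun _ : Unit => S)) (comp one (fun _ => p)) = p
  comp_one {S : Type} [Finite S] (p : obj S) :
    map (Equiv.sigmaUnique S (fun _ => Unit)) (comp p (fun _ => one)) = p

namespace LinearOperad

attribute [instance] LinearOperad.addCommGroup LinearOperad.module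

/-- An algebra over the operad `P`: each `p ∈ P(S)` acts as an `S`-ary multilinear operation. -/
class Algebra {k : Type u} [Field k] (P : LinearOperad k) (A : Type u) [AddCommGroup A]
    [Module k A] where
  act {S : Type} [Finite S] : P.obj S →ₗ[k] MultilinearMap k (fun _ : S => A) A
  act_map {S T : Type} [Finite S] [Finite T] (e : S ≃ T) (p : P.obj S) (a : T → A) :
    act (P.map e p) a = act p (fun s => a (e s))
  act_comp {T : Type} [Finite T] {S : T → Type} [∀ t, Finite (S t)] (p : P.obj T)
    (q : ∀ t, P.obj (S t)) (a : (Σ t, S t) → A) :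
    act (P.comp p q) a = act p (fun t => act (q t) (fun s => a ⟨t, s⟩))
  act_one (a : Unit → A) : act P.one a = a ()

section Derivations

variable {k : Type u} [Field k] (P : LinearOperad k) (A : Type u) [AddCommGroup A] [Module k A]
  [P.Algebra A]

/-- The Leibniz rule for a linear endomorphism of a `P`-algebra. -/
def IsDerivation (δ : Module.End k A) : Prop :=
  ∀ (r : ℕ) (p : P.obj (Fin r)) (a : Fin r → A),
    δ (Algebra.act p a) = ∑ i, Algebra.act p (Function.update a i (δ (a i)))

variable {P A} in
theorem IsDerivation.add {δ δ' : Module.End k A} (h : P.IsDerivation A δ)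
    (h' : P.IsDerivation A δ') : P.IsDerivation A (δ + δ') := by
  intro r p a
  simp [h r p a, h' r p a, Finset.sum_add_distrib]

variable {P A} in
theorem IsDerivation.smul (c : k) {δ : Module.End k A} (h : P.IsDerivation A δ) :
    P.IsDerivation A (c • δ) := by
  intro r p a
  simp [h r p a, Finset.smul_sum]

theorem IsDerivation.zero : P.IsDerivation A 0 := by
  intro r p a
  simp

variable {P A} in
theorem IsDerivation.comp_apply {δ δ' : Module.End k A} (h : P.IsDerivation A δ)
    (h' : P.IsDerivation A δ') (r : ℕ) (p : P.obj (Fin r)) (a : Fin r → A) :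
    δ (δ' (Algebra.act p a)) =
      ∑ i, Algebra.act p (Function.update a i (δ (δ' (a i)))) +
      ∑ i, ∑ j ∈ Finset.univ.erase i, Algebra.act p
        (Function.update (Function.update a i (δ' (a i))) j (δ (a j))) := by
  rw [h' r p a, map_sum, ← Finset.sum_add_distrib]
  refine Finset.sum_congr rfl fun i _ => ?_
  rw [h, ← Finset.add_sum_erase _ _ (Finset.mem_univ i)]
  congr 1
  · simp
  · refine Finset.sum_congr rfl fun j hj => ?_
    rw [Function.update_of_ne (Finset.ne_of_mem_erase hj)]

/-- The Lie algebra of derivations of a `P`-algebra, with the commutator bracket. -/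
def derivations : LieSubalgebra k (Module.End k A) where
  carrier := {δ | P.IsDerivation A δ}
  add_mem' h h' := h.add h'
  zero_mem' := IsDerivation.zero P A
  smul_mem' c _ h := IsDerivation.smul c h
  lie_mem' {δ δ'} h h' := by
    intro r p a
    rw [LieRing.of_associative_ring_bracket, LinearMap.sub_apply, Module.End.mul_apply,
      Module.End.mul_apply, IsDerivation.comp_apply h h', IsDerivation.comp_apply h' h]
    have key : ∑ i, ∑ j ∈ Finset.univ.erase i, Algebra.act p
        (Function.update (Function.update a i (δ' (a i))) j (δ (a j))) =
        ∑ i, ∑ j ∈ Finset.univ.erase i, Algebra.act p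
        (Function.update (Function.update a i (δ (a i))) j (δ' (a j))) := by
      rw [Finset.sum_comm' (t' := Finset.univ) (s' := fun j => Finset.univ.erase j)]
      · refine Finset.sum_congr rfl fun j _ => Finset.sum_congr rfl fun i hi => ?_
        rw [Function.update_comm (Finset.ne_of_mem_erase hi)]
      · intro x y
        simp [eq_comm]
    rw [key, add_sub_add_right_eq_sub, ← Finset.sum_sub_distrib]
    refine Finset.sum_congr rfl fun i _ => ?_
    rw [← MultilinearMap.map_update_sub]
    rfl

end Derivations

end LinearOperad

namespace LinearOperad

section QuotLift

variable {k : Type u} [Field k] {ι : Type} [Finite ι] {M N : Type u} [AddCommGroup M] [Module k M]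
  [AddCommGroup N] [Module k N]

theorem multilinear_eq_of_sub_mem (F : MultilinearMap k (fun _ : ι => M) N) (R : Submodule k M)
    (h : ∀ [DecidableEq ι] (v : ι → M) (i : ι) (x : M), x ∈ R → F (Function.update v i x) = 0)
    {v w : ι → M} (hvw : ∀ i, v i - w i ∈ R) : F v = F w := by
  classical
  cases nonempty_fintype ι
  have key : ∀ s : Finset ι, F (s.piecewise v w) = F w := by
    intro s
    induction s using Finset.induction_on with
    | empty => simp
    | insert j s hj ih =>
      rw [Finset.piecewise_insert, ← ih]
      have h1 : s.piecewise v w = Function.update (s.piecewise v w) j (w j) := by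
        rw [eq_comm, Function.update_eq_self_iff]
        simp [hj]
      conv_rhs => rw [h1]
      rw [← sub_eq_zero, ← MultilinearMap.map_update_sub]
      exact h _ _ _ (hvw j)
  simpa using key Finset.univ

/-- A multilinear map vanishing on a submodule in each variable descends to the quotient. -/
noncomputable def multilinearQuot (F : MultilinearMap k (fun _ : ι => M) N) (R : Submodule k M)
    (h : ∀ [DecidableEq ι] (v : ι → M) (i : ι) (x : M), x ∈ R → F (Function.update v i x) = 0) :
    MultilinearMap k (fun _ : ι => M ⧸ R) N where
  toFun a := F (fun i => Quotient.out (a i))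
  map_update_add' a i x y := by
    have e : ∀ z : M ⧸ R, F (fun j => Quotient.out (Function.update a i z j)) =
        F (Function.update (fun j => Quotient.out (a j)) i (Quotient.out z)) := by
      intro z
      congr 1
      funext j
      by_cases hj : j = i
      · subst hj; simp
      · simp [hj]
    rw [e, e, e, ← MultilinearMap.map_update_add]
    refine multilinear_eq_of_sub_mem F R h fun j => ?_
    by_cases hj : j = i
    · subst hj
      rw [← Submodule.Quotient.eq]
      simp
    · simp [hj]
  map_update_smul' a i c x := by
    have e : ∀ z : M ⧸ R, F (fun j => Quotient.out (Function.update a i z j)) =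
        F (Function.update (fun j => Quotient.out (a j)) i (Quotient.out z)) := by
      intro z
      congr 1
      funext j
      by_cases hj : j = i
      · subst hj; simp
      · simp [hj]
    rw [e, e, ← MultilinearMap.map_update_smul]
    refine multilinear_eq_of_sub_mem F R h fun j => ?_
    by_cases hj : j = i
    · subst hj
      rw [← Submodule.Quotient.eq]
      simp
    · simp [hj]

theorem multilinearQuot_mk (F : MultilinearMap k (fun _ : ι => M) N) (R : Submodule k M)
    (h : ∀ [DecidableEq ι] (v : ι → M) (i : ι) (x : M), x ∈ R → F (Function.update v i x) = 0)
    (v : ι → M) : multilinearQuot F R h (fun i => Submodule.Quotient.mk (v i)) = F v := by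
  refine multilinear_eq_of_sub_mem F R h fun j => ?_
  rw [← Submodule.Quotient.eq]
  exact Quotient.out_eq _

end QuotLift

section Free

variable {k : Type u} [Field k] (P : LinearOperad k) (X : Type)

/-- The direct sum `⨁_r P([r]) ⊗ (k^X)^{⊗ r}`, written in the basis of `(k^X)^{⊗ r}` given by
the words `f : Fin r → X`. -/
abbrev PreFree : Type u := Π₀ s : Σ r : ℕ, (Fin r → X), P.obj (Fin s.1)

open Classical in
/-- The relations `(σ p) ⊗ f = p ⊗ (f ∘ σ)`, whose quotient is
`⨁_r P([r]) ⊗_{k[S_r]} (k^X)^{⊗ r}`. -/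
def freeRel : Submodule k (P.PreFree X) :=
  Submodule.span k {z | ∃ (r : ℕ) (f : Fin r → X) (σ : Equiv.Perm (Fin r)) (p : P.obj (Fin r)),
    z = DFinsupp.single (β := fun s : Σ r : ℕ, (Fin r → X) => P.obj (Fin s.1)) ⟨r, f⟩ (P.map σ p) -
      DFinsupp.single ⟨r, f ∘ σ⟩ p}

/-- The free `P`-algebra `P{k^X} = ⨁_r P([r]) ⊗_{k[S_r]} (k^X)^{⊗ r}` on the vector space with
basis `X`. -/
def Free : Type u := P.PreFree X ⧸ P.freeRel X

noncomputable instance : AddCommGroup (P.Free X) :=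
  inferInstanceAs (AddCommGroup (P.PreFree X ⧸ P.freeRel X))

noncomputable instance : Module k (P.Free X) :=
  inferInstanceAs (Module k (P.PreFree X ⧸ P.freeRel X))

namespace Free

variable {P X}

open Classical in
/-- The class of `p ⊗ f`, for `p ∈ P([r])` and a word `f : Fin r → X`. -/
noncomputable def monoFin {r : ℕ} (f : Fin r → X) : P.obj (Fin r) →ₗ[k] P.Free X :=
  (P.freeRel X).mkQ ∘ₗ
    DFinsupp.lsingle (M := fun s : Σ r : ℕ, (Fin r → X) => P.obj (Fin s.1)) ⟨r, f⟩

theorem monoFin_map {r : ℕ} (f : Fin r → X) (σ : Equiv.Perm (Fin r)) (p : P.obj (Fin r)) :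
    monoFin f (P.map σ p) = monoFin (f ∘ σ) p := by
  classical
  refine (Submodule.Quotient.eq _).2 (Submodule.subset_span ⟨r, f, σ, p, ?_⟩)
  congr!

/-- The element `p(x_{f(s)})_{s ∈ S}` of the free algebra, for `p ∈ P(S)` and `f : S → X`. -/
noncomputable def mono {S : Type} [Finite S] (f : S → X) : P.obj S →ₗ[k] P.Free X :=
  monoFin (f ∘ (Finite.equivFin S).symm) ∘ₗ P.map (Finite.equivFin S)

theorem mono_eq {S : Type} [Finite S] (f : S → X) {r : ℕ} (e : S ≃ Fin r) (p : P.obj S) :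
    mono f p = monoFin (f ∘ e.symm) (P.map e p) := by
  obtain rfl : r = Nat.card S := by simp [Nat.card_congr e]
  have : e = (Finite.equivFin S).trans ((Finite.equivFin S).symm.trans e) := by
    ext; simp
  conv_rhs => rw [this, P.map_trans, monoFin_map]
  rw [mono, LinearMap.comp_apply]
  congr 1
  congr 1
  ext i
  simp

theorem mono_map {S T : Type} [Finite S] [Finite T] (e : S ≃ T) (f : T → X) (p : P.obj S) :
    mono f (P.map e p) = mono (f ∘ e) p := by
  rw [mono_eq f (Finite.equivFin T), mono_eq (f ∘ e) (e.trans (Finite.equivFin T)), P.map_trans]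
  congr 1
  congr 1
  ext i
  simp

theorem mono_fin {r : ℕ} (f : Fin r → X) (p : P.obj (Fin r)) : mono f p = monoFin f p := by
  rw [mono_eq f (Equiv.refl _), P.map_refl]
  rfl

/-- The generator `x_i`. -/
noncomputable def var (i : X) : P.Free X := mono (fun _ : Unit => i) P.one

theorem lin_ext {N : Type*} [AddCommGroup N] [Module k N] {φ ψ : P.Free X →ₗ[k] N}
    (h : ∀ (r : ℕ) (f : Fin r → X) (p : P.obj (Fin r)), φ (mono f p) = ψ (mono f p)) : φ = ψ := by
  classical
  refine Submodule.linearMap_qext _ (DFinsupp.lhom_ext' fun s => LinearMap.ext fun p => ?_)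
  have := h s.1 s.2 p
  rw [mono_fin] at this
  convert this using 1 <;> simp [monoFin] <;> congr!

open Classical in
theorem multilinear_ext {ι : Type} [Finite ι] {N : Type*} [AddCommGroup N] [Module k N]
    {F G : MultilinearMap k (fun _ : ι => P.Free X) N}
    (h : ∀ (r : ι → ℕ) (f : ∀ i, Fin (r i) → X) (p : ∀ i, P.obj (Fin (r i))),
      F (fun i => mono (f i) (p i)) = G (fun i => mono (f i) (p i))) : F = G := by
  refine MultilinearMap.compLinearMap_injective (fun _ => (P.freeRel X).mkQ)
    (fun _ => Submodule.mkQ_surjective _) ?_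
  refine MultilinearMap.dfinsupp_ext fun κ => MultilinearMap.ext fun p => ?_
  have := h (fun i => (κ i).1) (fun i => (κ i).2) p
  simp only [mono_fin] at this
  exact this

/-- Linear maps out of the free algebra. -/
noncomputable def lin {N : Type u} [AddCommGroup N] [Module k N]
    (φ : ∀ (r : ℕ), (Fin r → X) → P.obj (Fin r) →ₗ[k] N)
    (h : ∀ r (f : Fin r → X) (σ : Equiv.Perm (Fin r)) p, φ r f (P.map σ p) = φ r (f ∘ σ) p) :
    P.Free X →ₗ[k] N :=
  (P.freeRel X).liftQ (by classical exact DFinsupp.lsum k fun s => φ s.1 s.2) <| by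
    refine Submodule.span_le.2 ?_
    rintro _ ⟨r, f, σ, p, rfl⟩
    classical
    simp only [SetLike.mem_coe, LinearMap.mem_ker, map_sub]
    erw [DFinsupp.lsum_single, DFinsupp.lsum_single]
    simp [h]

theorem lin_mono {N : Type u} [AddCommGroup N] [Module k N]
    (φ : ∀ (r : ℕ), (Fin r → X) → P.obj (Fin r) →ₗ[k] N)
    (h : ∀ r (f : Fin r → X) (σ : Equiv.Perm (Fin r)) p, φ r f (P.map σ p) = φ r (f ∘ σ) p)
    {r : ℕ} (f : Fin r → X) (p : P.obj (Fin r)) : lin φ h (mono f p) = φ r f p := by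
  rw [mono_fin]
  classical
  refine (Submodule.liftQ_apply _ _ _).trans ?_
  erw [DFinsupp.lsum_single]

end Free

end Free

end LinearOperad

namespace LinearOperad

namespace Free

section

variable {k : Type u} [Field k] {P : LinearOperad k} {X : Type}

open Classical in
/-- The operation on `⨁_r P([r]) ⊗ (k^X)^{⊗ r}` determined by `q ∈ P(S)`: compose the operations
and concatenate the words. -/
noncomputable def preAct {S : Type} [Finite S] (q : P.obj S) :
    MultilinearMap k (fun _ : S => P.PreFree X) (P.Free X) :=
  letI := Fintype.ofFinite S
  MultilinearMap.fromDFinsuppEquiv (fun _ : S => Σ r : ℕ, (Fin r → X)) k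
    (M := fun _ s => P.obj (Fin s.1))
    (fun κ => (mono (fun x : Σ s, Fin (κ s).1 => (κ x.1).2 x.2)).compMultilinearMap (P.comp q))

open Classical in
theorem preAct_single {S : Type} [Finite S] (q : P.obj S) (κ : S → Σ r : ℕ, (Fin r → X))
    (p : ∀ s, P.obj (Fin (κ s).1)) :
    preAct q (fun s => DFinsupp.single (κ s) (p s)) =
      mono (fun x : Σ s, Fin (κ s).1 => (κ x.1).2 x.2) (P.comp q p) := by
  let := Fintype.ofFinite S
  have := MultilinearMap.fromDFinsuppEquiv_single (R := k)
    (M := fun (_ : S) (s : Σ r : ℕ, (Fin r → X)) => P.obj (Fin s.1))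
    (fun κ : (S → Σ r : ℕ, (Fin r → X)) =>
      (mono (fun x : Σ s, Fin (κ s).1 => (κ x.1).2 x.2)).compMultilinearMap (P.comp q)) κ p
  unfold preAct
  convert this using 2
  rfl

open Classical in
/-- Auxiliary: relabel the words of each length `r` by the permutation `τ r`. -/
noncomputable def twist (τ : ∀ r : ℕ, Equiv.Perm (Fin r)) : P.PreFree X →ₗ[k] P.PreFree X :=
  DFinsupp.lsum k fun s : (Σ r : ℕ, (Fin r → X)) =>
    DFinsupp.lsingle (M := fun s : Σ r : ℕ, (Fin r → X) => P.obj (Fin s.1))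
      ⟨s.1, s.2 ∘ (τ s.1).symm⟩ ∘ₗ P.map (τ s.1)

open Classical in
theorem twist_single (τ : ∀ r : ℕ, Equiv.Perm (Fin r)) (s : Σ r : ℕ, (Fin r → X))
    (p : P.obj (Fin s.1)) :
    twist τ (DFinsupp.single s p : P.PreFree X) =
      DFinsupp.single ⟨s.1, s.2 ∘ (τ s.1).symm⟩ (P.map (τ s.1) p) := by
  unfold twist
  erw [DFinsupp.lsum_single]
  rfl

open Classical in
theorem twist_single_comp (τ : ∀ r : ℕ, Equiv.Perm (Fin r)) {r : ℕ} (σ : Equiv.Perm (Fin r))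
    (hσ : τ r = σ) (f : Fin r → X) (p : P.obj (Fin r)) :
    twist τ (DFinsupp.single ⟨r, f ∘ σ⟩ p : P.PreFree X) =
      DFinsupp.single ⟨r, f⟩ (P.map σ p) := by
  subst hσ
  have e : ∀ (g : Fin r → X) (_ : g = f) (x : P.obj (Fin r)),
      (DFinsupp.single ⟨r, g⟩ x : P.PreFree X) = DFinsupp.single ⟨r, f⟩ x := by
    rintro _ rfl _; rfl
  exact (twist_single _ _ _).trans (e _ (by ext; simp) _)

theorem twist_refl : twist (fun _ => Equiv.refl _) = (LinearMap.id : P.PreFree X →ₗ[k] _) := by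
  classical
  refine DFinsupp.lhom_ext' fun s => LinearMap.ext fun p => ?_
  refine (twist_single (fun _ => Equiv.refl _) s p).trans ?_
  rw [P.map_refl]
  rfl

theorem preAct_twist {S : Type} [Finite S] (q : P.obj S) (τ : S → ∀ r : ℕ, Equiv.Perm (Fin r))
    (v : S → P.PreFree X) : preAct q (fun s => twist (τ s) (v s)) = preAct q v := by
  classical
  have : (preAct q).compLinearMap (fun s => twist (τ s)) = preAct (X := X) q := by
    refine MultilinearMap.dfinsupp_ext fun κ => MultilinearMap.ext fun p => ?_
    change preAct q (fun s => twist (τ s) (DFinsupp.single (κ s) (p s))) =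
      preAct q (fun s => DFinsupp.single (κ s) (p s))
    simp only [twist_single]
    erw [preAct_single q (fun s => ⟨(κ s).1, (κ s).2 ∘ (τ s (κ s).1).symm⟩)
      (fun s => P.map (τ s (κ s).1) (p s)), preAct_single]
    rw [P.comp_map (fun s => τ s (κ s).1), mono_map]
    congr 1
    congr 1
    ext x
    exact congrArg (κ x.1).2 (Equiv.symm_apply_apply _ _)
  exact congrArg (fun F => F v) this

theorem preAct_update_eq_zero {S : Type} [Finite S] (q : P.obj S) [DecidableEq S]
    (v : S → P.PreFree X) (i : S) (x : P.PreFree X) (hx : x ∈ P.freeRel X) :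
    preAct q (Function.update v i x) = 0 := by
  have h : P.freeRel X ≤ LinearMap.ker ((preAct q).toLinearMap v i) := by
    refine Submodule.span_le.2 ?_
    rintro _ ⟨r, f, σ, p, rfl⟩
    classical
    simp only [SetLike.mem_coe, LinearMap.mem_ker, map_sub, sub_eq_zero,
      MultilinearMap.toLinearMap_apply]
    have key := preAct_twist q (Function.update (fun _ _ => Equiv.refl _) i
      (Function.update (fun _ => Equiv.refl _) r σ)) (Function.update v i
        (DFinsupp.single ⟨r, f ∘ σ⟩ p))
    rw [← key]
    congr 1
    funext j
    by_cases hj : j = i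
    · subst hj
      simp only [Function.update_self]
      rw [twist_single_comp _ σ (by simp)]
    · simp [hj, twist_refl]
  exact h hx

/-- The `P`-algebra structure on the free algebra. -/
noncomputable def actMap {S : Type} [Finite S] :
    P.obj S →ₗ[k] MultilinearMap k (fun _ : S => P.Free X) (P.Free X) where
  toFun q := multilinearQuot (preAct q) (P.freeRel X) (fun v i x hx => by
    exact preAct_update_eq_zero q v i x hx)
  map_add' q q' := by
    refine MultilinearMap.ext fun a => ?_
    change preAct (q + q') _ = preAct q _ + preAct q' _
    rw [← add_apply]
    congr 1
    unfold preAct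
    rw [← map_add]
    congr 1
    ext
    simp
  map_smul' c q := by
    refine MultilinearMap.ext fun a => ?_
    change preAct (c • q) _ = c • preAct q _
    rw [← smul_apply]
    congr 1
    unfold preAct
    rw [← map_smul]
    congr 1
    ext
    simp

theorem actMap_mono {S : Type} [Finite S] (q : P.obj S) {R : S → Type} [∀ s, Finite (R s)]
    (f : ∀ s, R s → X) (p : ∀ s, P.obj (R s)) :
    actMap q (fun s => mono (f s) (p s)) =
      mono (fun x : Σ s, R s => f x.1 x.2) (P.comp q p) := by
  classical
  have h1 := preAct_single q (fun s => ⟨Nat.card (R s), f s ∘ (Finite.equivFin (R s)).symm⟩)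
    (fun s => P.map (Finite.equivFin (R s)) (p s))
  rw [P.comp_map, mono_map] at h1
  have h2 := multilinearQuot_mk (preAct q) (P.freeRel X) (fun v i x hx => by
    exact preAct_update_eq_zero q v i x hx) (fun s => DFinsupp.single
      ⟨Nat.card (R s), f s ∘ (Finite.equivFin (R s)).symm⟩
        (P.map (Finite.equivFin (R s)) (p s)))
  refine (h2.trans h1).trans ?_
  congr 1
  congr 1
  ext x
  exact congrArg (f x.1) (Equiv.symm_apply_apply _ _)

theorem actMap_mono_one {S : Type} [Finite S] (q : P.obj S) (f : S → X) :
    actMap q (fun s => var (f s)) = mono f q := by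
  have := actMap_mono q (fun s (_ : Unit) => f s) (fun _ => P.one)
  refine this.trans ?_
  conv_rhs => rw [← P.comp_one q]
  rw [mono_map]
  rfl

theorem actMap_comp {T : Type} [Finite T] {S : T → Type} [∀ t, Finite (S t)] (p : P.obj T)
    (q : ∀ t, P.obj (S t)) (a : (Σ t, S t) → P.Free X) :
    actMap (P.comp p q) a = actMap p (fun t => actMap (q t) (fun s => a ⟨t, s⟩)) := by
  have : actMap (X := X) (P.comp p q) =
      (actMap p).compMultilinearMap (fun t => actMap (q t)) := by
    refine multilinear_ext fun r f w => ?_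
    have e : ∀ t, actMap (q t) (fun s => mono (f ⟨t, s⟩) (w ⟨t, s⟩)) =
        mono (X := X) (fun x : Σ s, Fin (r ⟨t, s⟩) => f ⟨t, x.1⟩ x.2)
          (P.comp (q t) (fun s => w ⟨t, s⟩)) :=
      fun t => actMap_mono _ _ _
    have e2 : (actMap p).compMultilinearMap (fun t => actMap (q t))
        (fun i => mono (f i) (w i)) =
        actMap p (fun t => actMap (q t) (fun s => mono (f ⟨t, s⟩) (w ⟨t, s⟩))) := rfl
    rw [e2]
    simp only [e]
    rw [actMap_mono, actMap_mono, ← P.assoc p q (fun t s => w ⟨t, s⟩), mono_map]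
    rfl
  rw [this]
  rfl

noncomputable instance : P.Algebra (P.Free X) where
  act := actMap
  act_map {S T} _ _ e p a := by
    have : actMap (X := X) (P.map e p) = (actMap p).domDomCongr e := by
      refine multilinear_ext fun r f q => ?_
      rw [MultilinearMap.domDomCongr_apply, actMap_mono, actMap_mono, P.map_comp, mono_map]
      rfl
    rw [this]
    rfl
  act_comp p q a := actMap_comp p q a
  act_one a := by
    have : actMap (X := X) P.one = MultilinearMap.ofSubsingleton k _ _ () LinearMap.id := by
      refine multilinear_ext fun r f w => ?_
      rw [actMap_mono]
      have := P.one_comp (w ())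
      simp only [MultilinearMap.ofSubsingleton_apply_apply, LinearMap.id_apply]
      conv_rhs => rw [← this]
      rw [mono_map]
      rfl
    rw [this]
    rfl

theorem act_mono {S : Type} [Finite S] (q : P.obj S) {R : S → Type} [∀ s, Finite (R s)]
    (f : ∀ s, R s → X) (p : ∀ s, P.obj (R s)) :
    Algebra.act q (fun s => mono (f s) (p s)) =
      mono (fun x : Σ s, R s => f x.1 x.2) (P.comp q p) :=
  actMap_mono q f p

theorem act_var {S : Type} [Finite S] (q : P.obj S) (f : S → X) :
    Algebra.act q (fun s => (var (f s) : P.Free X)) = mono f q :=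
  actMap_mono_one q f

end

end Free

end LinearOperad

namespace LinearOperad

namespace Free

section

variable {k : Type u} [Field k] {P : LinearOperad k} {X : Type} {A : Type u} [AddCommGroup A]
  [Module k A] [P.Algebra A]

/-- The unique map of `P`-algebras from the free algebra with prescribed values on generators. -/
noncomputable def lift (a : X → A) : P.Free X →ₗ[k] A :=
  lin (fun _ f =>
    { toFun := fun p => Algebra.act p (a ∘ f)
      map_add' := fun p q => by simp
      map_smul' := fun c p => by simp })
    (fun r f σ p => Algebra.act_map σ p (a ∘ f))

theorem lift_mono (a : X → A) {S : Type} [Finite S] (f : S → X) (p : P.obj S) :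
    lift a (mono f p) = Algebra.act p (a ∘ f) := by
  have h : mono f p = mono (f ∘ (Finite.equivFin S).symm) (P.map (Finite.equivFin S) p) := by
    rw [mono_map]
    congr 1
    congr 1
    ext
    simp
  rw [h, lift, lin_mono]
  change Algebra.act _ _ = _
  rw [Algebra.act_map]
  congr 1
  ext
  simp

theorem lift_var (a : X → A) (i : X) : lift (P := P) a (var i) = a i := by
  rw [var, lift_mono, Algebra.act_one]
  rfl

theorem lift_act (a : X → A) {S : Type} [Finite S] (q : P.obj S) (v : S → P.Free X) :
    lift a (Algebra.act q v) = Algebra.act q (fun s => lift a (v s)) := by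
  have : (lift a).compMultilinearMap (Algebra.act (A := P.Free X) q) =
      (Algebra.act q).compLinearMap (fun _ => lift a) := by
    refine multilinear_ext fun r f p => ?_
    rw [LinearMap.compMultilinearMap_apply, MultilinearMap.compLinearMap_apply, act_mono,
      lift_mono, Algebra.act_comp]
    simp only [lift_mono]
    rfl
  exact congrArg (fun F => F v) this

theorem lift_unique (φ : P.Free X →ₗ[k] A)
    (h : ∀ (r : ℕ) (q : P.obj (Fin r)) (v : Fin r → P.Free X),
      φ (Algebra.act q v) = Algebra.act q (fun s => φ (v s))) :
    φ = lift (fun i => φ (var i)) := by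
  refine lin_ext fun r f p => ?_
  rw [lift_mono, ← act_var, h]
  rfl

/-- A linear map on the free algebra satisfying a Leibniz rule is determined by its values on
the generators. -/
theorem leibniz_ext (φ : P.Free X → A) {d d' : P.Free X →ₗ[k] A}
    (h : ∀ (r : ℕ) (p : P.obj (Fin r)) (a : Fin r → P.Free X),
      d (Algebra.act p a) =
        ∑ i, Algebra.act p (Function.update (fun j => φ (a j)) i (d (a i))))
    (h' : ∀ (r : ℕ) (p : P.obj (Fin r)) (a : Fin r → P.Free X),
      d' (Algebra.act p a) =
        ∑ i, Algebra.act p (Function.update (fun j => φ (a j)) i (d' (a i))))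
    (hv : ∀ i, d (var i) = d' (var i)) : d = d' := by
  refine lin_ext fun r f p => ?_
  rw [← act_var, h, h']
  simp only [hv]

/-- The unique derivation of the free algebra with prescribed values on the generators. -/
noncomputable def der (g : X → P.Free X) : Module.End k (P.Free X) :=
  lin (fun r f =>
    { toFun := fun p => ∑ i : Fin r, Algebra.act p
        (Function.update (fun j => var (f j)) i (g (f i)))
      map_add' := fun p q => by simp [Finset.sum_add_distrib]
      map_smul' := fun c p => by simp [Finset.smul_sum] })
    (fun r f σ p => by
      simp only [LinearMap.coe_mk, AddHom.coe_mk, Algebra.act_map]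
      refine (Equiv.sum_comp σ _).symm.trans (Finset.sum_congr rfl fun i _ => ?_)
      congr 1
      funext j
      by_cases hj : j = i
      · subst hj; simp
      · simp [hj])

theorem der_mono (g : X → P.Free X) {S : Type} [Fintype S] [DecidableEq S] (f : S → X)
    (p : P.obj S) : der g (mono f p) =
      ∑ s, Algebra.act p (Function.update (fun j => var (f j)) s (g (f s))) := by
  have e := Finite.equivFin S
  have h : mono f p = mono (f ∘ e.symm) (P.map e p) := by
    rw [mono_map]
    congr 1
    congr 1
    ext
    simp
  rw [h, der, lin_mono]
  simp only [LinearMap.coe_mk, AddHom.coe_mk, Algebra.act_map]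
  refine (Equiv.sum_comp e _).symm.trans (Finset.sum_congr rfl fun i _ => ?_)
  congr 1
  funext j
  by_cases hj : j = i
  · subst hj; simp
  · simp [hj]

theorem der_var (g : X → P.Free X) (i : X) : der g (var i) = g i := by
  rw [var, der_mono]
  simp [Algebra.act_one]

theorem der_isDerivation (g : X → P.Free X) : P.IsDerivation (P.Free X) (der g) := by
  intro n q v
  have : (der g).compMultilinearMap (Algebra.act (A := P.Free X) q) =
      ∑ i, (Algebra.act q).compLinearMap
        (Function.update (fun _ => LinearMap.id) i (der g)) := by
    refine multilinear_ext fun r f p => ?_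
    rw [LinearMap.compMultilinearMap_apply, act_mono, der_mono, Fintype.sum_sigma,
      sum_apply]
    refine Finset.sum_congr rfl fun i _ => ?_
    have e : (fun j => (Function.update (fun _ => LinearMap.id) i (der g) :
        Fin n → P.Free X →ₗ[k] P.Free X) j (mono (f j) (p j))) =
        Function.update (fun j => mono (f j) (p j)) i (der g (mono (f i) (p i))) := by
      funext j
      by_cases hj : j = i
      · subst hj; simp
      · simp [hj]
    rw [MultilinearMap.compLinearMap_apply, e, der_mono, MultilinearMap.map_update_sum]
    refine Finset.sum_congr rfl fun s _ => ?_
    rw [Algebra.act_comp]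
    congr 1
    funext t
    by_cases ht : t = i
    · subst ht
      simp only [Function.update_self]
      congr 1
      funext s'
      by_cases hs : s' = s
      · subst hs; simp
      · rw [Function.update_of_ne hs, Function.update_of_ne (by simp [hs])]
    · rw [Function.update_of_ne ht, ← act_var]
      congr 1
      funext s'
      rw [Function.update_of_ne (by rintro h; exact ht (congrArg Sigma.fst h))]
  have h2 := congrArg (fun F => F v) this
  rw [LinearMap.compMultilinearMap_apply, sum_apply] at h2
  refine h2.trans (Finset.sum_congr rfl fun i _ => ?_)
  rw [MultilinearMap.compLinearMap_apply]
  congr 1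
  funext j
  by_cases hj : j = i
  · subst hj; simp
  · simp [hj]

theorem derivation_ext {δ δ' : Module.End k (P.Free X)} (h : P.IsDerivation _ δ)
    (h' : P.IsDerivation _ δ') (hv : ∀ i, δ (var i) = δ' (var i)) : δ = δ' :=
  leibniz_ext (fun a => a) h h' hv

end

end Free

section LieAlgebras

variable {k : Type u} [Field k] (P : LinearOperad k)

/-- The free algebra `V_n = P{k^n}`. -/
abbrev V (n : ℕ) : Type u := P.Free (Fin n)

/-- The free algebra `V = ⋃ V_n` on countably many generators. -/
abbrev VInf : Type u := P.Free ℕ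

/-- The Lie algebra `𝔥_n` of all derivations of `V_n`. -/
noncomputable abbrev hFin (n : ℕ) : LieSubalgebra k (Module.End k (P.V n)) := P.derivations (P.V n)

/-- The Lie algebra `𝔥 = ⋃ 𝔥_n`: the derivations of `V` killing all but finitely many of the
generators (see `exists_mem_range_extend`). -/
noncomputable def hInf : LieSubalgebra k (Module.End k P.VInf) where
  carrier := {δ | P.IsDerivation P.VInf δ ∧ ∃ m : ℕ, ∀ i, m ≤ i → δ (Free.var i) = 0}
  add_mem' := by
    rintro δ δ' ⟨h, m, hm⟩ ⟨h', m', hm'⟩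
    refine ⟨h.add h', max m m', fun i hi => ?_⟩
    simp [hm i (le_trans (le_max_left _ _) hi), hm' i (le_trans (le_max_right _ _) hi)]
  zero_mem' := ⟨IsDerivation.zero P _, 0, fun _ _ => rfl⟩
  smul_mem' := by
    rintro c δ ⟨h, m, hm⟩
    exact ⟨h.smul c, m, fun i hi => by simp [hm i hi]⟩
  lie_mem' := by
    rintro δ δ' ⟨h, m, hm⟩ ⟨h', m', hm'⟩
    refine ⟨(P.derivations P.VInf).lie_mem' h h', max m m', fun i hi => ?_⟩
    simp [LieRing.of_associative_ring_bracket, hm i (le_trans (le_max_left _ _) hi),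
      hm' i (le_trans (le_max_right _ _) hi)]

variable {P}

theorem hInf_ext {δ δ' : P.hInf} (h : ∀ i, δ.1 (Free.var i) = δ'.1 (Free.var i)) : δ = δ' :=
  Subtype.ext (Free.derivation_ext δ.2.1 δ'.2.1 h)

theorem hInf_lie_var (δ δ' : P.hInf) (i : ℕ) :
    (⁅δ, δ'⁆ : P.hInf).1 (Free.var i) = δ.1 (δ'.1 (Free.var i)) - δ'.1 (δ.1 (Free.var i)) := by
  simp [LieRing.of_associative_ring_bracket]

variable (P)

/-- The inclusion `V_n ⊆ V` of free algebras. -/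
noncomputable def incl (n : ℕ) : P.V n →ₗ[k] P.VInf := Free.lift (fun i => Free.var (i : ℕ))

/-- The inclusion `𝔥_n ⊆ 𝔥`: a derivation of `V_n` is extended to `V` by killing the generators
`x_i` with `i ≥ n`. -/
noncomputable def extendDer (n : ℕ) (δ : P.hFin n) : P.hInf :=
  ⟨Free.der (fun i => if h : i < n then P.incl n (δ.1 (Free.var ⟨i, h⟩)) else 0),
    Free.der_isDerivation _, n, fun i hi => by rw [Free.der_var, dif_neg (not_lt.2 hi)]⟩

variable {P}

theorem extendDer_var_of_lt {n : ℕ} (δ : P.hFin n) {i : ℕ} (h : i < n) :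
    (P.extendDer n δ).1 (Free.var i) = P.incl n (δ.1 (Free.var ⟨i, h⟩)) := by
  rw [extendDer, Free.der_var, dif_pos h]

theorem extendDer_var_of_le {n : ℕ} (δ : P.hFin n) {i : ℕ} (h : n ≤ i) :
    (P.extendDer n δ).1 (Free.var i) = 0 := by
  rw [extendDer, Free.der_var, dif_neg (not_lt.2 h)]

theorem incl_var (n : ℕ) (i : Fin n) : P.incl n (Free.var i) = Free.var (i : ℕ) :=
  Free.lift_var _ _

theorem extendDer_incl {n : ℕ} (δ : P.hFin n) (v : P.V n) :
    (P.extendDer n δ).1 (P.incl n v) = P.incl n (δ.1 v) := by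
  have : (P.extendDer n δ).1 ∘ₗ P.incl n = P.incl n ∘ₗ δ.1 := by
    refine Free.leibniz_ext (P.incl n) (fun r p a => ?_) (fun r p a => ?_) (fun i => ?_)
    · rw [LinearMap.comp_apply, incl, Free.lift_act, (P.extendDer n δ).2.1]
      rfl
    · rw [LinearMap.comp_apply, δ.2, map_sum]
      refine Finset.sum_congr rfl fun i _ => ?_
      rw [incl, Free.lift_act]
      congr 1
      funext j
      by_cases hj : j = i
      · subst hj; simp
      · simp [hj]
    · rw [LinearMap.comp_apply, LinearMap.comp_apply, incl_var, extendDer_var_of_lt δ i.2]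
  exact congrArg (fun F => F v) this

variable (P)

/-- The inclusion `𝔥_n ⊆ 𝔥` as a homomorphism of Lie algebras. -/
noncomputable def extend (n : ℕ) : P.hFin n →ₗ⁅k⁆ P.hInf where
  toFun := P.extendDer n
  map_add' δ δ' := hInf_ext fun i => by
    rcases lt_or_ge i n with h | h
    · change _ = (P.extendDer n δ).1 _ + (P.extendDer n δ').1 _
      simp [extendDer_var_of_lt _ h]
    · change _ = (P.extendDer n δ).1 _ + (P.extendDer n δ').1 _
      simp [extendDer_var_of_le _ h]
  map_smul' c δ := hInf_ext fun i => by
    rcases lt_or_ge i n with h | h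
    · change _ = c • (P.extendDer n δ).1 _
      simp [extendDer_var_of_lt _ h]
    · change _ = c • (P.extendDer n δ).1 _
      simp [extendDer_var_of_le _ h]
  map_lie' {δ δ'} := hInf_ext fun i => by
    rw [hInf_lie_var]
    rcases lt_or_ge i n with h | h
    · simp [extendDer_var_of_lt _ h, extendDer_incl, LieRing.of_associative_ring_bracket]
    · simp [extendDer_var_of_le _ h]

variable {P}

/-- `𝔥` is the union of the subalgebras `𝔥_n`. -/
theorem exists_mem_range_extend (δ : P.hInf) : ∃ n, δ ∈ (P.extend n).range := by
  have hV : ∀ v : P.VInf, ∃ n, ∀ m, n ≤ m → v ∈ LinearMap.range (P.incl m) := by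
    let U : Submodule k P.VInf :=
      { carrier := {v | ∃ n, ∀ m, n ≤ m → v ∈ LinearMap.range (P.incl m)}
        add_mem' := by
          rintro v w ⟨n, hn⟩ ⟨n', hn'⟩
          exact ⟨max n n', fun m hm => add_mem (hn m (le_trans (le_max_left _ _) hm))
            (hn' m (le_trans (le_max_right _ _) hm))⟩
        zero_mem' := ⟨0, fun m _ => zero_mem _⟩
        smul_mem' := by
          rintro c v ⟨n, hn⟩
          exact ⟨n, fun m hm => Submodule.smul_mem _ c (hn m hm)⟩ }
    have hU : U.mkQ = 0 := by
      refine Free.lin_ext fun r f p => ?_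
      refine (Submodule.Quotient.mk_eq_zero _).2 ?_
      refine ⟨Finset.univ.sup f + 1, fun m hm => ?_⟩
      have hf : ∀ i, f i < m := fun i => by
        have := Finset.le_sup (f := f) (Finset.mem_univ i)
        omega
      refine ⟨Free.mono (fun i => ⟨f i, hf i⟩) p, ?_⟩
      · rw [incl, Free.lift_mono, ← Free.act_var]
        rfl
    intro v
    exact (Submodule.Quotient.mk_eq_zero U).1 (congrArg (fun F => F v) hU)
  obtain ⟨m, hm⟩ := δ.2.2
  choose N hN using fun i => hV (δ.1 (Free.var i))
  let n := max m ((Finset.range m).sup N)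
  have hn : ∀ i : Fin n, ∃ w, P.incl n w = δ.1 (Free.var (i : ℕ)) := by
    intro i
    rcases lt_or_ge (i : ℕ) m with h | h
    · exact hN i n (le_trans (Finset.le_sup (f := N) (Finset.mem_range.2 h)) (le_max_right _ _))
    · exact ⟨0, by rw [hm _ h, map_zero]⟩
  choose w hw using hn
  refine ⟨n, ⟨⟨Free.der w, Free.der_isDerivation w⟩, hInf_ext fun i => ?_⟩⟩
  change (P.extendDer n _).1 _ = _
  rcases lt_or_ge i n with h | h
  · rw [extendDer_var_of_lt _ h, Free.der_var, hw]
  · rw [extendDer_var_of_le _ h, hm i (le_trans (le_max_left _ _) h)]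

end LieAlgebras

section GenLin

/-- The infinite general linear Lie algebra `𝔤𝔩 = ⋃ 𝔤𝔩_n`, acting on `W = ⋃ k^n`. -/
def glInf (k : Type u) [Field k] : LieSubalgebra k (Module.End k (ℕ →₀ k)) where
  carrier := {g | ∃ m : ℕ, ∀ i, m ≤ i → g (Finsupp.single i 1) = 0}
  add_mem' := by
    rintro g g' ⟨m, hm⟩ ⟨m', hm'⟩
    refine ⟨max m m', fun i hi => ?_⟩
    simp [hm i (le_trans (le_max_left _ _) hi), hm' i (le_trans (le_max_right _ _) hi)]
  zero_mem' := ⟨0, fun _ _ => rfl⟩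
  smul_mem' := by
    rintro c g ⟨m, hm⟩
    exact ⟨m, fun i hi => by simp [hm i hi]⟩
  lie_mem' := by
    rintro g g' ⟨m, hm⟩ ⟨m', hm'⟩
    refine ⟨max m m', fun i hi => ?_⟩
    simp [LieRing.of_associative_ring_bracket, hm i (le_trans (le_max_left _ _) hi),
      hm' i (le_trans (le_max_right _ _) hi)]

/-- The subalgebra `𝔤𝔩_{∞-n} ⊆ 𝔤𝔩` of the matrices supported on the rows and columns with
index `≥ n`. -/
def glTail (k : Type u) [Field k] (n : ℕ) : LieSubalgebra k (glInf k) where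
  carrier := {g | (∀ i, i < n → g.1 (Finsupp.single i 1) = 0) ∧ ∀ w, ∀ j, j < n → g.1 w j = 0}
  add_mem' := by
    rintro g g' ⟨h1, h2⟩ ⟨h1', h2'⟩
    exact ⟨fun i hi => by simp [h1 i hi, h1' i hi], fun w j hj => by simp [h2 w j hj, h2' w j hj]⟩
  zero_mem' := ⟨fun _ _ => rfl, fun _ _ _ => rfl⟩
  smul_mem' := by
    rintro c g ⟨h1, h2⟩
    exact ⟨fun i hi => by simp [h1 i hi], fun w j hj => by simp [h2 w j hj]⟩
  lie_mem' := by
    rintro g g' ⟨h1, h2⟩ ⟨h1', h2'⟩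
    exact ⟨fun i hi => by simp [LieRing.of_associative_ring_bracket, h1 i hi, h1' i hi],
      fun w j hj => by simp [LieRing.of_associative_ring_bracket, h2 _ j hj, h2' _ j hj]⟩

variable {k : Type u} [Field k] (P : LinearOperad k)

/-- The map `W → V` sending the basis vector `e_i` to the generator `x_i`. -/
noncomputable def inclW : (ℕ →₀ k) →ₗ[k] P.VInf := Finsupp.linearCombination k Free.var

variable {P} in
theorem inclW_single (i : ℕ) : P.inclW (Finsupp.single i 1) = Free.var i := by
  simp [inclW]

/-- The derivation of `V` induced by an element of `𝔤𝔩`. -/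
noncomputable def glDer (g : glInf k) : P.hInf :=
  ⟨Free.der (fun i => P.inclW (g.1 (Finsupp.single i 1))), Free.der_isDerivation _, by
    obtain ⟨m, hm⟩ := g.2
    exact ⟨m, fun i hi => by rw [Free.der_var, hm i hi, map_zero]⟩⟩

variable {P}

theorem glDer_var (g : glInf k) (i : ℕ) :
    (P.glDer g).1 (Free.var i) = P.inclW (g.1 (Finsupp.single i 1)) := by
  rw [glDer, Free.der_var]

theorem glDer_inclW (g : glInf k) (w : ℕ →₀ k) :
    (P.glDer g).1 (P.inclW w) = P.inclW (g.1 w) := by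
  have : (P.glDer g).1 ∘ₗ P.inclW = P.inclW ∘ₗ g.1 := by
    refine Finsupp.lhom_ext' fun i => LinearMap.ext_ring ?_
    change (P.glDer g).1 (P.inclW (Finsupp.single i 1)) = _
    rw [inclW_single, glDer_var]
    rfl
  exact congrArg (fun F => F w) this

variable (P)

/-- The action of `𝔤𝔩` on `V` by derivations, as a homomorphism of Lie algebras `𝔤𝔩 → 𝔥`. -/
noncomputable def glToH : glInf k →ₗ⁅k⁆ P.hInf where
  toFun := P.glDer
  map_add' g g' := hInf_ext fun i => by
    change _ = (P.glDer g).1 _ + (P.glDer g').1 _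
    simp [glDer_var]
  map_smul' c g := hInf_ext fun i => by
    change _ = c • (P.glDer g).1 _
    simp [glDer_var]
  map_lie' {g g'} := hInf_ext fun i => by
    rw [hInf_lie_var]
    simp [glDer_var, glDer_inclW, LieRing.of_associative_ring_bracket]

variable {P}

/-- `𝔥_n` commutes with `𝔤𝔩_{∞-n}` inside `𝔥`. -/
theorem lie_glToH_extend {n : ℕ} (g : glTail k n) (δ : P.hFin n) :
    ⁅P.glToH g.1, P.extend n δ⁆ = 0 := by
  have h1 : (P.glDer g.1).1 ∘ₗ P.incl n = 0 := by
    refine Free.leibniz_ext (P.incl n) (fun r p a => ?_) (fun r p a => ?_) (fun i => ?_)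
    · rw [LinearMap.comp_apply, incl, Free.lift_act, (P.glDer g.1).2.1]
      rfl
    · simp
    · rw [LinearMap.comp_apply, incl_var, glDer_var, g.2.1 i i.2, map_zero]
      rfl
  have h2 : ∀ w : ℕ →₀ k, (∀ j, j < n → w j = 0) → (P.extendDer n δ).1 (P.inclW w) = 0 := by
    intro w hw
    rw [inclW, Finsupp.linearCombination_apply, Finsupp.sum, map_sum]
    refine Finset.sum_eq_zero fun i hi => ?_
    rcases lt_or_ge i n with h | h
    · exact absurd (hw i h) (Finsupp.mem_support_iff.1 hi)
    · rw [map_smul, extendDer_var_of_le _ h, smul_zero]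
  refine hInf_ext fun i => ?_
  rw [hInf_lie_var]
  change (P.glDer g.1).1 ((P.extendDer n δ).1 _) - (P.extendDer n δ).1 ((P.glDer g.1).1 _) = 0
  rw [glDer_var, h2 _ (fun j hj => g.2.2 _ j hj), sub_zero]
  rcases lt_or_ge i n with h | h
  · rw [extendDer_var_of_lt _ h]
    exact congrArg (fun F => F (δ.1 (Free.var ⟨i, h⟩))) h1
  · rw [extendDer_var_of_le _ h, map_zero]

end GenLin

end LinearOperad

open CategoryTheory Limits

/-- A representation of the Lie algebra `L` over `k`. -/
structure LieRep (k : Type u) [Field k] (L : Type u) [LieRing L] [LieAlgebra k L] where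
  /-- the underlying vector space -/
  carrier : Type u
  [addCommGroup : AddCommGroup carrier]
  [module : Module k carrier]
  [lieRingModule : LieRingModule L carrier]
  [lieModule : LieModule k L carrier]

namespace LieRep

attribute [instance] LieRep.addCommGroup LieRep.module LieRep.lieRingModule LieRep.lieModule

section Category

variable {k : Type u} [Field k] {L : Type u} [LieRing L] [LieAlgebra k L]

instance : Category.{u} (LieRep k L) where
  Hom M N := M.carrier →ₗ⁅k, L⁆ N.carrier
  id M := LieModuleHom.id
  comp f g := g.comp f

theorem comp_apply {M N K : LieRep k L} (f : M ⟶ N) (g : N ⟶ K) (m : M.carrier) :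
    (show M.carrier →ₗ⁅k, L⁆ K.carrier from f ≫ g) m =
      (show N.carrier →ₗ⁅k, L⁆ K.carrier from g)
        ((show M.carrier →ₗ⁅k, L⁆ N.carrier from f) m) := rfl

noncomputable instance : Preadditive (LieRep k L) where
  homGroup M N := inferInstanceAs (AddCommGroup (M.carrier →ₗ⁅k, L⁆ N.carrier))
  add_comp _ N K _ _ g := LieModuleHom.ext fun _ =>
    map_add (show N.carrier →ₗ⁅k, L⁆ K.carrier from g) _ _
  comp_add _ _ _ _ _ _ := rfl

/-- The action of the enveloping algebra on a representation. -/
noncomputable abbrev envModule (M : LieRep k L) :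
    Module (UniversalEnvelopingAlgebra k L) M.carrier :=
  Module.compHom M.carrier
    (UniversalEnvelopingAlgebra.lift k (LieModule.toEnd k L M.carrier)).toRingHom

theorem env_map {M N : LieRep k L} (f : M.carrier →ₗ⁅k, L⁆ N.carrier)
    (a : UniversalEnvelopingAlgebra k L) (m : M.carrier) :
    f (UniversalEnvelopingAlgebra.lift k (LieModule.toEnd k L M.carrier) a m) =
      UniversalEnvelopingAlgebra.lift k (LieModule.toEnd k L N.carrier) a (f m) := by
  let S : Subalgebra k (Module.End k M.carrier × Module.End k N.carrier) :=
    { carrier := {p | ∀ m, f (p.1 m) = p.2 (f m)}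
      mul_mem' := by
        intro p q hp hq m
        change f (p.1 (q.1 m)) = p.2 (q.2 (f m))
        rw [hp, hq]
      add_mem' := by
        intro p q hp hq m
        simp [hp m, hq m]
      algebraMap_mem' := by
        intro c m
        simp }
  let φ : L →ₗ⁅k⁆ S :=
    { toFun := fun x => ⟨(LieModule.toEnd k L M.carrier x, LieModule.toEnd k L N.carrier x),
        fun m => by simp⟩
      map_add' := fun x y => by ext <;> simp
      map_smul' := fun c x => by ext <;> simp
      map_lie' := fun {x y} => by
        ext <;> simp [LieRing.of_associative_ring_bracket] }
  have h1 : (AlgHom.fst k _ _).comp (S.val.comp (UniversalEnvelopingAlgebra.lift k φ)) =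
      UniversalEnvelopingAlgebra.lift k (LieModule.toEnd k L M.carrier) := by
    apply UniversalEnvelopingAlgebra.hom_ext
    refine LieHom.ext fun x => ?_
    simp [φ]
  have h2 : (AlgHom.snd k _ _).comp (S.val.comp (UniversalEnvelopingAlgebra.lift k φ)) =
      UniversalEnvelopingAlgebra.lift k (LieModule.toEnd k L N.carrier) := by
    apply UniversalEnvelopingAlgebra.hom_ext
    refine LieHom.ext fun x => ?_
    simp [φ]
  rw [← h1, ← h2]
  exact (UniversalEnvelopingAlgebra.lift k φ a).2 m

variable (k L) in
/-- Representations of `L` as modules over the enveloping algebra. -/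
noncomputable def toEnv : LieRep k L ⥤ ModuleCat.{u} (UniversalEnvelopingAlgebra k L) where
  obj M := letI := M.envModule; ModuleCat.of _ M.carrier
  map {M N} f := letI := M.envModule; letI := N.envModule
    ModuleCat.ofHom
      { toFun := fun m => (show M.carrier →ₗ⁅k, L⁆ N.carrier from f) m
        map_add' := fun m m' => map_add (show M.carrier →ₗ⁅k, L⁆ N.carrier from f) m m'
        map_smul' := fun a m => env_map (show M.carrier →ₗ⁅k, L⁆ N.carrier from f) a m }

instance : (toEnv k L).Faithful where
  map_injective {M N} f g h := by
    refine LieModuleHom.ext fun m => ?_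
    exact congrArg (fun F => F.hom m) h

instance : (toEnv k L).Full where
  map_surjective {M N} f := by
    let := M.envModule
    let := N.envModule
    let F : M.carrier →ₗ[UniversalEnvelopingAlgebra k L] N.carrier := f.hom
    have hs : ∀ (K : LieRep k L) (a : UniversalEnvelopingAlgebra k L) (m : K.carrier),
        (let := K.envModule; a • m) =
          UniversalEnvelopingAlgebra.lift k (LieModule.toEnd k L K.carrier) a m :=
      fun K a m => rfl
    refine ⟨(show M.carrier →ₗ⁅k, L⁆ N.carrier from
      { toFun := F
        map_add' := F.map_add
        map_smul' := fun c m => ?_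
        map_lie' := fun {x m} => ?_ }), rfl⟩
    · have := F.map_smul (algebraMap k _ c) m
      rw [hs, hs] at this
      simpa using this
    · have := F.map_smul (UniversalEnvelopingAlgebra.ι k x) m
      rw [hs, hs] at this
      simpa using this

instance : (toEnv k L).EssSurj where
  mem_essImage N := by
    let : Module k N := Module.compHom N (algebraMap k (UniversalEnvelopingAlgebra k L))
    have : IsScalarTower k (UniversalEnvelopingAlgebra k L) N :=
      ⟨fun c a n => by rw [Algebra.smul_def, mul_smul]; rfl⟩
    let : LieRingModule L N :=
      { bracket := fun x n => UniversalEnvelopingAlgebra.ι k x • n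
        add_lie := fun x y n => by
          rw [map_add, add_smul]
        lie_add := fun x n n' => smul_add _ _ _
        leibniz_lie := fun x y n => by
          change UniversalEnvelopingAlgebra.ι k x • UniversalEnvelopingAlgebra.ι k y • n =
            UniversalEnvelopingAlgebra.ι k ⁅x, y⁆ • n +
              UniversalEnvelopingAlgebra.ι k y • UniversalEnvelopingAlgebra.ι k x • n
          rw [LieHom.map_lie, LieRing.of_associative_ring_bracket, sub_smul, mul_smul, mul_smul]
          abel }
    have : LieModule k L N :=
      { smul_lie := fun c x n => by
          change UniversalEnvelopingAlgebra.ι k (c • x) • n =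
            c • UniversalEnvelopingAlgebra.ι k x • n
          rw [map_smul, smul_assoc]
        lie_smul := fun c x n => by
          change UniversalEnvelopingAlgebra.ι k x • c • n =
            c • UniversalEnvelopingAlgebra.ι k x • n
          rw [← algebraMap_smul (UniversalEnvelopingAlgebra k L) c n, ← mul_smul,
            ← Algebra.commutes, mul_smul, algebraMap_smul] }
    let M : LieRep k L := ⟨N⟩
    have key : UniversalEnvelopingAlgebra.lift k (LieModule.toEnd k L M.carrier) =
        Algebra.lsmul k k N := by
      apply UniversalEnvelopingAlgebra.hom_ext
      refine LieHom.ext fun x => LinearMap.ext fun n => ?_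
      exact congrArg (fun F => F n)
        (UniversalEnvelopingAlgebra.lift_ι_apply k (LieModule.toEnd k L M.carrier) x)
    have hs : ∀ (a : UniversalEnvelopingAlgebra k L) (n : N),
        (letI := M.envModule; (a • (show M.carrier from n) : M.carrier)) = a • n :=
      fun a n => congrArg (fun F => F a n) key
    exact ⟨M, ⟨@LinearEquiv.toModuleIso (UniversalEnvelopingAlgebra k L) _ M.carrier N _ _
      M.envModule _ (@LinearEquiv.mk _ _ _ _ _ _ _ _ _ _ _ _ M.envModule _
        (@LinearMap.mk _ _ _ _ _ _ _ _ _ M.envModule _ ⟨fun n => n, fun _ _ => rfl⟩ hs)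
        (fun n => n) (fun _ => rfl) (fun _ => rfl))⟩⟩

instance : (toEnv k L).IsEquivalence where

instance : HasFiniteProducts (LieRep k L) :=
  ⟨fun _ => Adjunction.hasLimitsOfShape_of_equivalence (toEnv k L)⟩

instance : (toEnv k L).Additive where
  map_add := rfl

noncomputable instance : Abelian (LieRep k L) := abelianOfEquivalence (toEnv k L)

theorem injective_of_mono {M N : LieRep k L} (f : M ⟶ N) [Mono f] :
    Function.Injective (show M.carrier →ₗ⁅k, L⁆ N.carrier from f) :=
  (ModuleCat.mono_iff_injective ((toEnv k L).map f)).1 inferInstance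

theorem surjective_of_epi {M N : LieRep k L} (f : M ⟶ N) [Epi f] :
    Function.Surjective (show M.carrier →ₗ⁅k, L⁆ N.carrier from f) :=
  (ModuleCat.epi_iff_surjective ((toEnv k L).map f)).1 inferInstance

end Category

end LieRep

namespace LieRep

open scoped TensorProduct DirectSum

section Constructions

variable {k : Type u} [Field k] {L : Type u} [LieRing L] [LieAlgebra k L]

/-- `x ∈ L` acts on `V^{⊗ ι}` as `∑_i 1 ⊗ ⋯ ⊗ x ⊗ ⋯ ⊗ 1`, with `x` in position `i`. -/
noncomputable def tensorAct (V : LieRep k L) (ι : Type) [Fintype ι] [DecidableEq ι] :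
    L →ₗ⁅k⁆ Module.End k (⨂[k] _ : ι, V.carrier) where
  toFun x := ∑ i, PiTensorProduct.map (Pi.mulSingle i (LieModule.toEnd k L V.carrier x))
  map_add' x y := by
    simp only [map_add, Pi.mulSingle, PiTensorProduct.map_update_add, Finset.sum_add_distrib]
  map_smul' c x := by
    simp only [map_smul, Pi.mulSingle, PiTensorProduct.map_update_smul, Finset.smul_sum,
      RingHom.id_apply]
  map_lie' {x y} := by
    let φ := PiTensorProduct.mapMonoidHom (R := k) (s := fun _ : ι => V.carrier)
    have key : ∀ i j (a b : Module.End k V.carrier), i ≠ j →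
        φ (Pi.mulSingle i a) * φ (Pi.mulSingle j b) =
          φ (Pi.mulSingle j b) * φ (Pi.mulSingle i a) := by
      intro i j a b h
      rw [← map_mul, ← map_mul]
      exact congrArg φ (Pi.mulSingle_commute (f := fun _ : ι => Module.End k V.carrier) h a b).eq
    have hd : ∀ i (a b : Module.End k V.carrier),
        φ (Pi.mulSingle i ⁅a, b⁆) = φ (Pi.mulSingle i a) * φ (Pi.mulSingle i b) -
          φ (Pi.mulSingle i b) * φ (Pi.mulSingle i a) := by
      intro i a b
      rw [← map_mul, ← map_mul, ← Pi.mulSingle_mul, ← Pi.mulSingle_mul,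
        LieRing.of_associative_ring_bracket]
      exact (PiTensorProduct.mapMultilinear k (fun _ : ι => V.carrier)
        (fun _ : ι => V.carrier)).map_update_sub 1 i (a * b) (b * a)
    change ∑ i, φ (Pi.mulSingle i _) = ⁅∑ i, φ (Pi.mulSingle i _), ∑ i, φ (Pi.mulSingle i _)⁆
    rw [LieRing.of_associative_ring_bracket (∑ i, _) (∑ i, _), LieHom.map_lie,
      Finset.sum_mul_sum, Finset.sum_mul_sum]
    conv_rhs => rw [Finset.sum_comm (f := fun i j => φ (Pi.mulSingle i
      (LieModule.toEnd k L V.carrier y)) * φ (Pi.mulSingle j (LieModule.toEnd k L V.carrier x)))]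
    rw [← Finset.sum_sub_distrib]
    refine Finset.sum_congr rfl fun i _ => ?_
    rw [← Finset.sum_sub_distrib, Finset.sum_eq_single i, hd]
    · intro j _ hj
      rw [key i j _ _ hj.symm, sub_self]
    · simp

theorem tensorAct_tprod (V : LieRep k L) (ι : Type) [Fintype ι] [DecidableEq ι] (x : L)
    (v : ι → V.carrier) : tensorAct V ι x (PiTensorProduct.tprod k v) =
      ∑ i, PiTensorProduct.tprod k (Function.update v i ⁅x, v i⁆) := by
  change (∑ i, PiTensorProduct.map (Pi.mulSingle i (LieModule.toEnd k L V.carrier x)))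
    (PiTensorProduct.tprod k v) = _
  rw [LinearMap.sum_apply]
  refine Finset.sum_congr rfl fun i _ => ?_
  rw [PiTensorProduct.map_tprod]
  congr 1
  funext j
  by_cases hj : j = i
  · subst hj; simp
  · simp [hj]

/-- A Lie algebra homomorphism `L → End(M)` makes `M` a representation of `L`. -/
noncomputable def ofHom (M : Type u) [AddCommGroup M] [Module k M] (φ : L →ₗ⁅k⁆ Module.End k M) :
    LieRep k L :=
  letI : LieRingModule L M := LieRingModule.compLieHom M φ
  haveI : LieModule k L M := LieModule.compLieHom M φ
  ⟨M⟩

theorem ofHom_lie (M : Type u) [AddCommGroup M] [Module k M] (φ : L →ₗ⁅k⁆ Module.End k M)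
    (x : L) (m : (ofHom M φ).carrier) : ⁅x, m⁆ = φ x m := rfl

/-- The tensor power `V^{⊗ ι}` of a representation, with factors indexed by a finite set. -/
noncomputable def tensorPow (V : LieRep k L) (ι : Type) [Fintype ι] [DecidableEq ι] :
    LieRep k L :=
  ofHom (⨂[k] _ : ι, V.carrier) (tensorAct V ι)

/-- The direct sum of a family of representations. -/
noncomputable def directSum {I : Type u} (M : I → LieRep k L) : LieRep k L :=
  ⟨⨁ i, (M i).carrier⟩

/-- Restriction of a representation along a homomorphism of Lie algebras. -/
noncomputable def res {L' : Type u} [LieRing L'] [LieAlgebra k L'] (φ : L' →ₗ⁅k⁆ L)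
    (M : LieRep k L) : LieRep k L' :=
  letI : LieRingModule L' M.carrier := LieRingModule.compLieHom M.carrier φ
  haveI : LieModule k L' M.carrier := LieModule.compLieHom M.carrier φ
  ⟨M.carrier⟩

/-- `M` is a subquotient of `X`: a quotient of a subrepresentation of `X`. -/
def IsSubquotient (M X : LieRep k L) : Prop :=
  ∃ (A : LieSubmodule k L X.carrier) (f : A →ₗ⁅k, L⁆ M.carrier), Function.Surjective f

theorem IsSubquotient.of_injective {M N X : LieRep k L} (h : N.IsSubquotient X)
    (f : M.carrier →ₗ⁅k, L⁆ N.carrier) (hf : Function.Injective f) : M.IsSubquotient X := by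
  obtain ⟨A, g, hg⟩ := h
  let B : LieSubmodule k L X.carrier := (f.range.comap g).map A.incl
  have hB : ∀ b : B, ∃ m, ∃ h : b.1 ∈ A, g ⟨b.1, h⟩ = f m := by
    rintro ⟨_, hb⟩
    obtain ⟨a, ha, rfl⟩ := (LieSubmodule.mem_map _).1 hb
    obtain ⟨m, hm⟩ := (LieModuleHom.mem_range _ _).1 (LieSubmodule.mem_comap.1 ha)
    exact ⟨m, a.2, hm.symm⟩
  choose φ h1 hφ using hB
  refine ⟨B, { toFun := φ, map_add' := ?_, map_smul' := ?_, map_lie' := ?_ }, ?_⟩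
  · intro b b'
    apply hf
    rw [map_add, ← hφ, ← hφ, ← hφ, ← map_add]
    rfl
  · intro c b
    apply hf
    rw [RingHom.id_apply, map_smul, ← hφ, ← hφ, ← map_smul]
    rfl
  · intro x b
    apply hf
    change f (φ ⁅x, b⁆) = f ⁅x, φ b⁆
    rw [LieModuleHom.map_lie, ← hφ, ← hφ, ← LieModuleHom.map_lie]
    rfl
  · intro m
    obtain ⟨a, ha⟩ := hg (f m)
    have hb : a.1 ∈ B := (LieSubmodule.mem_map _).2
      ⟨a, LieSubmodule.mem_comap.2 ((LieModuleHom.mem_range _ _).2 ⟨m, ha.symm⟩), rfl⟩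
    refine ⟨⟨a.1, hb⟩, hf ?_⟩
    change f (φ _) = _
    rw [← hφ, ← ha]

theorem IsSubquotient.of_surjective {M N X : LieRep k L} (h : M.IsSubquotient X)
    (f : M.carrier →ₗ⁅k, L⁆ N.carrier) (hf : Function.Surjective f) : N.IsSubquotient X := by
  obtain ⟨A, g, hg⟩ := h
  exact ⟨A, f.comp g, hf.comp hg⟩

/-- The product of two representations. -/
def prod (M N : LieRep k L) : LieRep k L :=
  letI : LieRingModule L (M.carrier × N.carrier) :=
    { bracket := fun x p => (⁅x, p.1⁆, ⁅x, p.2⁆)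
      add_lie := fun x y p => Prod.ext (add_lie x y p.1) (add_lie x y p.2)
      lie_add := fun x p q => Prod.ext (lie_add x p.1 q.1) (lie_add x p.2 q.2)
      leibniz_lie := fun x y p => Prod.ext (leibniz_lie x y p.1) (leibniz_lie x y p.2) }
  haveI : LieModule k L (M.carrier × N.carrier) :=
    { smul_lie := fun c x p => Prod.ext (smul_lie c x p.1) (smul_lie c x p.2)
      lie_smul := fun c x p => Prod.ext (lie_smul c x p.1) (lie_smul c x p.2) }
  ⟨M.carrier × N.carrier⟩

end Constructions

section Polynomial

variable {k : Type u} [Field k] {L : Type u} [LieRing L] [LieAlgebra k L] (V : LieRep k L)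

/-- A representation is polynomial (with respect to the tautological representation `V`) if it
is a subquotient of a direct sum of tensor powers of `V`. -/
def isPolynomial : ObjectProperty (LieRep k L) := fun M =>
  ∃ (I : Type u) (d : I → ℕ), M.IsSubquotient (directSum fun i => V.tensorPow (Fin (d i)))

/-- The projection of a direct sum onto the subsum indexed along an injection. -/
noncomputable def directSumProj {I J : Type u} (M : J → LieRep k L) (h : I → J)
    (hh : Function.Injective h) :
    (directSum M).carrier →ₗ⁅k, L⁆ (directSum fun i => M (h i)).carrier where
  toFun z := DFinsupp.comapDomain h hh z
  map_add' z w := DFinsupp.comapDomain_add h hh z w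
  map_smul' c z := DFinsupp.comapDomain_smul h hh c z
  map_lie' {x z} := by
    refine DFinsupp.ext fun i => ?_
    rfl

theorem exists_directSum {I J : Type u} (M : I ⊕ J → LieRep k L)
    (a : (directSum fun i => M (Sum.inl i)).carrier)
    (b : (directSum fun j => M (Sum.inr j)).carrier) :
    ∃ z : (directSum M).carrier, directSumProj M Sum.inl Sum.inl_injective z = a ∧
      directSumProj M Sum.inr Sum.inr_injective z = b := by
  classical
  have h1 : ∃ z : (directSum M).carrier, directSumProj M Sum.inl Sum.inl_injective z = a ∧
      directSumProj M Sum.inr Sum.inr_injective z = 0 := by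
    induction a using DirectSum.induction_on with
    | zero => exact ⟨0, map_zero _, map_zero _⟩
    | of i x =>
      refine ⟨DFinsupp.single (Sum.inl i) x, ?_, ?_⟩
      · exact DFinsupp.comapDomain_single (β := fun s => (M s).carrier) Sum.inl Sum.inl_injective i x
      · refine DFinsupp.ext fun j => ?_
        exact DFinsupp.single_eq_of_ne (i := Sum.inl i) (i' := Sum.inr j) (b := x) (by simp)
    | add x y hx hy =>
      obtain ⟨z, hz, hz'⟩ := hx
      obtain ⟨w, hw, hw'⟩ := hy
      exact ⟨z + w, by rw [map_add, hz, hw]; rfl, by rw [map_add, hz', hw', add_zero]⟩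
  have h2 : ∃ z : (directSum M).carrier, directSumProj M Sum.inl Sum.inl_injective z = 0 ∧
      directSumProj M Sum.inr Sum.inr_injective z = b := by
    induction b using DirectSum.induction_on with
    | zero => exact ⟨0, map_zero _, map_zero _⟩
    | of i x =>
      refine ⟨DFinsupp.single (Sum.inr i) x, ?_, ?_⟩
      · refine DFinsupp.ext fun j => ?_
        exact DFinsupp.single_eq_of_ne (i := Sum.inr i) (i' := Sum.inl j) (b := x) (by simp)
      · exact DFinsupp.comapDomain_single (β := fun s => (M s).carrier) Sum.inr Sum.inr_injective i x
    | add x y hx hy =>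
      obtain ⟨z, hz, hz'⟩ := hx
      obtain ⟨w, hw, hw'⟩ := hy
      exact ⟨z + w, by rw [map_add, hz, hw, add_zero], by rw [map_add, hz', hw']; rfl⟩
  obtain ⟨z, hz, hz'⟩ := h1
  obtain ⟨w, hw, hw'⟩ := h2
  exact ⟨z + w, by rw [map_add, hz, hw, add_zero], by rw [map_add, hz', hw', zero_add]⟩

theorem isPolynomial_prod {M N : LieRep k L} (hM : V.isPolynomial M) (hN : V.isPolynomial N) :
    V.isPolynomial (M.prod N) := by
  obtain ⟨I, d, A, f, hf⟩ := hM
  obtain ⟨J, e, B, g, hg⟩ := hN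
  let T : I ⊕ J → LieRep k L := fun s => V.tensorPow (Fin (Sum.elim d e s))
  let p := directSumProj T Sum.inl Sum.inl_injective
  let q := directSumProj T Sum.inr Sum.inr_injective
  refine ⟨I ⊕ J, Sum.elim d e, A.comap p ⊓ B.comap q,
    { toFun := fun z => (f ⟨p z.1, z.2.1⟩, g ⟨q z.1, z.2.2⟩)
      map_add' := fun z w => Prod.ext ?_ ?_
      map_smul' := fun c z => Prod.ext ?_ ?_
      map_lie' := fun {x z} => Prod.ext ?_ ?_ }, ?_⟩
  · exact (congrArg f (Subtype.ext (map_add p z.1 w.1))).trans (map_add f _ _)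
  · exact (congrArg g (Subtype.ext (map_add q z.1 w.1))).trans (map_add g _ _)
  · exact (congrArg f (Subtype.ext (map_smul p c z.1))).trans (map_smul f c _)
  · exact (congrArg g (Subtype.ext (map_smul q c z.1))).trans (map_smul g c _)
  · exact (congrArg f (Subtype.ext (p.map_lie x z.1))).trans (f.map_lie x _)
  · exact (congrArg g (Subtype.ext (q.map_lie x z.1))).trans (g.map_lie x _)
  · rintro ⟨m, n⟩
    obtain ⟨a, rfl⟩ := hf m
    obtain ⟨b, rfl⟩ := hg n
    obtain ⟨z, hz, hz'⟩ := exists_directSum T a.1 b.1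
    refine ⟨⟨z, ?_, ?_⟩, Prod.ext (congrArg f (Subtype.ext hz)) (congrArg g (Subtype.ext hz'))⟩
    · change p z ∈ A
      rw [show p z = a.1 from hz]
      exact a.2
    · change q z ∈ B
      rw [show q z = b.1 from hz']
      exact b.2

instance : V.isPolynomial.ContainsZero where
  exists_zero := by
    let Z : LieRep k L := directSum (I := PEmpty) (fun _ => V)
    have : Subsingleton Z.carrier := ⟨fun a b => DFinsupp.ext fun i => i.elim⟩
    refine ⟨Z, ?_, PEmpty, PEmpty.elim, ⊤, 0, fun z => ⟨0, Subsingleton.elim _ _⟩⟩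
    rw [IsZero.iff_id_eq_zero]
    exact LieModuleHom.ext fun m => Subsingleton.elim _ _

instance : V.isPolynomial.IsClosedUnderSubobjects where
  prop_of_mono f _ h := by
    obtain ⟨I, d, h⟩ := h
    exact ⟨I, d, h.of_injective _ (injective_of_mono f)⟩

instance : V.isPolynomial.IsClosedUnderQuotients where
  prop_of_epi f _ h := by
    obtain ⟨I, d, h⟩ := h
    exact ⟨I, d, h.of_surjective _ (surjective_of_epi f)⟩

instance : V.isPolynomial.IsClosedUnderBinaryProducts where
  limitsOfShape_le := by
    rintro X ⟨p⟩
    let Y (j : WalkingPair) : LieRep k L := p.diag.obj ⟨j⟩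
    let a (j : WalkingPair) : X.carrier →ₗ⁅k, L⁆ (Y j).carrier := p.π.app ⟨j⟩
    let f : X ⟶ (Y .left).prod (Y .right) :=
      (show X.carrier →ₗ⁅k, L⁆ ((Y .left).prod (Y .right)).carrier from
      { toFun := fun m => (a .left m, a .right m)
        map_add' := fun m n => Prod.ext (map_add (a .left) m n) (map_add (a .right) m n)
        map_smul' := fun c m => Prod.ext (map_smul (a .left) c m) (map_smul (a .right) c m)
        map_lie' := fun {x m} => Prod.ext ((a .left).map_lie x m) ((a .right).map_lie x m) })
    have : Mono f := by
      refine ⟨fun {Z} g h e => p.isLimit.hom_ext ?_⟩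
      rintro ⟨_ | _⟩
      · exact LieModuleHom.ext fun z => congrArg Prod.fst (LieModuleHom.congr_fun e z)
      · exact LieModuleHom.ext fun z => congrArg Prod.snd (LieModuleHom.congr_fun e z)
    exact V.isPolynomial.prop_of_mono f
      (V.isPolynomial_prod (p.prop_diag_obj _) (p.prop_diag_obj _))

instance : V.isPolynomial.IsClosedUnderFiniteProducts := .mk'

/-- The category of polynomial representations. -/
abbrev PolRep : Type (u + 1) := V.isPolynomial.FullSubcategory

end Polynomial

end LieRep

namespace LieRep

open scoped TensorProduct

section Schur

variable {k : Type u} [Field k] {L : Type u} [LieRing L] [LieAlgebra k L] (V : LieRep k L)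

/-- A permutation of the index set acts on the tensor power by permuting the factors. -/
noncomputable def permHom (ι : Type) [Fintype ι] [DecidableEq ι] (σ : Equiv.Perm ι) :
    (V.tensorPow ι).carrier →ₗ⁅k, L⁆ (V.tensorPow ι).carrier where
  toLinearMap := (PiTensorProduct.reindex k (fun _ : ι => V.carrier) σ).toLinearMap
  map_lie' {x m} := by
    change PiTensorProduct.reindex k (fun _ : ι => V.carrier) σ (tensorAct V ι x m) =
      tensorAct V ι x (PiTensorProduct.reindex k (fun _ : ι => V.carrier) σ m)
    have h : (PiTensorProduct.reindex k (fun _ : ι => V.carrier) σ).toLinearMap ∘ₗ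
        tensorAct V ι x =
        tensorAct V ι x ∘ₗ (PiTensorProduct.reindex k (fun _ : ι => V.carrier) σ).toLinearMap := by
      refine PiTensorProduct.ext (MultilinearMap.ext fun v => ?_)
      change PiTensorProduct.reindex k (fun _ : ι => V.carrier) σ
        (tensorAct V ι x (PiTensorProduct.tprod k v)) = tensorAct V ι x
        (PiTensorProduct.reindex k (fun _ : ι => V.carrier) σ (PiTensorProduct.tprod k v))
      rw [tensorAct_tprod, map_sum, PiTensorProduct.reindex_tprod, tensorAct_tprod]
      refine Fintype.sum_equiv σ _ _ fun i => ?_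
      rw [PiTensorProduct.reindex_tprod]
      congr 1
      funext j
      by_cases hj : j = σ i
      · subst hj; simp
      · rw [Function.update_of_ne hj, Function.update_of_ne]
        rintro rfl
        simp at hj
    exact congrArg (fun F => F m) h

open Classical in
/-- The Young symmetrizer of a Young diagram `μ`, acting on the tensor power indexed by the cells
of `μ`: the sum of `sign(q) p q` over the permutations `p` preserving the rows and the
permutations `q` preserving the columns. -/
noncomputable def youngSymmetrizer (μ : YoungDiagram) :
    (V.tensorPow μ.cells).carrier →ₗ⁅k, L⁆ (V.tensorPow μ.cells).carrier :=
  ∑ p : Equiv.Perm μ.cells with ∀ c, (p c).1.1 = c.1.1,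
    ∑ q : Equiv.Perm μ.cells with ∀ c, (q c).1.2 = c.1.2,
      (Equiv.Perm.sign q : ℤ) • (V.permHom μ.cells p).comp (V.permHom μ.cells q)

/-- The Schur functor `S_μ` applied to a representation, as the image of the Young symmetrizer. -/
noncomputable def schur (μ : YoungDiagram) : LieRep k L := ⟨(V.youngSymmetrizer μ).range⟩

end Schur

end LieRep

namespace LinearOperad

section Specialization

variable {k : Type u} [Field k] (P : LinearOperad k)

/-- The tautological representation of `𝔥_n` on `V_n`. -/
noncomputable def VRep (n : ℕ) : LieRep k (P.hFin n) := LieRep.ofHom (P.V n) (P.hFin n).incl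

/-- The tautological representation of `𝔥` on `V`. -/
noncomputable def VInfRep : LieRep k P.hInf := LieRep.ofHom P.VInf P.hInf.incl

/-- The tautological representation `W` of `𝔤𝔩`. -/
noncomputable def WRep (k : Type u) [Field k] : LieRep k (glInf k) :=
  LieRep.ofHom (ℕ →₀ k) (glInf k).incl

/-- The space of `𝔤𝔩_{∞-n}`-invariants of a representation of `𝔥`. -/
def invariants (n : ℕ) (M : LieRep k P.hInf) : Submodule k M.carrier where
  carrier := {m | ∀ g : glTail k n, ⁅P.glToH g.1, m⁆ = 0}
  add_mem' {m m'} h h' g := by rw [lie_add, h g, h' g, add_zero]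
  zero_mem' g := lie_zero _
  smul_mem' c m h g := by rw [lie_smul, h g, smul_zero]

variable {P} in
theorem lie_extend_mem {n : ℕ} {M : LieRep k P.hInf} (δ : P.hFin n) {m : M.carrier}
    (h : m ∈ P.invariants n M) : ⁅P.extend n δ, m⁆ ∈ P.invariants n M := by
  intro g
  rw [leibniz_lie, lie_glToH_extend, zero_lie, h g, lie_zero, add_zero]

/-- The `𝔤𝔩_{∞-n}`-invariants of a representation of `𝔥`, as a representation of `𝔥_n`. -/
noncomputable def gammaObj (n : ℕ) (M : LieRep k P.hInf) : LieRep k (P.hFin n) :=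
  letI : LieRingModule (P.hFin n) (P.invariants n M) :=
    { bracket := fun δ m => ⟨⁅P.extend n δ, m.1⁆, lie_extend_mem δ m.2⟩
      add_lie := fun δ δ' m => Subtype.ext <| by
        change ⁅P.extend n (δ + δ'), m.1⁆ = ⁅P.extend n δ, m.1⁆ + ⁅P.extend n δ', m.1⁆
        rw [map_add, add_lie]
      lie_add := fun δ m m' => Subtype.ext (lie_add _ _ _)
      leibniz_lie := fun δ δ' m => Subtype.ext <| by
        change ⁅P.extend n δ, ⁅P.extend n δ', m.1⁆⁆ =
          ⁅P.extend n ⁅δ, δ'⁆, m.1⁆ + ⁅P.extend n δ', ⁅P.extend n δ, m.1⁆⁆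
        rw [LieHom.map_lie, leibniz_lie] }
  haveI : LieModule k (P.hFin n) (P.invariants n M) :=
    { smul_lie := fun c δ m => Subtype.ext <| by
        change ⁅P.extend n (c • δ), m.1⁆ = c • ⁅P.extend n δ, m.1⁆
        rw [map_smul, smul_lie]
      lie_smul := fun c δ m => Subtype.ext (lie_smul _ _ _) }
  ⟨P.invariants n M⟩

/-- The functor of `𝔤𝔩_{∞-n}`-invariants, from representations of `𝔥` to those of `𝔥_n`. -/
noncomputable def Gamma (n : ℕ) : LieRep k P.hInf ⥤ LieRep k (P.hFin n) where
  obj M := P.gammaObj n M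
  map {M N} f :=
    let F : M.carrier →ₗ⁅k, P.hInf⁆ N.carrier := f
    (show (P.gammaObj n M).carrier →ₗ⁅k, P.hFin n⁆ (P.gammaObj n N).carrier from
      { toFun := fun m => ⟨F m.1, fun g => by rw [← F.map_lie, m.2 g, map_zero]⟩
        map_add' := fun m m' => Subtype.ext (map_add F m.1 m'.1)
        map_smul' := fun c m => Subtype.ext (map_smul F c m.1)
        map_lie' := fun {δ m} => Subtype.ext (F.map_lie (P.extend n δ) m.1) })

/-- The category `𝒦_n`: the polynomial representations of `𝔥` whose simple `𝔤𝔩`-factors all have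
the form `S_μ(W)` with `μ` having more than `n` rows. -/
def serreK (n : ℕ) : ObjectProperty P.VInfRep.PolRep := fun M =>
  ∀ T : LieRep k (glInf k), LieModule.IsIrreducible k (glInf k) T.carrier →
    T.IsSubquotient (M.obj.res P.glToH) →
    ∃ μ : YoungDiagram, n < μ.colLen 0 ∧ Nonempty (T ≅ (WRep k).schur μ)

/-- The specialization functor on polynomial representations, given that the invariants of a
polynomial representation of `𝔥` form a polynomial representation of `𝔥_n`. -/
noncomputable def gammaPol (n : ℕ)
    (h : ∀ M : P.VInfRep.PolRep, (P.VRep n).isPolynomial ((P.Gamma n).obj M.obj)) :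
    P.VInfRep.PolRep ⥤ (P.VRep n).PolRep :=
  (P.VRep n).isPolynomial.lift (P.VInfRep.isPolynomial.ι ⋙ P.Gamma n) h

end Specialization

end LinearOperad

/-- A locally noetherian category: a Grothendieck category with a set of noetherian generators. -/
def IsLocallyNoetherian (C : Type (u + 1)) [Category.{u} C] [Abelian C] : Prop :=
  IsGrothendieckAbelian.{u} C ∧
    ∃ (I : Type u) (G : I → C), (∀ i, IsNoetherianObject (G i)) ∧
      (ObjectProperty.ofObj G).IsSeparating

/-! ### Serre quotients by the kernel of an exact functor -/

namespace CategoryTheory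

open Limits

variable {C D : Type*} [Category* C] [Abelian C] [Category* D] [Abelian D]

/-! Everything rests on one splitting. Restricted to `𝔤𝔩`, a polynomial `𝔥`-module `M` is spanned by
weight vectors with nonnegative integral weights. A weight vector whose weight vanishes at all
indices `≥ n` is killed by `𝔤𝔩_{∞-n}`: a matrix unit `E_ij` with `i ≠ j` and `i, j ≥ n` would create
a weight entry `-1`. Conversely an invariant has no component of any other weight. So `M` is the
direct sum of its invariants (`tailInv`) and of the span `tailPos` of the other weight vectors,
naturally in `M`, and `Γ_n` is exact. On `V^{⊗d}` the invariants are exactly `V_n^{⊗d}`; exactness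
then shows that `Γ_n` preserves polynomial representations.

The second ingredient compares `𝔥`-submodules with `𝔥_n`-submodules. Every element of `𝔥` is a sum
of an element of `𝔥_n`, a derivation with values in the kernel of the retraction `V → V_n`
(`posDer`) and a derivation killing `V_n` (`tailDer`). On tensor powers of `V`, hence on all
polynomial modules, `tailDer` annihilates the invariants and `posDer` maps everything into
`tailPos`; this is `IsTailRegular`. Consequently the `𝔥`-submodule generated by an `𝔥_n`-stable
space `B` of invariants lies in `B + tailPos`, and its invariants are exactly `B`
(`IsTailRegular.mem_of_mem_lieSpan`).

This one fact has three uses. If `N = A / A'` with `A' ⊆ A` inside a sum of tensor powers of `V_n`,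
the quotient of the `𝔥`-submodules generated by `A` and `A'` has invariants `N`, so `Γ_n` is
essentially surjective (`exists_gamma_iso`). Given `g : Γ_n M → Γ_n N`, the `𝔥`-submodule of `M × N`
generated by the graph of `g` has that graph as invariants, so it is a roof representing `g`
(`exists_gamma_roof`). Finally, submodules of `Γ_n M` embed in submodules of `M` by an order
embedding, which transfers the noetherian condition.

It remains to identify `𝒦_n` with the kernel of `Γ_n` (`serreK_iff`). By highest weight theory and
the Young symmetrizer, a simple `𝔤𝔩`-module of the present kind is some `S_μ(W)`. It has nonzero
invariants exactly when `μ` has at most `n` rows: in that case its highest weight vector is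
invariant, while for more rows every word in `n` letters repeats a letter in the first column and is
killed by the symmetrizer. An exact functor with the properties above induces an equivalence from
the Serre quotient by its kernel. -/

/-- An exact functor which is essentially surjective, and full and faithful up to the Serre class
of the objects that it kills, induces an equivalence from the Serre quotient. -/
theorem Abelian.isEquivalence_lift_of_exact (G : C ⥤ D) [PreservesFiniteLimits G]
    [PreservesFiniteColimits G] [G.EssSurj]
    (hfull : ∀ {M N : C} (g : G.obj M ⟶ G.obj N), ∃ (E : C) (s : E ⟶ M) (t : E ⟶ N),
      IsIso (G.map s) ∧ G.map s ≫ g = G.map t)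
    (K : ObjectProperty C) [K.IsSerreClass] (hK : ∀ X, K X ↔ IsZero (G.obj X))
    (hinv : K.isoModSerre.IsInvertedBy G) :
    (Localization.Construction.lift G hinv).IsEquivalence := by
  have hKG : K = G.kernel := by
    ext X; exact hK X
  have hiso : K.isoModSerre = (MorphismProperty.isomorphisms D).inverseImage G := by
    subst hKG
    exact Abelian.isoModSerre_kernel_eq_inverseImage_isomorphisms G
  have hadd : G.Additive := G.additive_of_preserves_binary_products
  let W := K.isoModSerre
  let F := Localization.Construction.lift G hinv
  have hF : ∀ {X Y : C} (f : X ⟶ Y), F.map (W.Q.map f) = G.map f := by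
    intro X Y f
    have := Functor.congr_hom (Localization.Construction.fac G hinv) f
    exact this.trans ((Category.id_comp _).trans (Category.comp_id _))
  -- `G` keeps the image factorization an epimorphism followed by a monomorphism, so it kills the
  -- image of any morphism that it kills.
  have h0 : ∀ {X Y : C} (f : X ⟶ Y), G.map f = 0 → K (Abelian.image f) := by
    intro X Y f hf
    rw [hK]
    have h1 : G.map (Abelian.factorThruImage f) ≫ G.map (Abelian.image.ι f) = 0 := by
      rw [← G.map_comp, Abelian.image.fac, hf]
    have h2 : G.map (Abelian.image.ι f) = 0 := by
      rw [← cancel_epi (G.map (Abelian.factorThruImage f)), h1, comp_zero]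
    exact IsZero.of_mono_eq_zero _ h2
  have hfaith : F.Faithful := by
    refine ⟨?_⟩
    intro A B f f' h
    obtain ⟨X, rfl⟩ : ∃ X, W.Q.obj X = A := ⟨A.as.obj, rfl⟩
    obtain ⟨Y, rfl⟩ : ∃ Y, W.Q.obj Y = B := ⟨B.as.obj, rfl⟩
    obtain ⟨φ, hφ⟩ := Localization.exists_rightFraction W.Q W f
    have e1 : W.Q.map φ.s ≫ f = W.Q.map φ.f := by
      rw [hφ, MorphismProperty.RightFraction.map_s_comp_map]
    -- Taking a fraction for `φ.s ≫ f'` rather than for `f'` puts both morphisms over a common apex,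
    -- where they are compared in `C` through `ψ.f - ψ.s ≫ φ.f`.
    obtain ⟨ψ, hψ⟩ := Localization.exists_rightFraction W.Q W (W.Q.map φ.s ≫ f')
    have e2 : W.Q.map ψ.s ≫ W.Q.map φ.s ≫ f' = W.Q.map ψ.f := by
      rw [hψ, MorphismProperty.RightFraction.map_s_comp_map]
    have e3 : G.map (ψ.f - ψ.s ≫ φ.f) = 0 := by
      rw [G.map_sub, sub_eq_zero, ← hF, ← hF, ← e2, W.Q.map_comp, ← e1]
      simp only [F.map_comp]
      rw [h]
    obtain ⟨Z, s, hs, hs0⟩ := (K.exists_isoModSerre_comp_eq_zero_iff _).2 (h0 _ e3)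
    have i1 := Localization.inverts W.Q W _ hs
    have i2 := Localization.inverts W.Q W _ φ.hs
    have i3 := Localization.inverts W.Q W _ ψ.hs
    rw [← cancel_epi (W.Q.map φ.s), ← cancel_epi (W.Q.map ψ.s), e2, e1,
      ← W.Q.map_comp, ← cancel_epi (W.Q.map s), ← W.Q.map_comp, ← W.Q.map_comp]
    rw [Preadditive.comp_sub, sub_eq_zero] at hs0
    rw [hs0]
  have hfull' : F.Full := by
    refine ⟨?_⟩
    intro A B g
    obtain ⟨X, rfl⟩ : ∃ X, W.Q.obj X = A := ⟨A.as.obj, rfl⟩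
    obtain ⟨Y, rfl⟩ : ∃ Y, W.Q.obj Y = B := ⟨B.as.obj, rfl⟩
    obtain ⟨E, s, t, hs, hst⟩ := hfull (M := X) (N := Y) g
    have hW : W s := by
      change K.isoModSerre s
      rw [hiso]
      exact hs
    have i1 := Localization.inverts W.Q W _ hW
    refine ⟨inv (W.Q.map s) ≫ W.Q.map t, ?_⟩
    have : IsIso (F.map (W.Q.map s)) := inferInstance
    rw [← cancel_epi (F.map (W.Q.map s)), ← F.map_comp, IsIso.hom_inv_id_assoc, hF, hF, ← hst]
    rfl
  have hess : F.EssSurj := by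
    refine ⟨fun Y => ?_⟩
    obtain ⟨X, ⟨e⟩⟩ := Functor.EssSurj.mem_essImage (F := G) Y
    exact ⟨W.Q.obj X, ⟨e⟩⟩
  exact { faithful := hfaith, full := hfull', essSurj := hess }

end CategoryTheory

namespace LinearOperad

/-! ### Matrix units of `𝔤𝔩` -/

section MatUnits

variable (k : Type u) [Field k]

/-- The matrix unit `E_ij` in `𝔤𝔩`, sending `e_j` to `e_i`. -/
noncomputable def matUnit (i j : ℕ) : glInf k :=
  ⟨Finsupp.lsingle i ∘ₗ Finsupp.lapply j, j + 1, fun l hl => by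
    have : l ≠ j := by omega
    simp [this]⟩

variable {k}

theorem matUnit_single (i j l : ℕ) (c : k) :
    (matUnit k i j).1 (Finsupp.single l c) = if l = j then Finsupp.single i c else 0 := by
  by_cases h : l = j
  · simp [matUnit, h]
  · simp [matUnit, h]

theorem glInf_ext {g g' : glInf k}
    (h : ∀ i, g.1 (Finsupp.single i 1) = g'.1 (Finsupp.single i 1)) : g = g' :=
  Subtype.ext (Finsupp.lhom_ext' fun i => LinearMap.ext_ring (h i))

theorem matUnit_lie (i j p q : ℕ) : ⁅matUnit k i j, matUnit k p q⁆ =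
    (if p = j then matUnit k i q else 0) - (if i = q then matUnit k p j else 0) := by
  refine glInf_ext fun l => ?_
  have h : (⁅matUnit k i j, matUnit k p q⁆ : glInf k).1 (Finsupp.single l 1) =
      (matUnit k i j).1 ((matUnit k p q).1 (Finsupp.single l 1)) -
        (matUnit k p q).1 ((matUnit k i j).1 (Finsupp.single l 1)) := by
    simp [LieRing.of_associative_ring_bracket]
  rw [h]
  have h1 : ∀ (c : Prop) [Decidable c] (x : glInf k) (w : ℕ →₀ k),
      (if c then x else 0 : glInf k).1 w = if c then x.1 w else 0 := by
    intro c _ x w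
    split_ifs <;> rfl
  change _ = (if p = j then matUnit k i q else 0 : glInf k).1 _ -
    (if i = q then matUnit k p j else 0 : glInf k).1 _
  rw [h1, h1, matUnit_single, matUnit_single, matUnit_single, matUnit_single]
  have h2 : ∀ (c : Prop) [Decidable c] (x : glInf k) (y : ℕ),
      x.1 (if c then Finsupp.single y 1 else 0) = if c then x.1 (Finsupp.single y 1) else 0 := by
    intro c _ x w
    split_ifs
    · rfl
    · exact map_zero _
  rw [h2, h2, matUnit_single, matUnit_single]
  congr 1 <;> split_ifs <;> rfl

/-- Only matrix units at nonzero entries of `g` are allowed, so that for `g` in `glTail k n` all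
those that occur have both indices `≥ n`. -/
theorem mem_span_matUnit (g : glInf k) : g ∈ Submodule.span k
    {x | ∃ i j, (g.1 (Finsupp.single j 1) i ≠ 0) ∧ x = matUnit k i j} := by
  obtain ⟨m, hm⟩ := g.2
  have : g = ∑ j ∈ Finset.range m, ∑ i ∈ (g.1 (Finsupp.single j 1)).support,
      (g.1 (Finsupp.single j 1) i) • matUnit k i j := by
    refine glInf_ext fun l => ?_
    have hs : ∀ (s : Finset ℕ) (f : ℕ → glInf k) (w : ℕ →₀ k),
        (∑ j ∈ s, f j : glInf k).1 w = ∑ j ∈ s, (f j).1 w := by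
      intro s f w
      rw [AddSubmonoidClass.coe_finsetSum, LinearMap.sum_apply]
    rw [hs]
    have h1 : ∀ j, (∑ i ∈ (g.1 (Finsupp.single j 1)).support,
        (g.1 (Finsupp.single j 1) i) • matUnit k i j : glInf k).1 (Finsupp.single l 1) =
        if l = j then g.1 (Finsupp.single j 1) else 0 := by
      intro j
      rw [hs]
      split_ifs with h
      · subst h
        conv_rhs => rw [← Finsupp.sum_single (g.1 (Finsupp.single l 1))]
        refine Finset.sum_congr rfl fun i _ => ?_
        change (g.1 (Finsupp.single l 1) i) • (matUnit k i l).1 _ = _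
        rw [matUnit_single, if_pos rfl, Finsupp.smul_single, smul_eq_mul, mul_one]
      · refine Finset.sum_eq_zero fun i _ => ?_
        change (g.1 (Finsupp.single j 1) i) • (matUnit k i j).1 _ = _
        rw [matUnit_single, if_neg h, smul_zero]
    simp only [h1]
    rw [Finset.sum_ite_eq]
    split_ifs with h
    · rfl
    · exact hm l (by simpa using h)
  rw [this]
  refine Submodule.sum_mem _ fun j _ => Submodule.sum_mem _ fun i hi => ?_
  refine Submodule.smul_mem _ _ (Submodule.subset_span ⟨i, j, ?_, rfl⟩)
  rw [← this]
  exact Finsupp.mem_support_iff.1 hi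

theorem matUnit_mem_glTail {n i j : ℕ} (hi : n ≤ i) (hj : n ≤ j) :
    matUnit k i j ∈ glTail k n := by
  refine ⟨fun l hl => ?_, fun w l hl => ?_⟩
  · rw [matUnit_single, if_neg (by omega)]
  · change Finsupp.single i (w j) l = 0
    rw [Finsupp.single_apply, if_neg (by omega)]

end MatUnits

/-! ### Weight spaces and modules with nonnegative integral weights -/

section Weights

variable {k : Type u} [Field k]
variable (M : Type*) [AddCommGroup M] [Module k M] [LieRingModule (glInf k) M]
  [LieModule k (glInf k) M]

/-- The weight space of weight `a` of a `𝔤𝔩`-module. -/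
def wtSpace (a : ℕ →₀ ℤ) : Submodule k M where
  carrier := {m | ∀ j, ⁅matUnit k j j, m⁆ = (a j : k) • m}
  add_mem' h h' j := by rw [lie_add, h j, h' j, smul_add]
  zero_mem' j := by simp
  smul_mem' c m h j := by rw [lie_smul, h j, smul_comm]

/-- A `𝔤𝔩`-module spanned by weight vectors of nonnegative integral weights. -/
def IsWeightModule (k : Type u) [Field k] (M : Type*) [AddCommGroup M] [Module k M]
    [LieRingModule (glInf k) M] [LieModule k (glInf k) M] : Prop :=
  Submodule.span k {v : M | ∃ a : ℕ →₀ ℤ, 0 ≤ a ∧ v ∈ wtSpace (k := k) M a} = ⊤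

variable {M}

theorem matUnit_mem_wtSpace {a : ℕ →₀ ℤ} {m : M} (h : m ∈ wtSpace (k := k) M a) (i j : ℕ) :
    ⁅matUnit k i j, m⁆ ∈ wtSpace (k := k) M (a + Finsupp.single i 1 - Finsupp.single j 1) := by
  intro l
  rw [leibniz_lie, h l, matUnit_lie, lie_smul]
  by_cases h1 : i = l <;> by_cases h2 : j = l
  · subst h1; subst h2; simp
  · subst h1; simp [Ne.symm h2, add_smul, add_comm]
  · subst h2; simp [h1, sub_smul]; abel
  · simp [h1, Ne.symm h2]

theorem wtSpace_map {N : Type*} [AddCommGroup N] [Module k N] [LieRingModule (glInf k) N]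
    [LieModule k (glInf k) N] (f : M →ₗ⁅k, glInf k⁆ N) {a : ℕ →₀ ℤ} {m : M}
    (h : m ∈ wtSpace (k := k) M a) : f m ∈ wtSpace (k := k) N a := fun j => by
  rw [← f.map_lie, h j, map_smul]

variable [CharZero k]

/-- If weights `a` and `b` differ at `j`, then `E_jj - b_j` removes the component of weight `b` and
multiplies that of weight `a` by `a_j - b_j`, which is nonzero in characteristic 0. Induction on the
number of components does the rest. -/
theorem mem_of_sum_wt_mem (A : Submodule k M) (hA : ∀ j, ∀ m ∈ A, ⁅matUnit k j j, m⁆ ∈ A)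
    (S : Finset (ℕ →₀ ℤ)) (v : (ℕ →₀ ℤ) → M) (hv : ∀ a ∈ S, v a ∈ wtSpace (k := k) M a)
    (h : ∑ a ∈ S, v a ∈ A) : ∀ a ∈ S, v a ∈ A := by
  classical
  induction hn : S.card generalizing S v with
  | zero =>
    intro a ha
    rw [Finset.card_eq_zero] at hn
    simp [hn] at ha
  | succ n ih =>
    intro a ha
    by_cases hb : ∃ b ∈ S, b ≠ a
    · obtain ⟨b, hb, hba⟩ := hb
      obtain ⟨j, hj⟩ : ∃ j, b j ≠ a j := by
        by_contra! hc
        exact hba (Finsupp.ext hc)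
      have key : ∑ c ∈ S.erase b, ((c j : k) - (b j : k)) • v c ∈ A := by
        have h1 : ⁅matUnit k j j, ∑ c ∈ S, v c⁆ - (b j : k) • ∑ c ∈ S, v c ∈ A :=
          A.sub_mem (hA j _ h) (A.smul_mem _ h)
        have h2 : ⁅matUnit k j j, ∑ c ∈ S, v c⁆ - (b j : k) • ∑ c ∈ S, v c =
            ∑ c ∈ S, ((c j : k) - (b j : k)) • v c := by
          rw [lie_sum, Finset.smul_sum, ← Finset.sum_sub_distrib]
          refine Finset.sum_congr rfl fun c hc => ?_
          rw [hv c hc j, sub_smul]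
        rw [h2, ← Finset.add_sum_erase _ _ hb, sub_self, zero_smul, zero_add] at h1
        exact h1
      have := ih (S.erase b) (fun c => ((c j : k) - (b j : k)) • v c)
        (fun c hc => Submodule.smul_mem _ _ (hv c (Finset.mem_of_mem_erase hc))) key
        (by rw [Finset.card_erase_of_mem hb, hn]; rfl) a (Finset.mem_erase.2 ⟨hba.symm, ha⟩)
      have hne : ((a j : k) - (b j : k)) ≠ 0 := by
        rw [sub_ne_zero]
        exact fun e => hj (Int.cast_injective e).symm
      exact (A.smul_mem_iff hne).1 this
    · push Not at hb
      have : S = {a} := Finset.eq_singleton_iff_unique_mem.2 ⟨ha, hb⟩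
      subst this
      simpa using h

/-- A family of weight vectors with prescribed sum lying in a torus-stable subspace. -/
theorem mem_of_finsupp_wt_mem (A : Submodule k M)
    (hA : ∀ j, ∀ m ∈ A, ⁅matUnit k j j, m⁆ ∈ A) (v : (ℕ →₀ ℤ) →₀ M)
    (hv : ∀ a, v a ∈ wtSpace (k := k) M a) (h : (v.sum fun _ m => m) ∈ A) (a : ℕ →₀ ℤ) :
    v a ∈ A := by
  by_cases ha : a ∈ v.support
  · exact mem_of_sum_wt_mem A hA v.support v (fun a _ => hv a) h a ha
  · rw [Finsupp.notMem_support_iff.1 ha]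
    exact A.zero_mem

theorem finsupp_wt_eq_of_sum_eq (v w : (ℕ →₀ ℤ) →₀ M)
    (hv : ∀ a, v a ∈ wtSpace (k := k) M a) (hw : ∀ a, w a ∈ wtSpace (k := k) M a)
    (h : (v.sum fun _ m => m) = w.sum fun _ m => m) : v = w := by
  have := mem_of_finsupp_wt_mem (⊥ : Submodule k M) (by simp) (v - w)
    (fun a => Submodule.sub_mem _ (hv a) (hw a)) (by
      rw [Finsupp.sum_sub_index (by simp), h, sub_self]
      exact Submodule.zero_mem _)
  exact sub_eq_zero.1 (Finsupp.ext this)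

theorem finsupp_wt_eq_single {v : (ℕ →₀ ℤ) →₀ M}
    (hv : ∀ a, v a ∈ wtSpace (k := k) M a) {a : ℕ →₀ ℤ} {m : M} (hm : m ∈ wtSpace (k := k) M a)
    (h : (v.sum fun _ m => m) = m) : v = Finsupp.single a m := by
  classical
  refine finsupp_wt_eq_of_sum_eq (k := k) v _ hv (fun b => ?_) (by rw [h]; simp)
  rw [Finsupp.single_apply]
  split_ifs with hb
  · exact hb ▸ hm
  · exact Submodule.zero_mem _

omit [LieRingModule (glInf k) M] [LieModule k (glInf k) M] [CharZero k] in
-- The terms of a linear combination are grouped by their labels `κ`. Weights play no role yet; the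
-- labels become weights in the applications.
theorem exists_finsupp_wt_of_mem_span {ι : Type*} (x : ι → M) (κ : ι → (ℕ →₀ ℤ))
    {m : M} (hm : m ∈ Submodule.span k (Set.range x)) :
    ∃ v : (ℕ →₀ ℤ) →₀ M, (∀ a, v a ∈ Submodule.span k (x '' {i | κ i = a})) ∧
      (v.sum fun _ m => m) = m := by
  classical
  induction hm using Submodule.span_induction with
  | mem y hy =>
    obtain ⟨i, rfl⟩ := hy
    refine ⟨Finsupp.single (κ i) (x i), fun a => ?_, by simp⟩
    rw [Finsupp.single_apply]
    split_ifs with h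
    · exact Submodule.subset_span ⟨i, h, rfl⟩
    · exact Submodule.zero_mem _
  | zero => exact ⟨0, fun a => Submodule.zero_mem _, by simp⟩
  | add y z _ _ hy hz =>
    obtain ⟨v, hv, rfl⟩ := hy
    obtain ⟨w, hw, rfl⟩ := hz
    exact ⟨v + w, fun a => Submodule.add_mem _ (hv a) (hw a),
      Finsupp.sum_add_index' (fun _ => rfl) (fun _ _ _ => rfl)⟩
  | smul c y _ hy =>
    obtain ⟨v, hv, rfl⟩ := hy
    refine ⟨c • v, fun a => Submodule.smul_mem _ c (hv a), ?_⟩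
    rw [Finsupp.sum_smul_index' (fun _ => rfl), Finsupp.smul_sum]

/-- Weight components are unique, so after grouping by weight only the terms of weight `a` survive.
-/
theorem mem_span_of_mem_wtSpace {ι : Type*} (x : ι → M) (κ : ι → (ℕ →₀ ℤ))
    (hx : ∀ i, x i ∈ wtSpace (k := k) M (κ i)) {a : ℕ →₀ ℤ} {m : M}
    (hm : m ∈ Submodule.span k (Set.range x)) (hma : m ∈ wtSpace (k := k) M a) :
    m ∈ Submodule.span k (x '' {i | κ i = a}) := by
  obtain ⟨v, hv, hvm⟩ := exists_finsupp_wt_of_mem_span x κ hm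
  have hv' : ∀ a, v a ∈ wtSpace (k := k) M a := fun a => by
    refine Submodule.span_le.2 ?_ (hv a)
    rintro _ ⟨i, rfl, rfl⟩
    exact hx i
  have := finsupp_wt_eq_single hv' hma hvm
  have h2 := hv a
  rwa [this, Finsupp.single_eq_same] at h2

omit [CharZero k] in
theorem IsWeightModule.of_span {ι : Type*} (x : ι → M) (κ : ι → (ℕ →₀ ℤ))
    (hκ : ∀ i, 0 ≤ κ i) (hx : ∀ i, x i ∈ wtSpace (k := k) M (κ i))
    (h : Submodule.span k (Set.range x) = ⊤) : IsWeightModule k M := by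
  rw [IsWeightModule, eq_top_iff, ← h]
  refine Submodule.span_mono ?_
  rintro _ ⟨i, rfl⟩
  exact ⟨κ i, hκ i, hx i⟩

omit [CharZero k] in
theorem IsWeightModule.exists_finsupp (hM : IsWeightModule k M) (m : M) :
    ∃ v : (ℕ →₀ ℤ) →₀ M, (∀ a, v a ∈ wtSpace (k := k) M a) ∧ (∀ a, v a ≠ 0 → 0 ≤ a) ∧
      (v.sum fun _ m => m) = m := by
  let ι := {v : M // ∃ a : ℕ →₀ ℤ, 0 ≤ a ∧ v ∈ wtSpace (k := k) M a}
  let x : ι → M := fun i => i.1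
  choose κ h0 hκ using fun i : ι => i.2
  have hm : m ∈ Submodule.span k (Set.range x) := by
    have h1 : Set.range x = {v : M | ∃ a : ℕ →₀ ℤ, 0 ≤ a ∧ v ∈ wtSpace (k := k) M a} :=
      Subtype.range_val
    rw [h1, show Submodule.span k _ = ⊤ from hM]
    trivial
  obtain ⟨v, hv, hvm⟩ := exists_finsupp_wt_of_mem_span x κ hm
  refine ⟨v, fun a => ?_, fun a ha => ?_, hvm⟩
  · refine Submodule.span_le.2 ?_ (hv a)
    rintro _ ⟨i, rfl, rfl⟩
    exact hκ i
  · by_contra hc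
    refine ha ?_
    have := hv a
    rw [show {i | κ i = a} = ∅ from Set.eq_empty_of_forall_notMem fun i hi => hc (hi ▸ h0 i)] at this
    simpa using this

/-- The definition bounds only the weights of a spanning set; independence of the weight spaces
extends the bound to every nonzero weight vector. Operators that would produce a negative entry must
therefore give zero. -/
theorem IsWeightModule.nonneg (hM : IsWeightModule k M) {a : ℕ →₀ ℤ} {m : M}
    (hm : m ∈ wtSpace (k := k) M a) (h0 : m ≠ 0) : 0 ≤ a := by
  obtain ⟨v, hv, hv0, hvm⟩ := hM.exists_finsupp m
  have := finsupp_wt_eq_single hv hm hvm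
  exact hv0 a (by rw [this, Finsupp.single_eq_same]; exact h0)

/-- A submodule is stable under every `E_jj`, so it contains the weight components of its elements.
-/
theorem IsWeightModule.lieSubmodule (hM : IsWeightModule k M) (A : LieSubmodule k (glInf k) M) :
    IsWeightModule k A := by
  rw [IsWeightModule, eq_top_iff]
  rintro ⟨m, hm⟩ -
  obtain ⟨v, hv, hv0, rfl⟩ := hM.exists_finsupp m
  have hA := mem_of_finsupp_wt_mem A.toSubmodule (fun j m hm => A.lie_mem hm) v hv hm
  have : (⟨v.sum fun _ m => m, hm⟩ : A) = ∑ a ∈ v.support, ⟨v a, hA a⟩ := by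
    ext
    simp [Finsupp.sum]
  rw [this]
  refine Submodule.sum_mem _ fun a ha => Submodule.subset_span ⟨a, ?_, fun j => ?_⟩
  · exact hv0 a (Finsupp.mem_support_iff.1 ha)
  · exact Subtype.ext (hv a j)

variable {N : Type*} [AddCommGroup N] [Module k N] [LieRingModule (glInf k) N]
    [LieModule k (glInf k) N]

omit [CharZero k] in
theorem IsWeightModule.of_surjective (hM : IsWeightModule k M) (f : M →ₗ⁅k, glInf k⁆ N)
    (hf : Function.Surjective f) : IsWeightModule k N := by
  rw [IsWeightModule, eq_top_iff, ← LinearMap.range_eq_top.2 (show Function.Surjective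
    (f : M →ₗ[k] N) from hf), LinearMap.range_eq_map,
    ← show Submodule.span k _ = ⊤ from hM, Submodule.map_span]
  refine Submodule.span_mono ?_
  rintro _ ⟨m, ⟨a, ha, hm⟩, rfl⟩
  exact ⟨a, ha, wtSpace_map f hm⟩

theorem IsWeightModule.exists_wt_preimage (hM : IsWeightModule k M) (f : M →ₗ⁅k, glInf k⁆ N)
    (hf : Function.Surjective f) {a : ℕ →₀ ℤ} {x : N} (hx : x ∈ wtSpace (k := k) N a) :
    ∃ m ∈ wtSpace (k := k) M a, f m = x := by
  obtain ⟨m, rfl⟩ := hf x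
  obtain ⟨v, hv, -, rfl⟩ := hM.exists_finsupp m
  let w : (ℕ →₀ ℤ) →₀ N := v.mapRange f (map_zero f)
  have hw : ∀ a, w a ∈ wtSpace (k := k) N a := fun a => wtSpace_map f (hv a)
  have hs : (w.sum fun _ m => m) = f (v.sum fun _ m => m) := by
    rw [Finsupp.sum_mapRange_index (fun _ => rfl), Finsupp.sum, Finsupp.sum, map_sum]
  have := finsupp_wt_eq_single hw hx hs
  refine ⟨v a, hv a, ?_⟩
  have h2 : w a = f (v a) := rfl
  rw [← h2, this, Finsupp.single_eq_same]

end Weights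

/-! ### The splitting into `𝔤𝔩_{∞-n}`-invariants and a natural complement -/

section Tail

variable {k : Type u} [Field k]
variable (M : Type*) [AddCommGroup M] [Module k M] [LieRingModule (glInf k) M]
  [LieModule k (glInf k) M]

/-- The `𝔤𝔩_{∞-n}`-invariants of a `𝔤𝔩`-module. -/
def tailInv (n : ℕ) : Submodule k M where
  carrier := {m | ∀ g : glTail k n, ⁅g.1, m⁆ = 0}
  add_mem' {m m'} h h' g := by rw [lie_add, h g, h' g, add_zero]
  zero_mem' g := lie_zero _
  smul_mem' c m h g := by rw [lie_smul, h g, smul_zero]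

/-- The span of the weight vectors whose weight is nonzero at some index `≥ n`. -/
def tailPos (n : ℕ) : Submodule k M :=
  Submodule.span k {m | ∃ a : ℕ →₀ ℤ, (∃ j, n ≤ j ∧ a j ≠ 0) ∧ m ∈ wtSpace (k := k) M a}

variable {M} {n : ℕ}
variable {N : Type*} [AddCommGroup N] [Module k N] [LieRingModule (glInf k) N]
    [LieModule k (glInf k) N]

theorem tailInv_map (f : M →ₗ⁅k, glInf k⁆ N) {m : M} (h : m ∈ tailInv (k := k) M n) :
    f m ∈ tailInv (k := k) N n := fun g => by
  rw [← f.map_lie, h g, map_zero]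

theorem tailPos_map (f : M →ₗ⁅k, glInf k⁆ N) {m : M} (h : m ∈ tailPos (k := k) M n) :
    f m ∈ tailPos (k := k) N n := by
  have : tailPos (k := k) M n ≤ (tailPos (k := k) N n).comap (f : M →ₗ[k] N) := by
    refine Submodule.span_le.2 ?_
    rintro m ⟨a, ha, hm⟩
    exact Submodule.subset_span ⟨a, ha, wtSpace_map f hm⟩
  exact this h

variable [CharZero k]

theorem eq_zero_of_lie_sum_eq_zero (v : (ℕ →₀ ℤ) →₀ M)
    (hv : ∀ a, v a ∈ wtSpace (k := k) M a) (j : ℕ)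
    (h : ⁅matUnit k j j, v.sum fun _ m => m⁆ = 0) (a : ℕ →₀ ℤ) (ha : a j ≠ 0) : v a = 0 := by
  by_cases hs : a ∈ v.support
  · have := mem_of_sum_wt_mem (⊥ : Submodule k M) (by simp) v.support
      (fun a => (a j : k) • v a) (fun a _ => Submodule.smul_mem _ _ (hv a)) (by
        rw [Submodule.mem_bot, ← h, Finsupp.sum, lie_sum]
        exact Finset.sum_congr rfl fun a _ => (hv a j).symm) a hs
    rw [Submodule.mem_bot, smul_eq_zero] at this
    exact this.resolve_left (by exact_mod_cast ha)
  · exact Finsupp.notMem_support_iff.1 hs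

/-- An invariant is killed by every `E_jj` with `j ≥ n`, whereas each weight component of an element
of `tailPos` is multiplied by a nonzero integer under one of them. -/
theorem tailInv_disjoint_tailPos {m : M} (h0 : m ∈ tailInv (k := k) M n)
    (h1 : m ∈ tailPos (k := k) M n) : m = 0 := by
  let ι := {v : M // ∃ a : ℕ →₀ ℤ, (∃ j, n ≤ j ∧ a j ≠ 0) ∧ v ∈ wtSpace (k := k) M a}
  let x : ι → M := fun i => i.1
  choose κ hκ0 hκ using fun i : ι => i.2
  have hm : m ∈ Submodule.span k (Set.range x) := by
    rw [show Set.range x = _ from Subtype.range_val]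
    exact h1
  obtain ⟨v, hv, rfl⟩ := exists_finsupp_wt_of_mem_span x κ hm
  have hv' : ∀ a, v a ∈ wtSpace (k := k) M a := fun a => by
    refine Submodule.span_le.2 ?_ (hv a)
    rintro _ ⟨i, rfl, rfl⟩
    exact hκ i
  have hz : ∀ a, v a = 0 := by
    intro a
    by_cases ha : ∃ j, n ≤ j ∧ a j ≠ 0
    · obtain ⟨j, hj, haj⟩ := ha
      exact eq_zero_of_lie_sum_eq_zero v hv' j
        (h0 ⟨matUnit k j j, matUnit_mem_glTail hj hj⟩) a haj
    · have := hv a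
      rw [show {i | κ i = a} = ∅ from Set.eq_empty_of_forall_notMem fun i hi =>
        ha (by have := hκ0 i; rwa [show κ i = a from hi] at this)] at this
      simpa using this
  rw [show v = 0 from Finsupp.ext hz]
  simp

/-- For `i ≠ j` with `i, j ≥ n`, applying `E_ij` would lower the entry at `j` from `0` to `-1`,
which nonnegativity forbids; `E_jj` acts by the entry `0`. -/
theorem IsWeightModule.mem_tailInv (hM : IsWeightModule k M) {a : ℕ →₀ ℤ}
    (ha : ∀ j, n ≤ j → a j = 0) {m : M} (hm : m ∈ wtSpace (k := k) M a) :
    m ∈ tailInv (k := k) M n := by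
  rintro ⟨g, hg⟩
  have h1 := mem_span_matUnit g
  have h2 : Submodule.span k {x | ∃ i j, (g.1 (Finsupp.single j 1) i ≠ 0) ∧ x = matUnit k i j} ≤
      LinearMap.ker ((LieModule.toEnd k (glInf k) M : glInf k →ₗ[k] Module.End k M).flip m) := by
    refine Submodule.span_le.2 ?_
    rintro _ ⟨i, j, hij, rfl⟩
    change ⁅matUnit k i j, m⁆ = 0
    have hj : n ≤ j := by
      by_contra hc
      exact hij (by rw [hg.1 j (by omega)]; rfl)
    have hi : n ≤ i := by
      by_contra hc
      exact hij (hg.2 _ i (by omega))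
    by_cases h : i = j
    · subst h
      rw [hm i, ha i hi, Int.cast_zero, zero_smul]
    · by_contra hc
      have := hM.nonneg (matUnit_mem_wtSpace hm i j) hc j
      simp [ha j hj, h] at this
  exact h2 h1

theorem IsWeightModule.exists_add (hM : IsWeightModule k M) (n : ℕ) (m : M) :
    ∃ r ∈ tailInv (k := k) M n, ∃ s ∈ tailPos (k := k) M n, m = r + s := by
  have : (⊤ : Submodule k M) ≤ tailInv (k := k) M n ⊔ tailPos (k := k) M n := by
    rw [← show Submodule.span k _ = ⊤ from hM]
    refine Submodule.span_le.2 ?_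
    rintro m ⟨a, -, hm⟩
    by_cases ha : ∃ j, n ≤ j ∧ a j ≠ 0
    · exact Submodule.mem_sup_right (Submodule.subset_span ⟨a, ha, hm⟩)
    · push Not at ha
      exact Submodule.mem_sup_left (hM.mem_tailInv ha hm)
  obtain ⟨r, hr, s, hs, h⟩ := Submodule.mem_sup.1 (this (Submodule.mem_top (x := m)))
  exact ⟨r, hr, s, hs, h.symm⟩

/-- The `tailPos` component of a preimage maps to an invariant lying in `tailPos`, that is, to zero;
so the invariant component is already a preimage. This gives the right exactness of `Γ_n`. -/
theorem IsWeightModule.exists_tailInv_preimage (hM : IsWeightModule k M)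
    (f : M →ₗ⁅k, glInf k⁆ N) {x : N} (hx : x ∈ tailInv (k := k) N n)
    (hf : ∃ m, f m = x) : ∃ m ∈ tailInv (k := k) M n, f m = x := by
  obtain ⟨m, rfl⟩ := hf
  obtain ⟨r, hr, s, hs, rfl⟩ := hM.exists_add n m
  refine ⟨r, hr, ?_⟩
  have h1 : f s ∈ tailInv (k := k) N n := by
    have := Submodule.sub_mem _ hx (tailInv_map f hr)
    rwa [map_add, add_sub_cancel_left] at this
  rw [map_add, tailInv_disjoint_tailPos h1 (tailPos_map f hs), add_zero]

theorem IsWeightModule.mem_tailPos_of_injective (hM : IsWeightModule k M)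
    (f : M →ₗ⁅k, glInf k⁆ N) (hf : Function.Injective f) {m : M}
    (h : f m ∈ tailPos (k := k) N n) : m ∈ tailPos (k := k) M n := by
  obtain ⟨r, hr, s, hs, rfl⟩ := hM.exists_add n m
  have h1 : f r ∈ tailPos (k := k) N n := by
    have := Submodule.sub_mem _ h (tailPos_map f hs)
    rwa [map_add, add_sub_cancel_right] at this
  have h2 : r = 0 := hf (by rw [tailInv_disjoint_tailPos (tailInv_map f hr) h1, map_zero])
  rw [h2, zero_add]
  exact hs

end Tail

end LinearOperad

/-! ### Submodules generated under a decomposition `L = L₁ + L₂` -/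

section EnvelopingInduction

variable {k L M : Type*} [CommRing k] [LieRing L] [LieAlgebra k L] [AddCommGroup M] [Module k M]
  [LieRingModule L M] [LieModule k L M]

/-- If `L = L₁ + L₂` and `L₂` stabilizes `B`, then the submodule generated by `B` is contained in
every `L₁`-stable subspace containing `B`. -/
theorem mem_of_mem_lieSpan_of_sup_eq_top {L₁ L₂ : Submodule k L} (h : L₁ ⊔ L₂ = ⊤)
    {B C : Submodule k M} (hB : ∀ z ∈ L₂, ∀ b ∈ B, ⁅z, b⁆ ∈ B) (hBC : B ≤ C)
    (hC : ∀ y ∈ L₁, ∀ c ∈ C, ⁅y, c⁆ ∈ C) {m : M} (hm : m ∈ LieSubmodule.lieSpan k L (B : Set M)) :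
    m ∈ C := by
  -- `D` is the least `L₁`-stable subspace containing `B`; the point is that it is stable under all
  -- of `L`.
  let 𝒰 : Set (Submodule k M) := {U | B ≤ U ∧ ∀ y ∈ L₁, ∀ u ∈ U, ⁅y, u⁆ ∈ U}
  let D : Submodule k M := sInf 𝒰
  have hBD : B ≤ D := le_sInf fun U hU => hU.1
  have hD : ∀ y ∈ L₁, ∀ u ∈ D, ⁅y, u⁆ ∈ D := by
    intro y hy u hu
    refine Submodule.mem_sInf.2 fun U hU => hU.2 y hy u ?_
    exact (sInf_le hU : D ≤ U) hu
  -- `E` is the part of `D` which `L` keeps inside `D`. Once `E` belongs to `𝒰`, minimality gives `D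
  -- ≤ E`. Neither `L₁` nor `L₂` has to be a subalgebra, because the condition on `u` covers `⁅x,
  -- y⁆` for every `x` in `L`.
  let E : Submodule k M :=
    { carrier := {u | u ∈ D ∧ ∀ x : L, ⁅x, u⁆ ∈ D}
      add_mem' := fun ha hb => ⟨D.add_mem ha.1 hb.1, fun x => by
        rw [lie_add]; exact D.add_mem (ha.2 x) (hb.2 x)⟩
      zero_mem' := ⟨D.zero_mem, fun x => by rw [lie_zero]; exact D.zero_mem⟩
      smul_mem' := fun c u hu => ⟨D.smul_mem c hu.1, fun x => by
        rw [lie_smul]; exact D.smul_mem c (hu.2 x)⟩ }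
  have hE : E ∈ 𝒰 := by
    refine ⟨fun b hb => ⟨hBD hb, fun x => ?_⟩, fun y hy u hu => ⟨hD y hy u hu.1, fun x => ?_⟩⟩
    · obtain ⟨y, hy, z, hz, rfl⟩ := Submodule.mem_sup.1 (h ▸ Submodule.mem_top : x ∈ L₁ ⊔ L₂)
      rw [add_lie]
      exact D.add_mem (hD y hy b (hBD hb)) (hBD (hB z hz b hb))
    · rw [leibniz_lie]
      exact D.add_mem (hu.2 _) (hD y hy _ (hu.2 x))
  let D' : LieSubmodule k L M := { D with lie_mem := fun {x u} hu => ((sInf_le hE : D ≤ E) hu).2 x }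
  have h1 : LieSubmodule.lieSpan k L (B : Set M) ≤ D' := LieSubmodule.lieSpan_le.2 hBD
  exact (sInf_le ⟨hBC, hC⟩ : D ≤ C) (h1 hm)

omit [LieModule k L M] in
/-- Two surjections with the same kernel have isomorphic targets. -/
theorem LieModuleHom.exists_equiv_of_ker_eq {N N' : Type*} [AddCommGroup N] [Module k N]
    [LieRingModule L N] [LieModule k L N] [AddCommGroup N'] [Module k N']
    [LieRingModule L N'] [LieModule k L N'] (f : M →ₗ⁅k, L⁆ N) (g : M →ₗ⁅k, L⁆ N')
    (hf : Function.Surjective f) (hg : Function.Surjective g) (h : ∀ m, f m = 0 ↔ g m = 0) :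
    ∃ e : N ≃ₗ⁅k, L⁆ N', ∀ m, e (f m) = g m := by
  have hfg : ∀ {m m'}, f m = f m' → g m = g m' := fun {m m'} e => by
    rw [← sub_eq_zero, ← map_sub, ← h, map_sub, e, sub_self]
  have hgf : ∀ {m m'}, g m = g m' → f m = f m' := fun {m m'} e => by
    rw [← sub_eq_zero, ← map_sub, h, map_sub, e, sub_self]
  let s := Function.surjInv hf
  let t := Function.surjInv hg
  have hs : ∀ x, f (s x) = x := Function.surjInv_eq hf
  have ht : ∀ x, g (t x) = x := Function.surjInv_eq hg
  let e : N ≃ₗ⁅k, L⁆ N' :=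
    { toFun := fun x => g (s x)
      map_add' := fun x y => by
        rw [← map_add]; exact hfg (by rw [map_add, hs, hs, hs])
      map_smul' := fun c x => by
        rw [RingHom.id_apply, ← map_smul]; exact hfg (by rw [map_smul, hs, hs])
      map_lie' := fun {x m} => by
        rw [← g.map_lie]; exact hfg (by rw [f.map_lie, hs, hs])
      invFun := fun x => f (t x)
      left_inv := fun x => by
        conv_rhs => rw [← hs x]
        exact hgf (by rw [ht])
      right_inv := fun x => by
        conv_rhs => rw [← ht x]
        exact hfg (by rw [hs]) }
  exact ⟨e, fun m => hfg (hs _)⟩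

end EnvelopingInduction

/-! ### Isomorphisms and products of representations -/

namespace LieRep

variable {k : Type u} [Field k] {L : Type u} [LieRing L] [LieAlgebra k L]

/-- An equivalence of Lie modules as an isomorphism of representations. -/
def isoOfEquiv {M N : LieRep k L} (e : M.carrier ≃ₗ⁅k, L⁆ N.carrier) : M ≅ N where
  hom := (e : M.carrier →ₗ⁅k, L⁆ N.carrier)
  inv := (e.symm : N.carrier →ₗ⁅k, L⁆ M.carrier)
  hom_inv_id := LieModuleHom.ext fun m => e.symm_apply_apply m
  inv_hom_id := LieModuleHom.ext fun m => e.apply_symm_apply m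

/-- The first projection from a product of representations. -/
def fst (M N : LieRep k L) : (M.prod N).carrier →ₗ⁅k, L⁆ M.carrier where
  toFun p := p.1
  map_add' _ _ := rfl
  map_smul' _ _ := rfl
  map_lie' := rfl

/-- The second projection from a product of representations. -/
def snd (M N : LieRep k L) : (M.prod N).carrier →ₗ⁅k, L⁆ N.carrier where
  toFun p := p.2
  map_add' _ _ := rfl
  map_smul' _ _ := rfl
  map_lie' := rfl

end LieRep

namespace LinearOperad

/-! ### Highest weight vectors of `𝔤𝔩`-modules -/

section HighestWeight

variable {k : Type u} [Field k]

/-- The sum `∑ j * a_j`. -/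
noncomputable def wtStat : (ℕ →₀ ℤ) →ₗ[ℤ] ℤ := Finsupp.linearCombination ℤ (fun j : ℕ => (j : ℤ))

theorem wtStat_single (i : ℕ) : wtStat (Finsupp.single i 1) = i := by
  simp [wtStat]

theorem wtStat_nonneg {a : ℕ →₀ ℤ} (h : 0 ≤ a) : 0 ≤ wtStat a := by
  rw [wtStat, Finsupp.linearCombination_apply]
  refine Finset.sum_nonneg fun j _ => ?_
  exact mul_nonneg (h j) (by positivity)

/-- A nonzero vector of weight `a` killed by all `E_ij` with `i < j`. -/
structure IsHighestWeight {M : Type*} [AddCommGroup M] [Module k M] [LieRingModule (glInf k) M]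
    [LieModule k (glInf k) M] (a : ℕ →₀ ℤ) (v : M) : Prop where
  ne_zero : v ≠ 0
  mem : v ∈ wtSpace (k := k) M a
  lie_eq_zero : ∀ i j, i < j → ⁅matUnit k i j, v⁆ = 0

variable [CharZero k]

section

variable {M : Type*} [AddCommGroup M] [Module k M] [LieRingModule (glInf k) M]
  [LieModule k (glInf k) M]

/-- For `i < j`, `E_ij` lowers `wtStat` by `j - i`, and `wtStat` is nonnegative on the weights that
occur. A nonzero weight vector with the least `wtStat` is thus killed by all these `E_ij`. -/
theorem IsWeightModule.exists_isHighestWeight (hM : IsWeightModule k M) [Nontrivial M] :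
    ∃ (a : ℕ →₀ ℤ) (v : M), IsHighestWeight (k := k) a v := by
  classical
  have hex : ∃ r : ℕ, ∃ (a : ℕ →₀ ℤ) (v : M), v ≠ 0 ∧ v ∈ wtSpace (k := k) M a ∧
      (wtStat a).toNat = r := by
    obtain ⟨m, hm⟩ := exists_ne (0 : M)
    obtain ⟨v, hv, -, rfl⟩ := hM.exists_finsupp m
    obtain ⟨a, ha⟩ : ∃ a, v a ≠ 0 := by
      by_contra! hc
      exact hm (by rw [show v = 0 from Finsupp.ext hc]; simp)
    exact ⟨_, a, v a, ha, hv a, rfl⟩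
  obtain ⟨a, v, hv, hva, hr⟩ := Nat.find_spec hex
  refine ⟨a, v, hv, hva, fun i j hij => ?_⟩
  by_contra hc
  have h1 := matUnit_mem_wtSpace hva i j
  have h2 := Nat.find_min' hex ⟨_, _, hc, h1, rfl⟩
  have h3 := wtStat_nonneg (hM.nonneg h1 hc)
  rw [← hr] at h2
  rw [map_sub, map_add, wtStat_single, wtStat_single] at h2 h3
  omega

/-- This is the `𝔰𝔩₂` argument at the indices `i, i + 1`. For `w r = E_{i+1,i}^r v` one has
`E_{i,i+1} (w (r+1)) = (r+1)(a_i - a_{i+1} - r) w r`. If `a_i < a_{i+1}`, the factor never vanishes,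
so all `w r` are nonzero, although the entry `a_i - r` of their weight becomes negative. -/
theorem IsHighestWeight.antitone (hM : IsWeightModule k M) {a : ℕ →₀ ℤ} {v : M}
    (h : IsHighestWeight (k := k) a v) : Antitone a := by
  refine antitone_nat_of_succ_le fun i => ?_
  by_contra! hlt
  let w : ℕ → M := fun r => Nat.rec v (fun _ x => ⁅matUnit k (i + 1) i, x⁆) r
  have hw0 : w 0 = v := rfl
  have hw : ∀ r, w (r + 1) = ⁅matUnit k (i + 1) i, w r⁆ := fun r => rfl
  clear_value w
  let b : ℕ → (ℕ →₀ ℤ) := fun r =>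
    a + r • (Finsupp.single (i + 1) (1 : ℤ) - Finsupp.single i 1)
  have hwt : ∀ r, w r ∈ wtSpace (k := k) M (b r) := by
    intro r
    induction r with
    | zero => simpa [b, hw0] using h.mem
    | succ r ih =>
      have := matUnit_mem_wtSpace ih (i + 1) i
      rw [hw]
      convert this using 2
      simp only [b, succ_nsmul]
      abel
  have hb : ∀ r, b r i = a i - r := fun r => by simp [b, sub_eq_add_neg]
  have hb' : ∀ r, b r (i + 1) = a (i + 1) + r := fun r => by simp [b]
  have he : ∀ r, ⁅matUnit k i (i + 1), w (r + 1)⁆ =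
      ((r + 1 : k) * ((a i : k) - a (i + 1) - r)) • w r := by
    intro r
    have hstep : ∀ r, ⁅matUnit k i (i + 1), w (r + 1)⁆ = ((a i : k) - a (i + 1) - 2 * r) • w r +
        ⁅matUnit k (i + 1) i, ⁅matUnit k i (i + 1), w r⁆⁆ := by
      intro r
      rw [hw, leibniz_lie, matUnit_lie, if_pos rfl, if_pos rfl, sub_lie, hwt r i, hwt r (i + 1),
        ← sub_smul, hb, hb']
      congr 2
      push_cast
      ring
    induction r with
    | zero =>
      rw [hstep, hw0, h.lie_eq_zero i (i + 1) (by omega), lie_zero, add_zero]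
      congr 1
      push_cast
      ring
    | succ r ih =>
      rw [hstep, ih, lie_smul, ← hw, ← add_smul]
      congr 1
      push_cast
      ring
  have hne : ∀ r, w r ≠ 0 := by
    intro r
    induction r with
    | zero => exact hw0 ▸ h.ne_zero
    | succ r ih =>
      intro h0
      have := he r
      rw [h0, lie_zero, eq_comm, smul_eq_zero] at this
      rcases this with h1 | h1
      · have h2 : ((r + 1 : ℤ) * (a i - a (i + 1) - r) : ℤ) = 0 := by
          have : (((r + 1 : ℤ) * (a i - a (i + 1) - r) : ℤ) : k) = 0 := by
            push_cast
            exact h1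
          exact_mod_cast this
        rcases mul_eq_zero.1 h2 with h3 | h3 <;> omega
      · exact ih h1
  -- Since `a_i` is nonnegative, the entry at `i` is `-1` for this exponent.
  have h0 := hM.nonneg (hwt ((a i).toNat + 1)) (hne _) i
  rw [hb, Finsupp.coe_zero, Pi.zero_apply] at h0
  have h4 := hM.nonneg h.mem h.ne_zero i
  rw [Finsupp.coe_zero, Pi.zero_apply] at h4
  push_cast at h0
  omega

theorem eq_zero_of_mem_span_wt {p : (ℕ →₀ ℤ) → Prop} {m : M}
    (hm : m ∈ Submodule.span k {m : M | ∃ a, p a ∧ m ∈ wtSpace (k := k) M a}) {a : ℕ →₀ ℤ}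
    (hma : m ∈ wtSpace (k := k) M a) (ha : ¬ p a) : m = 0 := by
  let ι := {v : M // ∃ a : ℕ →₀ ℤ, p a ∧ v ∈ wtSpace (k := k) M a}
  choose κ hκ0 hκ using fun i : ι => i.2
  have := mem_span_of_mem_wtSpace (fun i : ι => i.1) κ hκ
    (by rwa [show Set.range (fun i : ι => i.1) = _ from Subtype.range_val]) hma
  rw [show {i | κ i = a} = ∅ from Set.eq_empty_of_forall_notMem fun i hi =>
    ha (by have := hκ0 i; rwa [show κ i = a from hi] at this)] at this
  simpa using this

/-- Upper triangular matrix units act on `v` by scalars, while strictly lower ones raise `wtStat`.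
Hence the submodule generated by `v` lies in the line of `v` plus weight spaces of larger `wtStat`,
and its part of weight `a` is that line. -/
theorem IsHighestWeight.mem_span_of_mem_lieSpan {a : ℕ →₀ ℤ} {v m : M}
    (hv : v ∈ wtSpace (k := k) M a) (hv' : ∀ i j, i < j → ⁅matUnit k i j, v⁆ = 0)
    (hm : m ∈ LieSubmodule.lieSpan k (glInf k) (Submodule.span k {v} : Set M))
    (hma : m ∈ wtSpace (k := k) M a) : m ∈ Submodule.span k {v} := by
  let L₁ : Submodule k (glInf k) := Submodule.span k {x | ∃ i j, j < i ∧ x = matUnit k i j}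
  let L₂ : Submodule k (glInf k) := Submodule.span k {x | ∃ i j, i ≤ j ∧ x = matUnit k i j}
  let F : Submodule k M :=
    Submodule.span k {m : M | ∃ b, wtStat a < wtStat b ∧ m ∈ wtSpace (k := k) M b}
  have htop : L₁ ⊔ L₂ = ⊤ := by
    refine eq_top_iff.2 fun g _ => ?_
    refine (Submodule.span_le.2 ?_ : _ ≤ L₁ ⊔ L₂) (mem_span_matUnit g)
    rintro _ ⟨i, j, -, rfl⟩
    rcases lt_or_ge j i with h | h
    · exact Submodule.mem_sup_left (Submodule.subset_span ⟨i, j, h, rfl⟩)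
    · exact Submodule.mem_sup_right (Submodule.subset_span ⟨i, j, h, rfl⟩)
  have hE : ∀ i j, j < i → ∀ b, wtStat b < wtStat (b + Finsupp.single i 1 - Finsupp.single j 1) := by
    intro i j hij b
    rw [map_sub, map_add, wtStat_single, wtStat_single]
    omega
  have hmem : ∀ {S : Set (glInf k)} {U U' : Submodule k M}
      (_ : ∀ x ∈ S, ∀ u ∈ U, ⁅x, u⁆ ∈ U') (x) (_ : x ∈ Submodule.span k S) (u) (_ : u ∈ U),
      ⁅x, u⁆ ∈ U' := by
    intro S U U' h x hx u hu
    have : Submodule.span k S ≤ U'.comap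
        ((LieModule.toEnd k (glInf k) M : glInf k →ₗ[k] Module.End k M).flip u) :=
      Submodule.span_le.2 fun x hx => h x hx u hu
    exact this hx
  have key : m ∈ Submodule.span k {v} ⊔ F := by
    refine mem_of_mem_lieSpan_of_sup_eq_top htop (B := Submodule.span k {v}) ?_ le_sup_left ?_ hm
    · refine hmem ?_
      rintro _ ⟨i, j, hij, rfl⟩ u hu
      obtain ⟨c, rfl⟩ := Submodule.mem_span_singleton.1 hu
      rw [lie_smul]
      refine Submodule.smul_mem _ _ ?_
      rcases eq_or_lt_of_le hij with rfl | hij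
      · rw [hv i]
        exact Submodule.smul_mem _ _ (Submodule.mem_span_singleton_self v)
      · rw [hv' i j hij]
        exact Submodule.zero_mem _
    · refine hmem ?_
      rintro _ ⟨i, j, hij, rfl⟩ u hu
      refine Submodule.mem_sup_right ?_
      obtain ⟨w, hw, f, hf, rfl⟩ := Submodule.mem_sup.1 hu
      rw [lie_add]
      refine Submodule.add_mem _ ?_ ?_
      · obtain ⟨c, rfl⟩ := Submodule.mem_span_singleton.1 hw
        rw [lie_smul]
        exact Submodule.smul_mem _ _
          (Submodule.subset_span ⟨_, hE i j hij a, matUnit_mem_wtSpace hv i j⟩)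
      · have : F ≤ F.comap (LieModule.toEnd k (glInf k) M (matUnit k i j)) := by
          refine Submodule.span_le.2 ?_
          rintro m ⟨b, hb, hmb⟩
          exact Submodule.subset_span ⟨_, hb.trans (hE i j hij b), matUnit_mem_wtSpace hmb i j⟩
        exact this hf
  obtain ⟨w, hw, f, hf, rfl⟩ := Submodule.mem_sup.1 key
  have hwa : w ∈ wtSpace (k := k) M a :=
    (Submodule.span_le.2 (by simpa using hv) : Submodule.span k {v} ≤ wtSpace (k := k) M a) hw
  have hfa : f ∈ wtSpace (k := k) M a := by
    have := Submodule.sub_mem _ hma hwa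
    rwa [add_sub_cancel_left] at this
  rw [eq_zero_of_mem_span_wt hf hfa (lt_irrefl _), add_zero]
  exact hw

end

/-- Irreducible representations with highest weight vectors of the same weight are isomorphic. -/
theorem IsHighestWeight.nonempty_iso {T T' : LieRep k (glInf k)}
    (hT : LieModule.IsIrreducible k (glInf k) T.carrier)
    (hT' : LieModule.IsIrreducible k (glInf k) T'.carrier) {a : ℕ →₀ ℤ} {v : T.carrier}
    {v' : T'.carrier} (h : IsHighestWeight (k := k) a v) (h' : IsHighestWeight (k := k) a v') :
    Nonempty (T ≅ T') := by
  let X := T.prod T'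
  let u : X.carrier := (v, v')
  have hu : u ∈ wtSpace (k := k) X.carrier a := fun j => Prod.ext (h.mem j) (h'.mem j)
  have hu' : ∀ i j, i < j → ⁅matUnit k i j, u⁆ = 0 := fun i j hij =>
    Prod.ext (h.lie_eq_zero i j hij) (h'.lie_eq_zero i j hij)
  -- The submodule generated by the diagonal vector projects onto both simple factors. If the
  -- kernels of the projections differed, `N` would contain `(0, v')` or `(v, 0)`, a vector of
  -- weight `a` off the line of `(v, v')`. So `N` is the graph of an isomorphism.
  let N : LieSubmodule k (glInf k) X.carrier :=
    LieSubmodule.lieSpan k (glInf k) (Submodule.span k {u} : Set X.carrier)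
  have huN : u ∈ N := LieSubmodule.subset_lieSpan (Submodule.mem_span_singleton_self u)
  let f : N →ₗ⁅k, glInf k⁆ T.carrier := (T.fst T').comp N.incl
  let g : N →ₗ⁅k, glInf k⁆ T'.carrier := (T.snd T').comp N.incl
  have hf : Function.Surjective f := by
    rw [← LieModuleHom.range_eq_top]
    refine (hT.eq_bot_or_eq_top _).resolve_left fun hb => h.ne_zero ?_
    rw [← LieSubmodule.mem_bot (R := k) (L := glInf k), ← hb]
    exact (LieModuleHom.mem_range _ _).2 ⟨⟨u, huN⟩, rfl⟩
  have hg : Function.Surjective g := by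
    rw [← LieModuleHom.range_eq_top]
    refine (hT'.eq_bot_or_eq_top _).resolve_left fun hb => h'.ne_zero ?_
    rw [← LieSubmodule.mem_bot (R := k) (L := glInf k), ← hb]
    exact (LieModuleHom.mem_range _ _).2 ⟨⟨u, huN⟩, rfl⟩
  have h1 : ∀ n, f n = 0 → g n = 0 := by
    intro n hn
    have hbot : f.ker.map g = ⊥ := by
      refine (hT'.eq_bot_or_eq_top _).resolve_right fun hb => h'.ne_zero ?_
      obtain ⟨p, hp, hpv⟩ := (LieSubmodule.mem_map _).1
        (hb ▸ LieSubmodule.mem_top _ : v' ∈ f.ker.map g)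
      have hp1 : p.1 = ((0, v') : T.carrier × T'.carrier) :=
        Prod.ext (LieModuleHom.mem_ker.1 hp) hpv
      have h2 := IsHighestWeight.mem_span_of_mem_lieSpan hu hu' p.2 (by
        rw [hp1]
        exact fun j => Prod.ext (by
          change ⁅matUnit k j j, (0 : T.carrier)⁆ = (a j : k) • (0 : T.carrier)
          simp) (h'.mem j))
      obtain ⟨c, hc⟩ := Submodule.mem_span_singleton.1 h2
      rw [hp1] at hc
      have hc1 : c • v = 0 := congrArg Prod.fst hc
      have hc2 : c • v' = v' := congrArg Prod.snd hc
      rw [(smul_eq_zero.1 hc1).resolve_right h.ne_zero, zero_smul] at hc2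
      exact hc2.symm
    rw [← LieSubmodule.mem_bot (R := k) (L := glInf k), ← hbot]
    exact (LieSubmodule.mem_map _).2 ⟨n, LieModuleHom.mem_ker.2 hn, rfl⟩
  have h2 : ∀ n, g n = 0 → f n = 0 := by
    intro n hn
    have hbot : g.ker.map f = ⊥ := by
      refine (hT.eq_bot_or_eq_top _).resolve_right fun hb => h.ne_zero ?_
      obtain ⟨p, hp, hpv⟩ := (LieSubmodule.mem_map _).1
        (hb ▸ LieSubmodule.mem_top _ : v ∈ g.ker.map f)
      have hp1 : p.1 = ((v, 0) : T.carrier × T'.carrier) :=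
        Prod.ext hpv (LieModuleHom.mem_ker.1 hp)
      have h2 := IsHighestWeight.mem_span_of_mem_lieSpan hu hu' p.2 (by
        rw [hp1]
        exact fun j => Prod.ext (h.mem j) (by
          change ⁅matUnit k j j, (0 : T'.carrier)⁆ = (a j : k) • (0 : T'.carrier)
          simp))
      obtain ⟨c, hc⟩ := Submodule.mem_span_singleton.1 h2
      rw [hp1] at hc
      have hc1 : c • v = v := congrArg Prod.fst hc
      have hc2 : c • v' = 0 := congrArg Prod.snd hc
      rw [(smul_eq_zero.1 hc2).resolve_right h'.ne_zero, zero_smul] at hc1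
      exact hc1.symm
    rw [← LieSubmodule.mem_bot (R := k) (L := glInf k), ← hbot]
    exact (LieSubmodule.mem_map _).2 ⟨n, LieModuleHom.mem_ker.2 hn, rfl⟩
  obtain ⟨e, -⟩ := LieModuleHom.exists_equiv_of_ker_eq f g hf hg fun n => ⟨h1 n, h2 n⟩
  exact ⟨LieRep.isoOfEquiv e⟩

end HighestWeight

end LinearOperad

/-! ### Combinatorics of the Young symmetrizer in the group algebra -/

section YoungSymmetrizer

/-- The elements of `s` outside `range s.card` are at least `s.card`, and they take the place of
equally many smaller numbers. -/
theorem Finset.sum_range_card_lt_of_ne {s : Finset ℕ} (h : s ≠ Finset.range s.card) :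
    ∑ x ∈ Finset.range s.card, x < ∑ x ∈ s, x := by
  classical
  set m := s.card with hm
  have hc : (s \ Finset.range m).card = (Finset.range m \ s).card := by
    have h1 := Finset.card_sdiff_add_card_inter s (Finset.range m)
    have h2 := Finset.card_sdiff_add_card_inter (Finset.range m) s
    rw [Finset.inter_comm, Finset.card_range] at h2
    omega
  have hne : (Finset.range m \ s).Nonempty := by
    rw [Finset.nonempty_iff_ne_empty]
    intro he
    rw [he, Finset.card_empty, Finset.card_eq_zero, Finset.sdiff_eq_empty_iff_subset] at hc
    rw [Finset.sdiff_eq_empty_iff_subset] at he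
    exact h (hc.antisymm he)
  have h1 : ∑ x ∈ Finset.range m \ s, x < m * (Finset.range m \ s).card := by
    rw [mul_comm, ← smul_eq_mul, ← Finset.sum_const]
    exact Finset.sum_lt_sum_of_nonempty hne fun x hx => by
      have := (Finset.mem_sdiff.1 hx).1
      simpa using this
  have h2 : m * (s \ Finset.range m).card ≤ ∑ x ∈ s \ Finset.range m, x := by
    rw [mul_comm, ← smul_eq_mul, ← Finset.sum_const]
    exact Finset.sum_le_sum fun x hx => by
      have := (Finset.mem_sdiff.1 hx).2
      simpa using this
  rw [← Finset.sum_inter_add_sum_sdiff s (Finset.range m),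
    ← Finset.sum_inter_add_sum_sdiff (Finset.range m) s, Finset.inter_comm s]
  rw [hc] at h2
  omega

theorem Finset.sum_range_card_le (s : Finset ℕ) :
    ∑ x ∈ Finset.range s.card, x ≤ ∑ x ∈ s, x := by
  by_cases h : s = Finset.range s.card
  · rw [← h]
  · exact (Finset.sum_range_card_lt_of_ne h).le

namespace YoungDiagram

variable {μ : YoungDiagram}

open Classical in
/-- If a permutation `g` of the cells sends no two cells of a column to the same row, then `g` is
the product of a permutation preserving the rows and one preserving the columns. -/
theorem exists_eq_row_mul_col (g : Equiv.Perm μ.cells)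
    (h : ∀ x y : μ.cells, x.1.2 = y.1.2 → (g x).1.1 = (g y).1.1 → x = y) :
    ∃ p q : Equiv.Perm μ.cells, (∀ c, (p c).1.1 = c.1.1) ∧ (∀ c, (q c).1.2 = c.1.2) ∧
      g = p * q := by
  let colF : ℕ → Finset μ.cells := fun j => Finset.univ.filter fun c => c.1.2 = j
  let J : Finset ℕ := Finset.univ.image fun c : μ.cells => c.1.2
  -- `s j` is the set of rows met by the image of column `j`; by hypothesis it has `colLen j`
  -- elements. The total of the row indices over all cells is unchanged by `g`, and among sets of a
  -- given size only the initial segment has the least sum. So each `s j` is the set of rows of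
  -- column `j`.
  let s : ℕ → Finset ℕ := fun j => (colF j).image fun c => (g c).1.1
  have hs : ∀ j, (s j).card = μ.colLen j := by
    intro j
    rw [Finset.card_image_of_injOn, YoungDiagram.colLen_eq_card]
    · rw [← Finset.card_map (Function.Embedding.subtype _)]
      congr 1
      ext c
      simp only [colF, Finset.mem_map, Finset.mem_filter, Finset.mem_univ, true_and,
        Function.Embedding.subtype_apply, Subtype.exists, YoungDiagram.mem_col_iff,
        YoungDiagram.mem_cells, exists_and_left, exists_prop]
      constructor
      · rintro ⟨a, ha, hm, rfl⟩
        exact ⟨hm, ha⟩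
      · rintro ⟨hm, hj⟩
        exact ⟨c, hj, hm, rfl⟩
    · intro x hx y hy hxy
      simp only [colF, Finset.coe_filter, Finset.mem_univ, true_and, Set.mem_ofPred_eq] at hx hy
      exact h x y (hx.trans hy.symm) hxy
  have hrows : ∀ j, ∑ c ∈ colF j, c.1.1 = ∑ x ∈ Finset.range (μ.colLen j), x := by
    intro j
    refine Finset.sum_bij (fun c _ => c.1.1) ?_ ?_ ?_ ?_
    · intro c hc
      simp only [colF, Finset.mem_filter, Finset.mem_univ, true_and] at hc
      rw [Finset.mem_range, ← YoungDiagram.mem_iff_lt_colLen, ← hc]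
      exact c.2
    · intro x hx y hy hxy
      simp only [colF, Finset.mem_filter, Finset.mem_univ, true_and] at hx hy
      exact Subtype.ext (Prod.ext hxy (hx.trans hy.symm))
    · intro i hi
      rw [Finset.mem_range, ← YoungDiagram.mem_iff_lt_colLen] at hi
      exact ⟨⟨(i, j), hi⟩, by simp [colF], rfl⟩
    · intro c _
      rfl
  have hsum : ∀ j, ∑ c ∈ colF j, (g c).1.1 = ∑ x ∈ s j, x := by
    intro j
    rw [Finset.sum_image]
    intro x hx y hy hxy
    simp only [colF, Finset.coe_filter, Finset.mem_univ, true_and, Set.mem_ofPred_eq] at hx hy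
    exact h x y (hx.trans hy.symm) hxy
  have htot : ∀ f : μ.cells → ℕ, ∑ c, f c = ∑ j ∈ J, ∑ c ∈ colF j, f c := by
    intro f
    exact (Finset.sum_fiberwise_of_maps_to (s := Finset.univ) (t := J) (g := fun c => c.1.2)
      (fun c hc => Finset.mem_image_of_mem _ hc) f).symm
  have hle : ∀ j ∈ J, ∑ x ∈ Finset.range (μ.colLen j), x ≤ ∑ x ∈ s j, x := by
    intro j _
    rw [← hs]
    exact Finset.sum_range_card_le _
  have heq : ∑ j ∈ J, ∑ x ∈ Finset.range (μ.colLen j), x = ∑ j ∈ J, ∑ x ∈ s j, x := by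
    simp only [← hrows, ← hsum]
    rw [← htot, ← htot]
    exact (Equiv.sum_comp g fun c => c.1.1).symm
  have hsr : ∀ j ∈ J, s j = Finset.range (μ.colLen j) := by
    intro j hj
    by_contra hc
    rw [← hs] at hc
    have := Finset.sum_range_card_lt_of_ne hc
    rw [hs] at this
    exact this.ne ((Finset.sum_eq_sum_iff_of_le hle).1 heq j hj)
  have hmem : ∀ c : μ.cells, ((g c).1.1, c.1.2) ∈ μ.cells := by
    intro c
    rw [YoungDiagram.mem_cells, YoungDiagram.mem_iff_lt_colLen, ← Finset.mem_range,
      ← hsr _ (Finset.mem_image_of_mem _ (Finset.mem_univ c))]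
    exact Finset.mem_image_of_mem (fun c => (g c).1.1) (by simp [colF])
  have hinj : Function.Injective fun c : μ.cells => (⟨((g c).1.1, c.1.2), hmem c⟩ : μ.cells) := by
    intro x y hxy
    have : ((g x).1.1, x.1.2) = ((g y).1.1, y.1.2) := Subtype.ext_iff.1 hxy
    exact h x y (Prod.mk.inj this).2 (Prod.mk.inj this).1
  -- `q` moves each cell within its column to the row in which `g` puts it; hence `g * q⁻¹`
  -- preserves rows.
  let q : Equiv.Perm μ.cells := Equiv.ofBijective _ (Finite.injective_iff_bijective.1 hinj)
  refine ⟨g * q⁻¹, q, fun c => ?_, fun c => rfl, by simp⟩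
  obtain ⟨d, rfl⟩ := q.surjective c
  rw [Equiv.Perm.mul_apply, show q⁻¹ (q d) = d from q.symm_apply_apply d]
  rfl

variable (k : Type*) [Field k] (μ)

open Classical in
/-- The row symmetrizer of a Young diagram in the group algebra. -/
noncomputable def rowSymm : MonoidAlgebra k (Equiv.Perm μ.cells) :=
  ∑ p : Equiv.Perm μ.cells with ∀ c, (p c).1.1 = c.1.1, MonoidAlgebra.of k _ p

open Classical in
/-- The column antisymmetrizer of a Young diagram in the group algebra. -/
noncomputable def colSymm : MonoidAlgebra k (Equiv.Perm μ.cells) :=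
  ∑ q : Equiv.Perm μ.cells with ∀ c, (q c).1.2 = c.1.2,
    (Equiv.Perm.sign q : ℤ) • MonoidAlgebra.of k _ q

variable {μ k}

open Classical in
theorem rowSymm_mul_of {p : Equiv.Perm μ.cells} (hp : ∀ c, (p c).1.1 = c.1.1) :
    μ.rowSymm k * MonoidAlgebra.of k _ p = μ.rowSymm k := by
  rw [rowSymm, Finset.sum_mul]
  refine Finset.sum_bij (fun r _ => r * p) ?_ ?_ ?_ ?_
  · intro r hr
    simp only [Finset.mem_filter, Finset.mem_univ, true_and] at hr ⊢
    intro c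
    rw [Equiv.Perm.mul_apply, hr, hp]
  · intro r _ r' _ h
    exact mul_right_cancel h
  · intro r hr
    simp only [Finset.mem_filter, Finset.mem_univ, true_and] at hr
    refine ⟨r * p⁻¹, ?_, by simp⟩
    simp only [Finset.mem_filter, Finset.mem_univ, true_and]
    intro c
    obtain ⟨d, rfl⟩ := p.surjective c
    rw [Equiv.Perm.mul_apply, show p⁻¹ (p d) = d from p.symm_apply_apply d, hr, hp]
  · intro r _
    rw [map_mul]

open Classical in
theorem of_mul_colSymm {q : Equiv.Perm μ.cells} (hq : ∀ c, (q c).1.2 = c.1.2) :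
    MonoidAlgebra.of k _ q * μ.colSymm k = (Equiv.Perm.sign q : ℤ) • μ.colSymm k := by
  rw [colSymm, Finset.mul_sum, Finset.smul_sum]
  refine Finset.sum_bij (fun r _ => q * r) ?_ ?_ ?_ ?_
  · intro r hr
    simp only [Finset.mem_filter, Finset.mem_univ, true_and] at hr ⊢
    intro c
    rw [Equiv.Perm.mul_apply, hq, hr]
  · intro r _ r' _ h
    exact mul_left_cancel h
  · intro r hr
    simp only [Finset.mem_filter, Finset.mem_univ, true_and] at hr
    refine ⟨q⁻¹ * r, ?_, by simp⟩
    simp only [Finset.mem_filter, Finset.mem_univ, true_and]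
    intro c
    have := hq (q⁻¹ (r c))
    rw [show q (q⁻¹ (r c)) = r c from q.apply_symm_apply _, hr] at this
    exact this.symm
  · intro r _
    rw [map_mul, mul_smul_comm, smul_smul, map_mul, Units.val_mul, ← mul_assoc,
      ← Units.val_mul, Int.units_mul_self, Units.val_one, one_mul]

open Classical in
theorem colSymm_mul_of {q : Equiv.Perm μ.cells} (hq : ∀ c, (q c).1.2 = c.1.2) :
    μ.colSymm k * MonoidAlgebra.of k _ q = (Equiv.Perm.sign q : ℤ) • μ.colSymm k := by
  rw [colSymm, Finset.sum_mul, Finset.smul_sum]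
  refine Finset.sum_bij (fun r _ => r * q) ?_ ?_ ?_ ?_
  · intro r hr
    simp only [Finset.mem_filter, Finset.mem_univ, true_and] at hr ⊢
    intro c
    rw [Equiv.Perm.mul_apply, hr, hq]
  · intro r _ r' _ h
    exact mul_right_cancel h
  · intro r hr
    simp only [Finset.mem_filter, Finset.mem_univ, true_and] at hr
    refine ⟨r * q⁻¹, ?_, by simp⟩
    simp only [Finset.mem_filter, Finset.mem_univ, true_and]
    intro c
    obtain ⟨d, rfl⟩ := q.surjective c
    rw [Equiv.Perm.mul_apply, show q⁻¹ (q d) = d from q.symm_apply_apply d, hr, hq]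
  · intro r _
    rw [map_mul, smul_mul_assoc, smul_smul, map_mul, Units.val_mul, mul_comm, mul_assoc,
      ← Units.val_mul, Int.units_mul_self, Units.val_one, mul_one]

variable [CharZero k]

/-- Either `g = p * q` with `p` preserving rows and `q` preserving columns, and both are absorbed up
to sign; or `g` sends two cells of a column to one row. In the second case the transposition `τ` of
these cells satisfies `g τ = τ' g` with `τ'` preserving rows, so the product equals its own
negative. -/
theorem rowSymm_mul_of_mul_colSymm (g : Equiv.Perm μ.cells) :
    ∃ s : k, μ.rowSymm k * MonoidAlgebra.of k _ g * μ.colSymm k =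
      s • (μ.rowSymm k * μ.colSymm k) := by
  classical
  by_cases h : ∀ x y : μ.cells, x.1.2 = y.1.2 → (g x).1.1 = (g y).1.1 → x = y
  · obtain ⟨p, q, hp, hq, rfl⟩ := exists_eq_row_mul_col g h
    refine ⟨((Equiv.Perm.sign q : ℤ) : k), ?_⟩
    rw [map_mul, ← mul_assoc, rowSymm_mul_of hp, mul_assoc, of_mul_colSymm hq, mul_smul_comm,
      Int.cast_smul_eq_zsmul]
  · push Not at h
    obtain ⟨x, y, hcol, hrow, hxy⟩ := h
    refine ⟨0, ?_⟩
    have hq : ∀ c, (Equiv.swap x y c).1.2 = c.1.2 := by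
      intro c
      rw [Equiv.swap_apply_def]
      split_ifs with h1 h2
      · rw [h1, hcol]
      · rw [h2, hcol]
      · rfl
    have hp : ∀ c, (Equiv.swap (g x) (g y) c).1.1 = c.1.1 := by
      intro c
      rw [Equiv.swap_apply_def]
      split_ifs with h1 h2
      · rw [h1, hrow]
      · rw [h2, hrow]
      · rfl
    have e : Equiv.swap (g x) (g y) * g = g * Equiv.swap x y := by
      rw [Equiv.swap_apply_apply]
      group
    have h1 : μ.rowSymm k * MonoidAlgebra.of k _ g * μ.colSymm k =
        -(μ.rowSymm k * MonoidAlgebra.of k _ g * μ.colSymm k) := by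
      conv_lhs => rw [← rowSymm_mul_of hp, mul_assoc (μ.rowSymm k), ← map_mul, e, map_mul,
        mul_assoc, mul_assoc, of_mul_colSymm hq, Equiv.Perm.sign_swap hxy]
      rw [Units.val_neg, Units.val_one, neg_smul, one_smul, mul_neg, mul_neg, mul_assoc]
    have h2 : (2 : k) • (μ.rowSymm k * MonoidAlgebra.of k _ g * μ.colSymm k) = 0 := by
      rw [two_smul]
      nth_rw 1 [h1]
      rw [neg_add_cancel]
    rw [zero_smul]
    exact (smul_eq_zero.1 h2).resolve_left two_ne_zero

variable (μ k) in
/-- The Young symmetrizer in the group algebra. -/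
noncomputable def youngSymm : MonoidAlgebra k (Equiv.Perm μ.cells) := μ.rowSymm k * μ.colSymm k

/-- With `a` and `b` the row and column symmetrizers, `(a b) x (a b) = a (b x a) b`, and the middle
factor is expanded in group elements. -/
theorem youngSymm_mul_mul (x : MonoidAlgebra k (Equiv.Perm μ.cells)) :
    ∃ s : k, μ.youngSymm k * x * μ.youngSymm k = s • μ.youngSymm k := by
  have h : ∀ y, ∃ s : k, μ.rowSymm k * y * μ.colSymm k = s • μ.youngSymm k := by
    intro y
    induction y using MonoidAlgebra.induction_on with
    | of g => exact rowSymm_mul_of_mul_colSymm g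
    | add y z hy hz =>
      obtain ⟨s, hs⟩ := hy
      obtain ⟨t, ht⟩ := hz
      exact ⟨s + t, by rw [mul_add, add_mul, hs, ht, add_smul]⟩
    | smul c y hy =>
      obtain ⟨s, hs⟩ := hy
      exact ⟨c * s, by rw [mul_smul_comm, smul_mul_assoc, hs, smul_smul]⟩
  obtain ⟨s, hs⟩ := h (μ.colSymm k * x * μ.rowSymm k)
  refine ⟨s, ?_⟩
  rw [← hs]
  simp only [youngSymm, mul_assoc]

end YoungDiagram

/-- The left ideal `R x` is generated by an idempotent `e = y x`, and `x ∈ R e` gives `x = x e`. -/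
theorem IsSemisimpleRing.exists_eq_mul_mul {R : Type*} [Ring R] [IsSemisimpleRing R] (x : R) :
    ∃ y, x = x * y * x := by
  obtain ⟨e, he, h⟩ := IsSemisimpleRing.ideal_eq_span_idempotent (Ideal.span {x})
  obtain ⟨y, hy⟩ := Ideal.mem_span_singleton'.1 (h ▸ Ideal.subset_span rfl : e ∈ Ideal.span {x})
  obtain ⟨r, hr⟩ := Ideal.mem_span_singleton'.1 (h ▸ Ideal.subset_span rfl : x ∈ Ideal.span {e})
  refine ⟨y, ?_⟩
  rw [mul_assoc, hy, ← hr, mul_assoc, he.eq]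

end YoungSymmetrizer

namespace LinearOperad

/-! ### Invariants of a module with a spanning family of weight vectors -/

section TailSpan

variable {k : Type u} [Field k] [CharZero k] {M : Type*} [AddCommGroup M] [Module k M]
  [LieRingModule (glInf k) M] [LieModule k (glInf k) M] {n : ℕ}

/-- Each spanning vector is either invariant or in `tailPos`, according to its weight, so the
splitting divides the family in two. -/
theorem mem_span_of_mem_tailInv {ι : Type*} (x : ι → M) (κ : ι → (ℕ →₀ ℤ)) (hκ : ∀ i, 0 ≤ κ i)
    (hx : ∀ i, x i ∈ wtSpace (k := k) M (κ i)) (h : Submodule.span k (Set.range x) = ⊤)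
    {m : M} (hm : m ∈ tailInv (k := k) M n) :
    m ∈ Submodule.span k (x '' {i | ∀ j, n ≤ j → κ i j = 0}) := by
  have hM : IsWeightModule k M := IsWeightModule.of_span x κ hκ hx h
  let A := Submodule.span k (x '' {i | ∀ j, n ≤ j → κ i j = 0})
  have hle : (⊤ : Submodule k M) ≤ A ⊔ tailPos (k := k) M n := by
    rw [← h]
    refine Submodule.span_le.2 ?_
    rintro _ ⟨i, rfl⟩
    by_cases hi : ∀ j, n ≤ j → κ i j = 0
    · exact Submodule.mem_sup_left (Submodule.subset_span ⟨i, hi, rfl⟩)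
    · push Not at hi
      exact Submodule.mem_sup_right (Submodule.subset_span ⟨κ i, hi, hx i⟩)
  obtain ⟨r, hr, s, hs, rfl⟩ := Submodule.mem_sup.1 (hle (Submodule.mem_top (x := m)))
  have hA : A ≤ tailInv (k := k) M n := by
    refine Submodule.span_le.2 ?_
    rintro _ ⟨i, hi, rfl⟩
    exact hM.mem_tailInv hi (hx i)
  have : s = 0 := by
    refine tailInv_disjoint_tailPos ?_ hs
    have := Submodule.sub_mem _ hm (hA hr)
    rwa [add_sub_cancel_left] at this
  rw [this, add_zero]
  exact hr

end TailSpan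

/-! ### Tensor powers of `W`: words, permutations and multilinear vectors -/

section Words

variable {k : Type u} [Field k] {ι : Type} [Fintype ι] [DecidableEq ι]

/-- The pure tensor `⨂ e_{w(c)}`. -/
noncomputable def word (w : ι → ℕ) : ((WRep k).tensorPow ι).carrier :=
  PiTensorProduct.tprod k (fun c => (Finsupp.single (w c) (1 : k) : ℕ →₀ k))

/-- The weight of a word: the number of occurrences of each letter. -/
noncomputable def content (w : ι → ℕ) : ℕ →₀ ℤ := ∑ c, Finsupp.single (w c) 1

variable (k ι) in
/-- The basis of words of a tensor power of `W`. -/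
noncomputable def wordBasis : Module.Basis (ι → ℕ) k ((WRep k).tensorPow ι).carrier :=
  Basis.piTensorProduct (fun _ : ι => (Finsupp.basisSingleOne : Module.Basis ℕ k (ℕ →₀ k)))

theorem wordBasis_apply (w : ι → ℕ) : wordBasis k ι w = word w := by
  refine (Basis.piTensorProduct_apply
    (fun _ : ι => (Finsupp.basisSingleOne : Module.Basis ℕ k (ℕ →₀ k))) w).trans ?_
  simp only [Finsupp.coe_basisSingleOne]
  rfl

theorem span_word : Submodule.span k (Set.range (word : (ι → ℕ) → ((WRep k).tensorPow ι).carrier)) =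
    ⊤ := by
  rw [← (wordBasis k ι).span_eq]
  congr 2
  funext w
  rw [wordBasis_apply]

theorem lie_word (i j : ℕ) (w : ι → ℕ) : ⁅matUnit k i j, (word w : ((WRep k).tensorPow ι).carrier)⁆ =
    ∑ c, if w c = j then word (Function.update w c i) else 0 := by
  refine (LieRep.tensorAct_tprod (WRep k) ι (matUnit k i j) _).trans ?_
  refine Finset.sum_congr rfl fun c _ => ?_
  have h : (⁅matUnit k i j, (Finsupp.single (w c) (1 : k) : (WRep k).carrier)⁆ : (WRep k).carrier) =
      (if w c = j then Finsupp.single i 1 else 0 : ℕ →₀ k) := matUnit_single i j (w c) 1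
  erw [h]
  split_ifs with hc
  · refine congrArg (PiTensorProduct.tprod k) (funext fun d => ?_)
    by_cases hd : d = c
    · subst hd
      refine (Function.update_self ..).trans ?_
      rw [Function.update_self]
    · refine (Function.update_of_ne hd ..).trans ?_
      rw [Function.update_of_ne hd]
  · exact (PiTensorProduct.tprod k).map_update_zero _ c

theorem word_mem_wtSpace (w : ι → ℕ) :
    (word w : ((WRep k).tensorPow ι).carrier) ∈ wtSpace (k := k) _ (content w) := by
  intro j
  rw [lie_word, content, Finsupp.finsetSum_apply, Int.cast_sum, Finset.sum_smul]
  refine Finset.sum_congr rfl fun c _ => ?_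
  rw [Finsupp.single_apply]
  split_ifs with h
  · rw [← h, Function.update_eq_self, Int.cast_one, one_smul]
  · rw [Int.cast_zero, zero_smul]

omit [DecidableEq ι] in
theorem content_nonneg (w : ι → ℕ) : 0 ≤ content w := by
  refine Finset.sum_nonneg fun c _ j => ?_
  rw [Finsupp.single_apply]
  split_ifs <;> simp

omit [DecidableEq ι] in
theorem content_apply (w : ι → ℕ) (j : ℕ) :
    content w j = (Finset.univ.filter fun c => w c = j).card := by
  rw [content, Finsupp.finsetSum_apply, Finset.card_filter]
  push_cast
  refine Finset.sum_congr rfl fun c _ => ?_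
  rw [Finsupp.single_apply]

theorem isWeightModule_tensorPow_WRep : IsWeightModule k ((WRep k).tensorPow ι).carrier :=
  IsWeightModule.of_span word content content_nonneg word_mem_wtSpace span_word

theorem permHom_word (σ : Equiv.Perm ι) (w : ι → ℕ) :
    (WRep k).permHom ι σ (word w) = word (w ∘ σ.symm) :=
  PiTensorProduct.reindex_tprod (R := k) σ
    (fun c => (Finsupp.single (w c) (1 : k) : ℕ →₀ k))

theorem word_hom_ext {N : Type*} [AddCommGroup N] [Module k N]
    {f g : ((WRep k).tensorPow ι).carrier →ₗ[k] N} (h : ∀ w, f (word w) = g (word w)) : f = g :=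
  (wordBasis k ι).ext fun w => by rw [wordBasis_apply, h]

variable (k ι) in
/-- The action of the group algebra of the symmetric group on a tensor power of `W`. -/
noncomputable def permAct : MonoidAlgebra k (Equiv.Perm ι) →ₐ[k]
    Module.End k ((WRep k).tensorPow ι).carrier :=
  MonoidAlgebra.lift k _ (Equiv.Perm ι)
    { toFun := fun σ => ((WRep k).permHom ι σ : _ →ₗ[k] _)
      map_one' := word_hom_ext fun w => permHom_word 1 w
      map_mul' := fun σ τ => word_hom_ext fun w => by
        change (WRep k).permHom ι (σ * τ) (word w) =
          (WRep k).permHom ι σ ((WRep k).permHom ι τ (word w))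
        rw [permHom_word, permHom_word, permHom_word]
        rfl }

theorem permAct_of (σ : Equiv.Perm ι) (m : ((WRep k).tensorPow ι).carrier) :
    permAct k ι (MonoidAlgebra.of k _ σ) m = (WRep k).permHom ι σ m := by
  rw [permAct, MonoidAlgebra.lift_of]
  rfl

theorem permAct_of_word (σ : Equiv.Perm ι) (w : ι → ℕ) :
    permAct k ι (MonoidAlgebra.of k _ σ) (word w) = word (w ∘ σ.symm) := by
  rw [permAct_of, permHom_word]

/-- The action of an element of the group algebra as a homomorphism of `𝔤𝔩`-modules. -/
noncomputable def permActHom (x : MonoidAlgebra k (Equiv.Perm ι)) :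
    ((WRep k).tensorPow ι).carrier →ₗ⁅k, glInf k⁆ ((WRep k).tensorPow ι).carrier :=
  { permAct k ι x with
    map_lie' := fun {g m} => by
      change permAct k ι x ⁅g, m⁆ = ⁅g, permAct k ι x m⁆
      induction x using MonoidAlgebra.induction_on with
      | of σ => rw [permAct_of, permAct_of, LieModuleHom.map_lie]
      | add x y hx hy => rw [map_add, LinearMap.add_apply, LinearMap.add_apply, lie_add, hx, hy]
      | smul c x hx => rw [map_smul, LinearMap.smul_apply, LinearMap.smul_apply, lie_smul, hx] }

theorem permActHom_apply (x : MonoidAlgebra k (Equiv.Perm ι))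
    (m : ((WRep k).tensorPow ι).carrier) : permActHom x m = permAct k ι x m := rfl

theorem youngSymmetrizer_apply (μ : YoungDiagram) (m : ((WRep k).tensorPow μ.cells).carrier) :
    (WRep k).youngSymmetrizer μ m = permAct k μ.cells (μ.youngSymm k) m := by
  classical
  let ev : (((WRep k).tensorPow μ.cells).carrier →ₗ⁅k, glInf k⁆
      ((WRep k).tensorPow μ.cells).carrier) →+ ((WRep k).tensorPow μ.cells).carrier :=
    { toFun := fun f => f m, map_zero' := rfl, map_add' := fun _ _ => rfl }
  change ev ((WRep k).youngSymmetrizer μ) = _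
  rw [LieRep.youngSymmetrizer, YoungDiagram.youngSymm, YoungDiagram.rowSymm, YoungDiagram.colSymm,
    Finset.sum_mul_sum, map_sum, map_sum, LinearMap.sum_apply]
  refine Finset.sum_congr (by congr!) fun p _ => ?_
  rw [map_sum, map_sum, LinearMap.sum_apply]
  refine Finset.sum_congr (by congr!) fun q _ => ?_
  rw [map_zsmul, mul_smul_comm, map_zsmul, LinearMap.smul_apply, map_mul, Module.End.mul_apply,
    permAct_of, permAct_of]
  rfl

/-- Letters are replaced one at a time: `E_{w c, ε c}` changes position `c` only, because the letter
`ε c` occurs nowhere else. -/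
theorem word_mem_of_disjoint (U : LieSubmodule k (glInf k) ((WRep k).tensorPow ι).carrier)
    {ε w : ι → ℕ} (hε : Function.Injective ε) (hw : ∀ c d, w c ≠ ε d) (h : word ε ∈ U) :
    word w ∈ U := by
  have key : ∀ s : Finset ι, (word (s.piecewise w ε) : ((WRep k).tensorPow ι).carrier) ∈ U := by
    intro s
    induction s using Finset.induction_on with
    | empty => simpa using h
    | insert c s hc ih =>
      have h1 := U.lie_mem (x := matUnit k (w c) (ε c)) ih
      rw [lie_word, Finset.sum_eq_single c] at h1
      · rw [if_pos (by simp [hc])] at h1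
        rwa [Finset.piecewise_insert]
      · intro d _ hd
        rw [if_neg]
        by_cases hds : d ∈ s
        · simpa [hds] using hw d c
        · simpa [hds] using hε.ne hd
      · simp
  simpa using key Finset.univ

/-- A submodule containing a word without repeated letters contains all words. -/
theorem word_mem_of_injective (U : LieSubmodule k (glInf k) ((WRep k).tensorPow ι).carrier)
    {ε : ι → ℕ} (hε : Function.Injective ε) (h : word ε ∈ U) (w : ι → ℕ) : word w ∈ U := by
  let N := Finset.univ.sup ε + Finset.univ.sup w + 1
  have hN : ∀ c, ε c < N ∧ w c < N := fun c => by
    have h1 := Finset.le_sup (f := ε) (Finset.mem_univ c)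
    have h2 := Finset.le_sup (f := w) (Finset.mem_univ c)
    constructor <;> omega
  -- Letters from `N` on occur neither in `ε` nor in `w`, so `ε'` is an intermediate word between
  -- two disjoint replacements.
  let ε' : ι → ℕ := fun c => N + Fintype.equivFin ι c
  have hε' : Function.Injective ε' := fun c d hcd => by
    simp only [ε', add_right_inj] at hcd
    exact (Fintype.equivFin ι).injective (Fin.ext hcd)
  have h1 : (word ε' : ((WRep k).tensorPow ι).carrier) ∈ U :=
    word_mem_of_disjoint U hε (fun c d => by have := (hN d).1; simp only [ε']; omega) h
  exact word_mem_of_disjoint U hε' (fun c d => by have := (hN c).2; simp only [ε']; omega) h1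

theorem mem_of_word_mem (U : LieSubmodule k (glInf k) ((WRep k).tensorPow ι).carrier)
    {ε : ι → ℕ} (hε : Function.Injective ε) (h : word ε ∈ U)
    (m : ((WRep k).tensorPow ι).carrier) : m ∈ U := by
  have : Submodule.span k (Set.range (word : (ι → ℕ) → ((WRep k).tensorPow ι).carrier)) ≤
      U.toSubmodule := by
    refine Submodule.span_le.2 ?_
    rintro _ ⟨w, rfl⟩
    exact word_mem_of_injective U hε h w
  rw [span_word] at this
  exact this Submodule.mem_top

variable [CharZero k]

theorem exists_content_eq {a : ℕ →₀ ℤ} {v : ((WRep k).tensorPow ι).carrier}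
    (h : v ∈ wtSpace (k := k) _ a) (h0 : v ≠ 0) : ∃ w : ι → ℕ, content w = a := by
  have := mem_span_of_mem_wtSpace word content word_mem_wtSpace
    (by rw [span_word]; exact Submodule.mem_top) h
  by_contra! hc
  rw [show {w : ι → ℕ | content w = a} = ∅ from Set.eq_empty_of_forall_notMem hc] at this
  exact h0 (by simpa using this)

/-- Every nonzero submodule of a tensor power of `W` contains a nonzero multilinear vector. -/
theorem exists_multilinear_mem (A : LieSubmodule k (glInf k) ((WRep k).tensorPow ι).carrier)
    (hA : A ≠ ⊥) : ∃ ε : ι → ℕ, Function.Injective ε ∧ ∃ v ∈ A, v ≠ 0 ∧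
      v ∈ wtSpace (k := k) _ (content ε) := by
  classical
  have hX : IsWeightModule k ((WRep k).tensorPow ι).carrier := isWeightModule_tensorPow_WRep
  -- `r` bounds the number of distinct letters still missing; a word with as many distinct letters
  -- as positions is injective.
  have key : ∀ (r : ℕ) (a : ℕ →₀ ℤ) (v : ((WRep k).tensorPow ι).carrier), v ∈ A → v ≠ 0 →
      v ∈ wtSpace (k := k) _ a → Fintype.card ι ≤ a.support.card + r →
      ∃ ε : ι → ℕ, Function.Injective ε ∧ ∃ v ∈ A, v ≠ 0 ∧
      v ∈ wtSpace (k := k) _ (content ε) := by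
    intro r
    induction r with
    | zero =>
      intro a v hvA hv0 hva hr
      obtain ⟨w, rfl⟩ := exists_content_eq hva hv0
      refine ⟨w, ?_, v, hvA, hv0, hva⟩
      have h1 : (content w).support ⊆ Finset.univ.image w := by
        intro j hj
        rw [Finsupp.mem_support_iff, content_apply] at hj
        have hj' : (Finset.univ.filter fun c => w c = j).card ≠ 0 := by exact_mod_cast hj
        obtain ⟨c, hc⟩ := Finset.card_ne_zero.1 hj'
        exact Finset.mem_image.2 ⟨c, Finset.mem_univ _, (Finset.mem_filter.1 hc).2⟩
      have h2 := Finset.card_le_card h1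
      have h3 : (Finset.univ.image w).card = (Finset.univ : Finset ι).card := by
        refine le_antisymm Finset.card_image_le ?_
        rw [Finset.card_univ]
        omega
      have h4 : Set.InjOn w ((Finset.univ : Finset ι) : Set ι) := Finset.card_image_iff.1 h3
      exact fun x y hxy => h4 (Finset.mem_coe.2 (Finset.mem_univ x))
        (Finset.mem_coe.2 (Finset.mem_univ y)) hxy
    | succ r ih =>
      intro a v hvA hv0 hva hr
      obtain ⟨w, rfl⟩ := exists_content_eq hva hv0
      by_cases hw : Function.Injective w
      · exact ⟨w, hw, v, hvA, hv0, hva⟩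
      · obtain ⟨c, d, hcd, hne⟩ : ∃ c d, w c = w d ∧ c ≠ d := by
          simpa [Function.Injective] using hw
        -- `N` is a letter absent from `w`. Applying `E_{N, w c}` to `v` adds `N` to the support of
        -- the weight and keeps `w c` there, as `w c` occurs at least twice. The result is nonzero
        -- because `E_{w c, N}` brings it back to `content w (w c) • v`.
        obtain ⟨N, hN⟩ := Infinite.exists_notMem_finset (content w).support
        have hN0 : content w N = 0 := Finsupp.notMem_support_iff.1 hN
        have h2 : 2 ≤ content w (w c) := by
          rw [content_apply]
          have h3 : ({c, d} : Finset ι) ⊆ Finset.univ.filter fun e => w e = w c := by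
            intro e he
            rw [Finset.mem_insert, Finset.mem_singleton] at he
            rcases he with rfl | rfl <;> simp [hcd]
          have := Finset.card_le_card h3
          rw [Finset.card_pair hne] at this
          exact_mod_cast this
        have hcN : w c ≠ N := by
          rintro rfl
          omega
        have h0 : ⁅matUnit k (w c) N, v⁆ = 0 := by
          by_contra hc0
          have := hX.nonneg (matUnit_mem_wtSpace hva (w c) N) hc0 N
          simp [hN0, hcN] at this
        have h1 : ⁅matUnit k (w c) N, ⁅matUnit k N (w c), v⁆⁆ = (content w (w c) : k) • v := by
          rw [leibniz_lie, h0, lie_zero, add_zero, matUnit_lie, if_pos rfl, if_pos rfl, sub_lie,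
            hva, hva, hN0, Int.cast_zero, zero_smul, sub_zero]
        have hne0 : ⁅matUnit k N (w c), v⁆ ≠ 0 := by
          intro hc0
          rw [hc0, lie_zero, eq_comm, smul_eq_zero] at h1
          rcases h1 with h1 | h1
          · have : content w (w c) = 0 := by exact_mod_cast h1
            omega
          · exact hv0 h1
        refine ih _ _ (A.lie_mem hvA) hne0 (matUnit_mem_wtSpace hva N (w c)) ?_
        have hsub : insert N (content w).support ⊆
            (content w + Finsupp.single N 1 - Finsupp.single (w c) 1).support := by
          intro j hj
          rw [Finsupp.mem_support_iff]
          rw [Finset.mem_insert, Finsupp.mem_support_iff] at hj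
          have hj0 := content_nonneg w j
          rw [Finsupp.coe_zero, Pi.zero_apply] at hj0
          simp only [Finsupp.sub_apply, Finsupp.add_apply, Finsupp.single_apply]
          by_cases e1 : w c = j
          · subst e1
            rw [if_neg (Ne.symm hcN), if_pos rfl]
            omega
          · by_cases e2 : N = j
            · subst e2
              rw [if_pos rfl, if_neg e1]
              omega
            · rw [if_neg e1, if_neg e2]
              have := hj.resolve_left (Ne.symm e2)
              omega
        have := Finset.card_le_card hsub
        rw [Finset.card_insert_of_notMem hN] at this
        omega
  obtain ⟨m, hm, hm0⟩ := A.toSubmodule.ne_bot_iff.1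
    (fun h => hA ((LieSubmodule.toSubmodule_eq_bot A).1 h))
  have hWA := hX.lieSubmodule A
  obtain ⟨v, hv, -, hvm⟩ := hWA.exists_finsupp ⟨m, hm⟩
  obtain ⟨a, ha⟩ : ∃ a, v a ≠ 0 := by
    by_contra! hc
    rw [show v = 0 from Finsupp.ext hc] at hvm
    exact hm0 (by simpa using (congrArg Subtype.val hvm).symm)
  exact key (Fintype.card ι) a (v a).1 (v a).2 (fun h => ha (Subtype.ext h))
    (wtSpace_map A.incl (hv a)) (Nat.le_add_left _ _)

/-- Words with the same content as an injective word are its rearrangements, so this weight space is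
generated by one word over the group algebra. -/
theorem exists_permAct_eq_of_mem_wtSpace {ε : ι → ℕ} (hε : Function.Injective ε)
    {y : ((WRep k).tensorPow ι).carrier} (hy : y ∈ wtSpace (k := k) _ (content ε)) :
    ∃ z, permAct k ι z (word ε) = y := by
  have := mem_span_of_mem_wtSpace word content word_mem_wtSpace
    (by rw [span_word]; exact Submodule.mem_top) hy
  have hle : Submodule.span k (word '' {w : ι → ℕ | content w = content ε}) ≤
      LinearMap.range ((permAct k ι).toLinearMap.flip (word ε)) := by
    refine Submodule.span_le.2 ?_
    rintro _ ⟨w, hw, rfl⟩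
    have hcard : ∀ j, (Finset.univ.filter fun c => w c = j).card =
        (Finset.univ.filter fun c => ε c = j).card := fun j => by
      have := congrArg (fun a => a j) (show content w = content ε from hw)
      simp only [content_apply] at this
      exact_mod_cast this
    have hex : ∀ c, ∃ d, ε d = w c := by
      intro c
      have h1 : (Finset.univ.filter fun d => ε d = w c).card ≠ 0 := by
        rw [← hcard]
        exact Finset.card_ne_zero_of_mem (Finset.mem_filter.2 ⟨Finset.mem_univ c, rfl⟩)
      obtain ⟨d, hd⟩ := Finset.card_ne_zero.1 h1
      exact ⟨d, (Finset.mem_filter.1 hd).2⟩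
    choose s hs using hex
    have hsinj : Function.Injective s := by
      intro c d hcd
      have h1 : (Finset.univ.filter fun e => w e = w c).card ≤ 1 := by
        rw [hcard, Finset.card_le_one]
        intro a ha b hb
        exact hε ((Finset.mem_filter.1 ha).2.trans (Finset.mem_filter.1 hb).2.symm)
      refine Finset.card_le_one.1 h1 _ (by simp) _ ?_
      simp [← hs, hcd]
    let σ : Equiv.Perm ι := Equiv.ofBijective s (Finite.injective_iff_bijective.1 hsinj)
    refine ⟨MonoidAlgebra.of k _ σ.symm, ?_⟩
    change permAct k ι _ (word ε) = _
    rw [permAct_of_word]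
    congr 1
    funext c
    exact hs c
  exact hle this

end Words

end LinearOperad

/-- A homomorphism of Lie modules as a surjection onto its range. -/
def LieModuleHom.toRange {k L M N : Type*} [CommRing k] [LieRing L] [LieAlgebra k L]
    [AddCommGroup M] [Module k M] [LieRingModule L M] [LieModule k L M] [AddCommGroup N]
    [Module k N] [LieRingModule L N] [LieModule k L N] (f : M →ₗ⁅k, L⁆ N) : M →ₗ⁅k, L⁆ f.range :=
  { (f : M →ₗ[k] N).rangeRestrict with
    map_lie' := fun {x m} => Subtype.ext (f.map_lie x m) }

theorem LieModuleHom.toRange_surjective {k L M N : Type*} [CommRing k] [LieRing L] [LieAlgebra k L]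
    [AddCommGroup M] [Module k M] [LieRingModule L M] [LieModule k L M] [AddCommGroup N]
    [Module k N] [LieRingModule L N] [LieModule k L N] (f : M →ₗ⁅k, L⁆ N) :
    Function.Surjective f.toRange :=
  (f : M →ₗ[k] N).surjective_rangeRestrict

namespace LinearOperad

/-! ### Simplicity of `S_μ(W)` and classification of simple weight modules -/

section Schur

variable {k : Type u} [Field k] (μ : YoungDiagram)

theorem youngSymmetrizer_word_eq (m : ((WRep k).tensorPow μ.cells).carrier) :
    (WRep k).youngSymmetrizer μ m = permAct k μ.cells (μ.rowSymm k)
      (permAct k μ.cells (μ.colSymm k) m) := by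
  rw [youngSymmetrizer_apply, YoungDiagram.youngSymm, map_mul, Module.End.mul_apply]

variable [CharZero k]

/-- The image of the Young symmetrizer has no proper nonzero submodules. -/
theorem range_youngSymmetrizer_le {A : LieSubmodule k (glInf k) ((WRep k).tensorPow μ.cells).carrier}
    (hA : A ≠ ⊥) (hle : A ≤ ((WRep k).youngSymmetrizer μ).range) :
    ((WRep k).youngSymmetrizer μ).range ≤ A := by
  have hX : IsWeightModule k ((WRep k).tensorPow μ.cells).carrier := isWeightModule_tensorPow_WRep
  obtain ⟨ε, hε, v, hvA, hv0, hv⟩ := exists_multilinear_mem A hA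
  let F := ((WRep k).youngSymmetrizer μ).toRange
  have hF : Function.Surjective F :=
    ((WRep k).youngSymmetrizer μ).toRange_surjective
  obtain ⟨y, hy, hyv⟩ := hX.exists_wt_preimage F hF (x := ⟨v, hle hvA⟩) (a := content ε)
    (fun j => Subtype.ext (hv j))
  -- With `c` the Young symmetrizer, the vector `v` of `A` is `c z` applied to the word `ε`. As this
  -- word generates the whole tensor power, `c z` maps all of it into `A`.
  obtain ⟨z, rfl⟩ := exists_permAct_eq_of_mem_wtSpace hε hy
  set c := μ.youngSymm k with hc
  have hyv' : permAct k μ.cells (c * z) (word ε) = v := by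
    rw [map_mul, Module.End.mul_apply, ← youngSymmetrizer_apply]
    exact congrArg Subtype.val hyv
  have hall : ∀ m, permAct k μ.cells (c * z) m ∈ A := fun m =>
    LieSubmodule.mem_comap.1 (mem_of_word_mem (A.comap (permActHom (c * z))) hε
      (LieSubmodule.mem_comap.2 (by rw [permActHom_apply, hyv']; exact hvA)) m)
  have : NeZero (Nat.card (Equiv.Perm μ.cells) : k) := ⟨by exact_mod_cast Nat.card_pos.ne'⟩
  -- From `c z = (c z) t (c z)` and `c (z t) c = s c` one gets `s ≠ 0`, since `c z ≠ 0`. Then `s • c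
  -- m = (c z)(t c m)` lies in `A` for every `m`.
  obtain ⟨t, ht⟩ := IsSemisimpleRing.exists_eq_mul_mul (c * z)
  obtain ⟨s, hs⟩ := μ.youngSymm_mul_mul (k := k) (z * t)
  rw [← hc] at hs
  have hs0 : s ≠ 0 := by
    rintro rfl
    rw [zero_smul] at hs
    have : c * z = 0 := by
      rw [ht, show c * z * t * (c * z) = c * (z * t) * c * z by simp only [mul_assoc], hs, zero_mul]
    rw [this, map_zero, LinearMap.zero_apply] at hyv'
    exact hv0 hyv'.symm
  intro m hm
  obtain ⟨m, rfl⟩ := (LieModuleHom.mem_range _ _).1 hm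
  have h1 := hall (permAct k μ.cells (t * c) m)
  rw [← Module.End.mul_apply, ← map_mul, show c * z * (t * c) = c * (z * t) * c by
    simp only [mul_assoc], hs, map_smul, LinearMap.smul_apply, hc, ← youngSymmetrizer_apply] at h1
  have h2 := A.smul_mem s⁻¹ h1
  rwa [smul_smul, inv_mul_cancel₀ hs0, one_smul] at h2

/-- The transposition of two cells in a column fixes the word but changes the sign of the column
antisymmetrizer. -/
theorem colSymm_word_eq_zero {w : μ.cells → ℕ} {c d : μ.cells} (hcd : c ≠ d)
    (hcol : c.1.2 = d.1.2) (hw : w c = w d) :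
    permAct k μ.cells (μ.colSymm k) (word w) = 0 := by
  have h1 := μ.colSymm_mul_of (k := k) (q := Equiv.swap c d) (fun e => by
    by_cases h1 : e = c
    · rw [h1, Equiv.swap_apply_left, hcol]
    · by_cases h2 : e = d
      · rw [h2, Equiv.swap_apply_right, hcol]
      · rw [Equiv.swap_apply_of_ne_of_ne h1 h2])
  have h2 := congrArg (fun x => permAct k μ.cells x (word w)) h1
  have h3 : w ∘ (Equiv.swap c d).symm = w := by
    funext e
    rw [Equiv.symm_swap, Function.comp_apply]
    by_cases h1 : e = c
    · rw [h1, Equiv.swap_apply_left, hw]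
    · by_cases h2 : e = d
      · rw [h2, Equiv.swap_apply_right, hw]
      · rw [Equiv.swap_apply_of_ne_of_ne h1 h2]
  simp only [map_mul, Module.End.mul_apply] at h2
  rw [permAct_of_word, h3, Equiv.Perm.sign_swap hcd] at h2
  simp only [Units.val_neg, Units.val_one, neg_smul, one_smul, map_neg, LinearMap.neg_apply] at h2
  have h4 : (2 : k) • permAct k μ.cells (μ.colSymm k) (word w) = 0 := by
    rw [two_smul]
    nth_rewrite 1 [h2]
    exact neg_add_cancel _
  exact (smul_eq_zero.1 h4).resolve_left two_ne_zero

/-- The word which labels each cell by its row. -/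
def rowWord (c : μ.cells) : ℕ := c.1.1

/-- The coefficient of the row word does not vanish. A column preserving permutation fixing that
word is trivial, so the antisymmetrized word has coefficient 1; row preserving permutations do not
change the coefficient, so the row symmetrizer multiplies it by their number, nonzero in
characteristic 0. -/
theorem youngSymmetrizer_rowWord_ne_zero :
    (WRep k).youngSymmetrizer μ (word (rowWord μ)) ≠ 0 := by
  classical
  let φ : ((WRep k).tensorPow μ.cells).carrier →ₗ[k] k :=
    Finsupp.lapply (rowWord μ) ∘ₗ (wordBasis k μ.cells).repr.toLinearMap
  have hφ : ∀ w, φ (word w) = if w = rowWord μ then 1 else 0 := fun w => by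
    change (wordBasis k μ.cells).repr (word w) (rowWord μ) = _
    rw [← wordBasis_apply, Module.Basis.repr_self, Finsupp.single_apply]
  have h1 : φ (permAct k μ.cells (μ.colSymm k) (word (rowWord μ))) = 1 := by
    rw [YoungDiagram.colSymm, map_sum, LinearMap.sum_apply, map_sum, Finset.sum_eq_single 1]
    · rw [map_zsmul, LinearMap.smul_apply, map_zsmul, permAct_of_word, hφ]
      rw [if_pos (by rfl)]
      simp
    · intro q hq hq1
      rw [map_zsmul, LinearMap.smul_apply, map_zsmul, permAct_of_word, hφ, if_neg, smul_zero]
      intro h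
      refine hq1 (Equiv.ext fun c => Subtype.ext (Prod.ext ?_ ?_))
      · have := congrFun h (q c)
        rw [Function.comp_apply, Equiv.symm_apply_apply] at this
        exact this.symm
      · exact (Finset.mem_filter.1 hq).2 c
    · intro h
      exact absurd (Finset.mem_filter.2 ⟨Finset.mem_univ _, fun _ => rfl⟩) h
  have h2 : ∀ p : Equiv.Perm μ.cells, (∀ c, (p c).1.1 = c.1.1) → ∀ m,
      φ (permAct k μ.cells (MonoidAlgebra.of k _ p) m) = φ m := by
    intro p hp m
    have : φ ∘ₗ permAct k μ.cells (MonoidAlgebra.of k _ p) = φ := word_hom_ext fun w => by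
      rw [LinearMap.comp_apply, permAct_of_word, hφ, hφ]
      congr 1
      refine propext ⟨fun h => ?_, fun h => ?_⟩
      · funext c
        have := congrFun h (p c)
        rw [Function.comp_apply, Equiv.symm_apply_apply] at this
        rw [this]
        exact hp c
      · funext c
        rw [h]
        have := hp (p.symm c)
        rw [Equiv.apply_symm_apply] at this
        exact this.symm
    exact congrArg (fun F => F m) this
  intro h
  have h3 := congrArg φ h
  rw [youngSymmetrizer_word_eq, YoungDiagram.rowSymm, map_sum, LinearMap.sum_apply, map_sum,
    Finset.sum_congr rfl (fun p hp => (h2 p (Finset.mem_filter.1 hp).2 _).trans h1),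
    Finset.sum_const, nsmul_eq_mul, mul_one, map_zero, Nat.cast_eq_zero, Finset.card_eq_zero] at h3
  exact Finset.notMem_empty (1 : Equiv.Perm μ.cells)
    (h3 ▸ Finset.mem_filter.2 ⟨Finset.mem_univ _, fun _ => rfl⟩)

/-- The highest weight vector of `S_μ(W)`. -/
noncomputable def schurVec : ((WRep k).schur μ).carrier :=
  ((WRep k).youngSymmetrizer μ).toRange (word (rowWord μ))

theorem isHighestWeight_schurVec :
    IsHighestWeight (k := k) (content (rowWord μ)) (schurVec (k := k) μ) where
  ne_zero h := youngSymmetrizer_rowWord_ne_zero (k := k) μ (congrArg Subtype.val h)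
  mem := wtSpace_map ((WRep k).youngSymmetrizer μ).toRange (word_mem_wtSpace (rowWord μ))
  lie_eq_zero i j hij := by
    refine (((WRep k).youngSymmetrizer μ).toRange.map_lie (matUnit k i j)
      (word (rowWord μ))).symm.trans ?_
    refine Subtype.ext ?_
    change (WRep k).youngSymmetrizer μ ⁅matUnit k i j, (word (rowWord μ) : _)⁆ = 0
    rw [lie_word, map_sum]
    refine Finset.sum_eq_zero fun c _ => ?_
    split_ifs with hc
    -- The new letter `i` in the cell `c` of row `j` is already carried by the cell of row `i` in
    -- the same column.
    · have hd : (i, c.1.2) ∈ μ.cells := μ.isLowerSet (a := c.1)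
        (Prod.mk_le_mk.2 ⟨hij.le.trans hc.symm.le, le_rfl⟩) c.2
      rw [youngSymmetrizer_word_eq, colSymm_word_eq_zero μ (c := c) (d := ⟨_, hd⟩), map_zero]
      · intro h
        have : c.1.1 = i := congrArg (fun x : μ.cells => x.1.1) h
        rw [rowWord] at hc
        omega
      · rfl
      · rw [Function.update_self, Function.update_of_ne]
        · rfl
        · intro h
          have : i = c.1.1 := congrArg (fun x : μ.cells => x.1.1) h
          rw [rowWord] at hc
          omega
    · exact map_zero _

theorem isIrreducible_schur : LieModule.IsIrreducible k (glInf k) ((WRep k).schur μ).carrier := by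
  have : Nontrivial ((WRep k).schur μ).carrier :=
    ⟨schurVec μ, 0, (isHighestWeight_schurVec (k := k) μ).ne_zero⟩
  refine LieModule.IsIrreducible.mk fun N hN => ?_
  let R := ((WRep k).youngSymmetrizer μ).range
  let A : LieSubmodule k (glInf k) ((WRep k).tensorPow μ.cells).carrier :=
    LieSubmodule.map R.incl N
  have hA : A ≠ ⊥ := fun h => hN <| by
    rw [LieSubmodule.eq_bot_iff] at h ⊢
    exact fun m hm => Subtype.ext (h m.1 (LieSubmodule.mem_map_of_mem hm))
  have h := range_youngSymmetrizer_le μ hA (by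
    intro m hm
    obtain ⟨m, -, rfl⟩ := (LieSubmodule.mem_map _).1 hm
    exact m.2)
  rw [eq_top_iff]
  intro m _
  obtain ⟨m', hm', h'⟩ := (LieSubmodule.mem_map _).1 (h m.2)
  have : m' = m := Subtype.ext h'
  rwa [← this]

/-- An invariant lifts to an invariant tensor, hence to a combination of words in the letters below
`n`. The first column has more than `n` cells, so a letter repeats there and the column
antisymmetrizer kills the word. -/
theorem eq_zero_of_mem_tailInv_schur {n : ℕ} (h : n < μ.colLen 0)
    {m : ((WRep k).schur μ).carrier} (hm : m ∈ tailInv (k := k) _ n) : m = 0 := by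
  have hX : IsWeightModule k ((WRep k).tensorPow μ.cells).carrier := isWeightModule_tensorPow_WRep
  let F := ((WRep k).youngSymmetrizer μ).toRange
  have hF : Function.Surjective F :=
    ((WRep k).youngSymmetrizer μ).toRange_surjective
  obtain ⟨y, hy, rfl⟩ := hX.exists_tailInv_preimage F hm (hF m)
  have hsp := mem_span_of_mem_tailInv (word : (μ.cells → ℕ) → ((WRep k).tensorPow μ.cells).carrier)
    content content_nonneg word_mem_wtSpace span_word hy
  have hle : Submodule.span k ((word : (μ.cells → ℕ) → ((WRep k).tensorPow μ.cells).carrier) ''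
      {w | ∀ j, n ≤ j → content w j = 0}) ≤ LinearMap.ker F.toLinearMap := by
    refine Submodule.span_le.2 ?_
    rintro _ ⟨w, hw, rfl⟩
    have hwn : ∀ c, w c < n := fun c => by
      by_contra! hc
      have := hw _ hc
      rw [content_apply] at this
      exact Finset.notMem_empty c (Finset.card_eq_zero.1 (by exact_mod_cast this) ▸
        Finset.mem_filter.2 ⟨Finset.mem_univ c, rfl⟩)
    let cell : Fin (n + 1) → μ.cells := fun i =>
      ⟨(i, 0), YoungDiagram.mem_iff_lt_colLen.2 (by omega)⟩
    obtain ⟨i, j, hij, hwij⟩ := Fintype.exists_ne_map_eq_of_card_lt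
      (fun i => (⟨w (cell i), hwn _⟩ : Fin n)) (by simp)
    refine Subtype.ext ?_
    change (WRep k).youngSymmetrizer μ (word w) = 0
    rw [youngSymmetrizer_word_eq, colSymm_word_eq_zero μ (c := cell i) (d := cell j), map_zero]
    · intro h
      exact hij (Fin.ext (congrArg (fun x : μ.cells => x.1.1) h))
    · rfl
    · exact congrArg Fin.val hwij
  exact hle hsp

theorem content_rowWord (i : ℕ) : content (rowWord μ) i = μ.rowLen i := by
  rw [content_apply, YoungDiagram.rowLen_eq_card]
  congr 1
  refine Finset.card_bij (fun c _ => c.1) (fun c hc => ?_) (fun c _ d _ h => Subtype.ext h)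
    (fun c hc => ?_)
  · exact YoungDiagram.mem_row_iff.2 ⟨c.2, (Finset.mem_filter.1 hc).2⟩
  · obtain ⟨h1, h2⟩ := YoungDiagram.mem_row_iff.1 hc
    exact ⟨⟨c, h1⟩, Finset.mem_filter.2 ⟨Finset.mem_univ _, h2⟩, rfl⟩

omit [CharZero k] in
theorem exists_youngDiagram_rowLen {a : ℕ →₀ ℤ} (h0 : 0 ≤ a) (ha : Antitone a) :
    ∃ μ : YoungDiagram, ∀ i, (μ.rowLen i : ℤ) = a i := by
  classical
  have hmem : ∀ x : ℕ × ℕ, x ∈ a.support.biUnion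
      (fun i => (Finset.range (a i).toNat).image (Prod.mk i)) ↔ (x.2 : ℤ) < a x.1 := by
    rintro ⟨i, j⟩
    have := h0 i
    simp only [Finset.mem_biUnion, Finset.mem_image, Finset.mem_range, Prod.mk.injEq]
    constructor
    · rintro ⟨i, -, j, hj, rfl, rfl⟩
      omega
    · intro h
      exact ⟨i, by rw [Finsupp.mem_support_iff]; omega, j, by omega, rfl, rfl⟩
  let μ : YoungDiagram :=
    { cells := a.support.biUnion fun i => (Finset.range (a i).toNat).image (Prod.mk i)
      isLowerSet := fun x y hxy hx => by
        rw [Finset.mem_coe, hmem] at hx ⊢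
        have h1 := ha hxy.1
        have h2 : y.2 ≤ x.2 := hxy.2
        omega }
  refine ⟨μ, fun i => ?_⟩
  have := h0 i
  rw [Finsupp.coe_zero, Pi.zero_apply] at this
  refine le_antisymm ?_ ?_
  · by_contra! h
    have h1 : (i, (a i).toNat) ∈ μ := YoungDiagram.mem_iff_lt_rowLen.2 (by omega)
    have h2 : ((a i).toNat : ℤ) < a i := (hmem _).1 h1
    omega
  · by_contra! h
    exact lt_irrefl _ (YoungDiagram.mem_iff_lt_rowLen.1 ((hmem (i, μ.rowLen i)).2 h))

/-- A simple weight module is isomorphic to `S_μ(W)`, with `μ` its highest weight. -/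
theorem exists_iso_schur {T : LieRep k (glInf k)} (hT : IsWeightModule k T.carrier)
    (hirr : LieModule.IsIrreducible k (glInf k) T.carrier) :
    ∃ (μ : YoungDiagram) (v : T.carrier), Nonempty (T ≅ (WRep k).schur μ) ∧ v ≠ 0 ∧
      ∃ a : ℕ →₀ ℤ, v ∈ wtSpace (k := k) T.carrier a ∧ ∀ i, a i = μ.rowLen i := by
  have := LieModule.nontrivial_of_isIrreducible k (glInf k) T.carrier
  obtain ⟨a, v, hv⟩ := hT.exists_isHighestWeight
  obtain ⟨μ, hμ⟩ := exists_youngDiagram_rowLen (hT.nonneg hv.mem hv.ne_zero) (hv.antitone hT)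
  have ha : content (rowWord μ) = a := Finsupp.ext fun i => by rw [content_rowWord, hμ]
  exact ⟨μ, v, IsHighestWeight.nonempty_iso hirr (isIrreducible_schur μ) hv
    (ha ▸ isHighestWeight_schurVec μ), hv.ne_zero, a, hv.mem, fun i => (hμ i).symm⟩

end Schur

end LinearOperad

namespace LinearOperad

/-! ### Decomposition of `𝔥` relative to the retraction of `V` onto `V_n` -/

section Retraction

variable {k : Type u} [Field k] (P : LinearOperad k)

/-- The retraction of `V` onto `V_n` killing the generators `x_i` with `i ≥ n`. -/
noncomputable def retr (n : ℕ) : P.VInf →ₗ[k] P.V n :=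
  Free.lift fun i => if h : i < n then Free.var ⟨i, h⟩ else 0

variable {P} {n : ℕ}

theorem incl_mono {S : Type} [Finite S] (f : S → Fin n) (p : P.obj S) :
    P.incl n (Free.mono f p) = Free.mono (fun s => (f s : ℕ)) p := by
  rw [incl, Free.lift_mono, ← Free.act_var]
  rfl

theorem retr_incl (v : P.V n) : P.retr n (P.incl n v) = v := by
  have : P.retr n ∘ₗ P.incl n = LinearMap.id := by
    refine Free.lin_ext fun r f p => ?_
    rw [LinearMap.comp_apply, incl_mono, retr, Free.lift_mono, LinearMap.id_apply, ← Free.act_var]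
    congr 1
    funext s
    exact dif_pos (f s).2
  exact congrArg (fun F => F v) this

theorem retr_var_of_le {i : ℕ} (h : n ≤ i) : P.retr n (Free.var i) = 0 := by
  rw [retr, Free.lift_var, dif_neg (not_lt.2 h)]

variable (P n)

/-- The derivations in `𝔥` killing the generators `x_i` with `i < n`. -/
def tailDer : Submodule k P.hInf where
  carrier := {δ | ∀ i, i < n → δ.1 (Free.var i) = 0}
  add_mem' {δ δ'} h h' i hi := by
    change δ.1 (Free.var i) + δ'.1 (Free.var i) = 0
    rw [h i hi, h' i hi, add_zero]
  zero_mem' _ _ := rfl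
  smul_mem' c δ h i hi := by
    change c • δ.1 (Free.var i) = 0
    rw [h i hi, smul_zero]

/-- The derivations in `𝔥` killing the generators `x_i` with `i ≥ n`. -/
def headDer : Submodule k P.hInf where
  carrier := {δ | ∀ i, n ≤ i → δ.1 (Free.var i) = 0}
  add_mem' {δ δ'} h h' i hi := by
    change δ.1 (Free.var i) + δ'.1 (Free.var i) = 0
    rw [h i hi, h' i hi, add_zero]
  zero_mem' _ _ := rfl
  smul_mem' c δ h i hi := by
    change c • δ.1 (Free.var i) = 0
    rw [h i hi, smul_zero]

/-- The derivations in `𝔥` whose image is killed by the retraction onto `V_n`. -/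
def posDer : Submodule k P.hInf where
  carrier := {δ | ∀ i, P.retr n (δ.1 (Free.var i)) = 0}
  add_mem' {δ δ'} h h' i := by
    change P.retr n (δ.1 (Free.var i) + δ'.1 (Free.var i)) = 0
    rw [map_add, h i, h' i, add_zero]
  zero_mem' _ := map_zero _
  smul_mem' c δ h i := by
    change P.retr n (c • δ.1 (Free.var i)) = 0
    rw [map_smul, h i, smul_zero]

variable {P n} in
theorem exists_mem_headDer_sub_mem_tailDer (δ : P.hInf) :
    ∃ δ' ∈ P.headDer n, δ - δ' ∈ P.tailDer n := by
  let δ' : P.hInf := ⟨Free.der fun i => if i < n then δ.1 (Free.var i) else 0,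
    Free.der_isDerivation _, n, fun i hi => (Free.der_var _ i).trans (if_neg (not_lt.2 hi))⟩
  have h : ∀ i, δ'.1 (Free.var i) = if i < n then δ.1 (Free.var i) else 0 :=
    fun i => Free.der_var (fun i => if i < n then δ.1 (Free.var i) else 0) i
  refine ⟨δ', fun i hi => ?_, fun i hi => ?_⟩
  · rw [h, if_neg (not_lt.2 hi)]
  · change δ.1 (Free.var i) - δ'.1 (Free.var i) = 0
    rw [h, if_pos hi, sub_self]

theorem headDer_sup_tailDer : P.headDer n ⊔ P.tailDer n = ⊤ := by
  refine Submodule.eq_top_iff'.2 fun δ => ?_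
  obtain ⟨δ', h1, h2⟩ := exists_mem_headDer_sub_mem_tailDer (n := n) δ
  have h3 := Submodule.add_mem_sup h1 h2
  rwa [add_sub_cancel] at h3

variable {P n}

/-- Composing the values on the first `n` generators with the retraction gives a derivation of
`V_n`; what is left over is killed by the retraction. -/
theorem exists_sub_extend_mem_posDer {δ : P.hInf} (h : δ ∈ P.headDer n) :
    ∃ δ' : P.hFin n, δ - P.extend n δ' ∈ P.posDer n := by
  refine ⟨⟨Free.der fun i => P.retr n (δ.1 (Free.var (i : ℕ))), Free.der_isDerivation _⟩,
    fun i => ?_⟩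
  change P.retr n (δ.1 (Free.var i) - (P.extendDer n _).1 (Free.var i)) = 0
  rcases lt_or_ge i n with hi | hi
  · rw [extendDer_var_of_lt _ hi, Free.der_var, map_sub, retr_incl, sub_self]
  · rw [extendDer_var_of_le _ hi, h i hi, sub_zero, map_zero]

/-- The retraction kills `x_j`, the only generator in the image of `E_ji`. For `i = j` this puts the
operators that detect `tailPos` inside `posDer`. -/
theorem matUnit_mem_posDer {j : ℕ} (hj : n ≤ j) (i : ℕ) : P.glToH (matUnit k j i) ∈ P.posDer n := by
  intro l
  change P.retr n ((P.glDer _).1 _) = 0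
  rw [glDer_var, matUnit_single]
  split_ifs
  · rw [inclW_single, retr_var_of_le hj]
  · rw [map_zero, map_zero]

theorem glTail_mem_tailDer (g : glTail k n) : P.glToH g.1 ∈ P.tailDer n := by
  intro l hl
  change (P.glDer _).1 _ = 0
  rw [glDer_var, g.2.1 l hl, map_zero]

theorem tailDer_incl {δ : P.hInf} (h : δ ∈ P.tailDer n) (v : P.V n) : δ.1 (P.incl n v) = 0 := by
  have : δ.1 ∘ₗ P.incl n = 0 := by
    refine Free.leibniz_ext (P.incl n) (fun r p a => ?_) (fun r p a => ?_) (fun i => ?_)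
    · rw [LinearMap.comp_apply, incl, Free.lift_act, δ.2.1]
      rfl
    · simp
    · rw [LinearMap.comp_apply, incl_var, h i i.2]
      rfl
  exact congrArg (fun F => F v) this

/-- The composite is a derivation along the algebra map `retr`, so it vanishes as soon as it does on
generators. -/
theorem retr_posDer {δ : P.hInf} (h : δ ∈ P.posDer n) (v : P.VInf) : P.retr n (δ.1 v) = 0 := by
  have : P.retr n ∘ₗ δ.1 = 0 := by
    refine Free.leibniz_ext (P.retr n) (fun r p a => ?_) (fun r p a => ?_) (fun i => ?_)
    · rw [LinearMap.comp_apply, δ.2.1, map_sum]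
      refine Finset.sum_congr rfl fun i _ => ?_
      rw [retr, Free.lift_act]
      congr 1
      funext j
      by_cases hj : j = i
      · subst hj; simp
      · simp [hj]
    · simp
    · exact h i
  exact congrArg (fun F => F v) this

end Retraction

/-! ### Representations of `𝔥` as `𝔤𝔩`-modules -/

section GlAction

variable {k : Type u} [Field k] {P : LinearOperad k}

/-- A representation of `𝔥` as a `𝔤𝔩`-module. -/
noncomputable instance glLieRingModule (M : LieRep k P.hInf) : LieRingModule (glInf k) M.carrier :=
  LieRingModule.compLieHom M.carrier P.glToH

instance glLieModule (M : LieRep k P.hInf) : LieModule k (glInf k) M.carrier :=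
  LieModule.compLieHom M.carrier P.glToH

theorem gl_lie (M : LieRep k P.hInf) (g : glInf k) (m : M.carrier) : ⁅g, m⁆ = ⁅P.glToH g, m⁆ := rfl

/-- A homomorphism of representations of `𝔥` as a homomorphism of `𝔤𝔩`-modules. -/
def glHom {M N : LieRep k P.hInf} (f : M.carrier →ₗ⁅k, P.hInf⁆ N.carrier) :
    M.carrier →ₗ⁅k, glInf k⁆ N.carrier :=
  { (f : M.carrier →ₗ[k] N.carrier) with map_lie' := fun {g m} => f.map_lie (P.glToH g) m }

/-- A `𝔥`-submodule as a `𝔤𝔩`-submodule. -/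
def glSub {M : LieRep k P.hInf} (A : LieSubmodule k P.hInf M.carrier) :
    LieSubmodule k (glInf k) M.carrier :=
  { A.toSubmodule with lie_mem := fun {g _} hm => A.lie_mem (x := P.glToH g) hm }

theorem glInf_matUnit_mono (j : ℕ) {S : Type} [Fintype S] (f : S → ℕ) (p : P.obj S) :
    (P.glToH (matUnit k j j)).1 (Free.mono f p) = (content f j : k) • Free.mono f p := by
  classical
  refine (Free.der_mono (fun i => P.inclW ((matUnit k j j).1 (Finsupp.single i 1))) f p).trans ?_
  rw [content, Finsupp.finsetSum_apply, Int.cast_sum, Finset.sum_smul]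
  refine Finset.sum_congr rfl fun s _ => ?_
  rw [matUnit_single, Finsupp.single_apply]
  split_ifs with h
  · rw [inclW_single, ← h, Int.cast_one, one_smul, ← Free.act_var]
    congr 1
    exact Function.update_eq_self s fun j => Free.var (f j)
  · rw [map_zero, Int.cast_zero, zero_smul]
    exact MultilinearMap.map_update_zero _ _ _

end GlAction

/-! ### Tensor powers of `V` and of `V_n` -/

section TensorPow

variable {k : Type u} [Field k] {P : LinearOperad k} {n : ℕ} {ι : Type} [Fintype ι] [DecidableEq ι]

/-- A pure tensor in a tensor power of a representation. -/
noncomputable def pureTensor {L : Type u} [LieRing L] [LieAlgebra k L] (V : LieRep k L)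
    (v : ι → V.carrier) : (V.tensorPow ι).carrier :=
  PiTensorProduct.tprod k v

theorem pureTensor_update_smul {L : Type u} [LieRing L] [LieAlgebra k L] (V : LieRep k L)
    (v : ι → V.carrier) (c : ι) (a : k) (x : V.carrier) :
    pureTensor V (Function.update v c (a • x)) = a • pureTensor V (Function.update v c x) :=
  (PiTensorProduct.tprod k).map_update_smul v c a x

theorem pureTensor_eq_zero {L : Type u} [LieRing L] [LieAlgebra k L] (V : LieRep k L)
    {v : ι → V.carrier} (c : ι) (h : v c = 0) : pureTensor V v = 0 :=
  (PiTensorProduct.tprod k).map_coord_zero c h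

theorem pureTensor_hom_ext {L : Type u} [LieRing L] [LieAlgebra k L] {V : LieRep k L} {N : Type*}
    [AddCommGroup N] [Module k N] {f g : (V.tensorPow ι).carrier →ₗ[k] N}
    (h : ∀ v, f (pureTensor V v) = g (pureTensor V v)) : f = g :=
  PiTensorProduct.ext (MultilinearMap.ext h)

theorem lie_pureTensor (δ : P.hInf) (v : ι → P.VInf) :
    ⁅δ, pureTensor P.VInfRep v⁆ =
    ∑ c, pureTensor P.VInfRep (Function.update v c (δ.1 (v c))) :=
  LieRep.tensorAct_tprod P.VInfRep ι δ v

theorem lie_pureTensor_fin (δ : P.hFin n) (v : ι → P.V n) :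
    ⁅δ, pureTensor (P.VRep n) v⁆ =
    ∑ c, pureTensor (P.VRep n) (Function.update v c (δ.1 (v c))) :=
  LieRep.tensorAct_tprod (P.VRep n) ι δ v

variable (P n ι)

/-- The inclusion `V_n^{⊗ι} ⊆ V^{⊗ι}`. -/
noncomputable def tensorIncl :
    ((P.VRep n).tensorPow ι).carrier →ₗ[k] (P.VInfRep.tensorPow ι).carrier :=
  PiTensorProduct.map fun _ => P.incl n

/-- The retraction of `V^{⊗ι}` onto `V_n^{⊗ι}`. -/
noncomputable def tensorRetr :
    (P.VInfRep.tensorPow ι).carrier →ₗ[k] ((P.VRep n).tensorPow ι).carrier :=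
  PiTensorProduct.map fun _ => P.retr n

variable {P n ι}

theorem tensorIncl_pureTensor (v : ι → P.V n) : P.tensorIncl n ι (pureTensor (P.VRep n) v) =
    pureTensor P.VInfRep fun c => P.incl n (v c) :=
  PiTensorProduct.map_tprod _ _

theorem tensorRetr_pureTensor (v : ι → P.VInf) : P.tensorRetr n ι (pureTensor P.VInfRep v) =
    pureTensor (P.VRep n) fun c => P.retr n (v c) :=
  PiTensorProduct.map_tprod _ _

theorem tensorRetr_tensorIncl (m) : P.tensorRetr n ι (P.tensorIncl n ι m) = m := by
  have : P.tensorRetr n ι ∘ₗ P.tensorIncl n ι = LinearMap.id := pureTensor_hom_ext fun v => by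
    exact (congrArg (P.tensorRetr n ι) (tensorIncl_pureTensor v)).trans
      ((tensorRetr_pureTensor _).trans (congrArg (pureTensor (P.VRep n))
        (funext fun c => retr_incl (v c))))
  exact congrArg (fun F => F m) this

theorem tensorIncl_injective : Function.Injective (P.tensorIncl n ι) :=
  Function.LeftInverse.injective tensorRetr_tensorIncl

theorem tensorIncl_lie (δ : P.hFin n) (m : ((P.VRep n).tensorPow ι).carrier) :
    P.tensorIncl n ι ⁅δ, m⁆ = ⁅P.extend n δ, P.tensorIncl n ι m⁆ := by
  have : P.tensorIncl n ι ∘ₗ LieModule.toEnd k (P.hFin n) ((P.VRep n).tensorPow ι).carrier δ =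
      LieModule.toEnd k P.hInf (P.VInfRep.tensorPow ι).carrier (P.extend n δ) ∘ₗ
        P.tensorIncl n ι := pureTensor_hom_ext fun v => by
    refine (congrArg (P.tensorIncl n ι) (lie_pureTensor_fin δ v)).trans (Eq.trans ?_
      ((congrArg (fun y => ⁅P.extend n δ, y⁆) (tensorIncl_pureTensor v)).trans
        (lie_pureTensor _ _)).symm)
    refine (map_sum _ _ _).trans ?_
    refine Finset.sum_congr rfl fun c _ => (tensorIncl_pureTensor _).trans ?_
    refine congrArg (pureTensor P.VInfRep) (funext fun d => ?_)
    by_cases hd : d = c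
    · subst hd
      exact (congrArg (P.incl n) (Function.update_self d _ v)).trans
        ((extendDer_incl δ _).symm.trans (Function.update_self d _
          fun c => P.incl n (v c)).symm)
    · exact (congrArg (P.incl n) (Function.update_of_ne hd _ v)).trans
        (Function.update_of_ne hd _ fun c => P.incl n (v c)).symm
  exact congrArg (fun F => F m) this

theorem lie_tensorIncl_eq_zero {δ : P.hInf} (h : δ ∈ P.tailDer n)
    (m : ((P.VRep n).tensorPow ι).carrier) : ⁅δ, P.tensorIncl n ι m⁆ = 0 := by
  have : LieModule.toEnd k P.hInf (P.VInfRep.tensorPow ι).carrier δ ∘ₗ P.tensorIncl n ι = 0 :=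
    pureTensor_hom_ext fun v => by
      refine ((congrArg (fun y => ⁅δ, y⁆) (tensorIncl_pureTensor v)).trans
        (lie_pureTensor _ _)).trans ?_
      refine Finset.sum_eq_zero fun c _ => pureTensor_eq_zero _ c ?_
      exact (Function.update_self ..).trans (tailDer_incl h _)
  exact congrArg (fun F => F m) this

theorem tensorRetr_lie_eq_zero {δ : P.hInf} (h : δ ∈ P.posDer n)
    (m : (P.VInfRep.tensorPow ι).carrier) : P.tensorRetr n ι ⁅δ, m⁆ = 0 := by
  have : P.tensorRetr n ι ∘ₗ LieModule.toEnd k P.hInf (P.VInfRep.tensorPow ι).carrier δ = 0 :=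
    pureTensor_hom_ext fun v => by
      refine ((congrArg (P.tensorRetr n ι) (lie_pureTensor δ v)).trans (map_sum _ _ _)).trans ?_
      refine Finset.sum_eq_zero fun c _ => (tensorRetr_pureTensor _).trans ?_
      refine pureTensor_eq_zero _ c ?_
      exact (congrArg (P.retr n) (Function.update_self c _ v)).trans (retr_posDer h _)
  exact congrArg (fun F => F m) this

/-- The family of pure tensors of monomials. -/
noncomputable def tensorMono
    (x : ι → Σ r : ℕ, (Fin r → ℕ) × P.obj (Fin r)) : (P.VInfRep.tensorPow ι).carrier :=
  pureTensor P.VInfRep fun c => Free.mono (x c).2.1 (x c).2.2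

theorem span_tensorMono : Submodule.span k
    (Set.range (tensorMono : (ι → Σ r : ℕ, (Fin r → ℕ) × P.obj (Fin r)) → _)) = ⊤ := by
  let U := Submodule.span k
    (Set.range (tensorMono : (ι → Σ r : ℕ, (Fin r → ℕ) × P.obj (Fin r)) → _))
  have : U.mkQ.compMultilinearMap (PiTensorProduct.tprod k) =
      (0 : MultilinearMap k (fun _ : ι => P.VInf) _) :=
    Free.multilinear_ext fun r f p =>
      (Submodule.Quotient.mk_eq_zero _).2
        (Submodule.subset_span ⟨fun c => ⟨r c, f c, p c⟩, rfl⟩)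
  have h2 : U.mkQ = 0 := PiTensorProduct.ext (this.trans rfl)
  refine (Submodule.ker_mkQ U).symm.trans ?_
  rw [h2, LinearMap.ker_zero]

theorem tensorMono_mem_wtSpace (x : ι → Σ r : ℕ, (Fin r → ℕ) × P.obj (Fin r)) :
    tensorMono x ∈ wtSpace (k := k) (P.VInfRep.tensorPow ι).carrier
      (∑ c, content (x c).2.1) := by
  intro j
  rw [gl_lie]
  refine (lie_pureTensor _ _).trans ?_
  rw [Finsupp.finsetSum_apply, Int.cast_sum, Finset.sum_smul]
  refine Finset.sum_congr rfl fun c _ => ?_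
  rw [glInf_matUnit_mono]
  refine (pureTensor_update_smul P.VInfRep _ c _ _).trans ?_
  congr 1
  exact congrArg _ (Function.update_eq_self c _)

variable [CharZero k]

omit [CharZero k] in
theorem isWeightModule_tensorPow : IsWeightModule k (P.VInfRep.tensorPow ι).carrier :=
  IsWeightModule.of_span tensorMono _ (fun _ => Finset.sum_nonneg fun _ _ => content_nonneg _)
    tensorMono_mem_wtSpace span_tensorMono

/-- Invariants are spanned by tensors of monomials with weight zero at all indices `≥ n`. As
contents are nonnegative, no generator of index `≥ n` occurs in such a tensor, which therefore comes
from `V_n`. -/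
theorem exists_tensorIncl_eq {m : (P.VInfRep.tensorPow ι).carrier}
    (hm : m ∈ tailInv (k := k) (P.VInfRep.tensorPow ι).carrier n) :
    ∃ y, P.tensorIncl n ι y = m := by
  have h1 := mem_span_of_mem_tailInv tensorMono _
    (fun _ => Finset.sum_nonneg fun _ _ => content_nonneg _)
    tensorMono_mem_wtSpace span_tensorMono hm
  refine (Submodule.span_le (p := LinearMap.range (P.tensorIncl n ι))).2 ?_ h1
  rintro _ ⟨x, hx, rfl⟩
  have hlt : ∀ c s, (x c).2.1 s < n := fun c s => by
    by_contra! h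
    have := hx _ h
    rw [Finsupp.finsetSum_apply, Finset.sum_eq_zero_iff_of_nonneg
      (fun c _ => content_nonneg _ _)] at this
    have := this c (Finset.mem_univ c)
    rw [content_apply] at this
    exact Finset.notMem_empty s (Finset.card_eq_zero.1 (by exact_mod_cast this) ▸
      Finset.mem_filter.2 ⟨Finset.mem_univ s, rfl⟩)
  refine ⟨pureTensor (P.VRep n) fun c => Free.mono (fun s => ⟨_, hlt c s⟩) (x c).2.2, ?_⟩
  refine (tensorIncl_pureTensor _).trans ?_
  simp only [incl_mono]
  rfl

/-- The retraction kills both `⁅δ, m⁆` and its `tailPos` component, and it is injective on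
invariants; so the invariant component is zero. -/
theorem tensorPow_lie_mem_tailPos {δ : P.hInf} (h : δ ∈ P.posDer n)
    (m : (P.VInfRep.tensorPow ι).carrier) :
    ⁅δ, m⁆ ∈ tailPos (k := k) (P.VInfRep.tensorPow ι).carrier n := by
  obtain ⟨r, hr, s, hs, e⟩ := isWeightModule_tensorPow.exists_add n ⁅δ, m⁆
  have h1 : tailPos (k := k) (P.VInfRep.tensorPow ι).carrier n ≤
      LinearMap.ker (P.tensorRetr n ι) := by
    refine Submodule.span_le.2 ?_
    rintro y ⟨a, ⟨j, hj, ha⟩, hy⟩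
    -- `y` is an eigenvector of `E_jj`, which lies in `posDer`, with nonzero eigenvalue.
    have h2 := tensorRetr_lie_eq_zero (matUnit_mem_posDer (P := P) hj j) y
    rw [← gl_lie, hy j, map_smul, smul_eq_zero] at h2
    exact h2.resolve_left (by exact_mod_cast ha)
  obtain ⟨y, rfl⟩ := exists_tensorIncl_eq hr
  have h3 := congrArg (P.tensorRetr n ι) e
  rw [tensorRetr_lie_eq_zero h, map_add, tensorRetr_tensorIncl,
    show P.tensorRetr n ι s = 0 from h1 hs, add_zero] at h3
  rw [e, ← h3, map_zero, zero_add]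
  exact hs

end TensorPow

end LinearOperad

/-! ### Submodules, quotients, simple subquotients and direct sums -/

namespace LieRep

open scoped DirectSum

section

variable {k : Type u} [Field k] {L : Type u} [LieRing L] [LieAlgebra k L]

/-- A submodule as a representation. -/
def sub {M : LieRep k L} (A : LieSubmodule k L M.carrier) : LieRep k L := ⟨A⟩

/-- The inclusion of a submodule. -/
def subIncl {M : LieRep k L} (A : LieSubmodule k L M.carrier) :
    (sub A).carrier →ₗ⁅k, L⁆ M.carrier := A.incl

theorem subIncl_injective {M : LieRep k L} (A : LieSubmodule k L M.carrier) :
    Function.Injective (subIncl A) := Subtype.val_injective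

theorem subIncl_mem {M : LieRep k L} (A : LieSubmodule k L M.carrier) (a : (sub A).carrier) :
    subIncl A a ∈ A := a.2

theorem exists_subIncl_eq {M : LieRep k L} {A : LieSubmodule k L M.carrier} {m : M.carrier}
    (h : m ∈ A) : ∃ a, subIncl A a = m := ⟨⟨m, h⟩, rfl⟩

/-- A quotient of a representation. -/
noncomputable def quot {M : LieRep k L} (A : LieSubmodule k L M.carrier) : LieRep k L :=
  ⟨M.carrier ⧸ A⟩

/-- The projection onto a quotient. -/
noncomputable def quotMk {M : LieRep k L} (A : LieSubmodule k L M.carrier) :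
    M.carrier →ₗ⁅k, L⁆ (quot A).carrier := LieSubmodule.Quotient.mk' A

theorem quotMk_surjective {M : LieRep k L} (A : LieSubmodule k L M.carrier) :
    Function.Surjective (quotMk A) := Submodule.Quotient.mk_surjective _

theorem quotMk_eq_zero {M : LieRep k L} {A : LieSubmodule k L M.carrier} {m : M.carrier} :
    quotMk A m = 0 ↔ m ∈ A := Submodule.Quotient.mk_eq_zero _

theorem IsSubquotient.refl (M : LieRep k L) : M.IsSubquotient M :=
  ⟨⊤, LieSubmodule.incl ⊤, fun m => ⟨⟨m, LieSubmodule.mem_top m⟩, rfl⟩⟩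

/-- Every nonzero element of a representation is nonzero in some simple subquotient. -/
theorem exists_isIrreducible (X : LieRep k L) {m : X.carrier} (hm : m ≠ 0) :
    ∃ (Y T : LieRep k L) (f : X.carrier →ₗ⁅k, L⁆ Y.carrier) (g : T.carrier →ₗ⁅k, L⁆ Y.carrier)
      (t : T.carrier), LieModule.IsIrreducible k L T.carrier ∧ Function.Surjective f ∧
      Function.Injective g ∧ t ≠ 0 ∧ g t = f m := by
  -- `N` is maximal among the submodules avoiding `m`; chains have upper bounds because the
  -- submodule generated by `m` is compact. Every nonzero submodule of the quotient by `N` contains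
  -- the class of `m`, so this class generates a simple submodule.
  obtain ⟨N, -, hN⟩ := zorn_le_nonempty₀ {N : LieSubmodule k L X.carrier | m ∉ N}
    (fun c hc hchain y hy => ⟨sSup c, fun hmem => by
      obtain ⟨x, hx, hle⟩ := (CompleteLattice.isCompactElement_iff_le_of_directed_sSup_le _ _).1
        (LieSubmodule.isCompactElement_lieSpan_singleton k L m) c ⟨y, hy⟩ hchain.directedOn
        (LieSubmodule.lieSpan_le.2 (Set.singleton_subset_iff.2 hmem))
      exact hc hx (hle (LieSubmodule.subset_lieSpan rfl)), fun z hz => le_sSup hz⟩) ⊥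
    (fun h => hm ((LieSubmodule.mem_bot m).1 h))
  let Y := quot N
  let f := quotMk N
  let A : LieSubmodule k L Y.carrier := LieSubmodule.lieSpan k L {f m}
  have hfm : f m ∈ A := LieSubmodule.subset_lieSpan rfl
  have ht : (⟨f m, hfm⟩ : (sub A).carrier) ≠ 0 := fun h =>
    hN.1 (quotMk_eq_zero.1 (congrArg (subIncl A) h))
  refine ⟨Y, sub A, f, subIncl A, ⟨f m, hfm⟩, ?_, quotMk_surjective N, subIncl_injective A, ht, rfl⟩
  have : Nontrivial (sub A).carrier := ⟨_, _, ht⟩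
  refine LieModule.IsIrreducible.mk fun B hB => ?_
  let C : LieSubmodule k L X.carrier := (B.map (subIncl A)).comap f
  have hmC : m ∈ C := by
    by_contra h
    have hNC : N ≤ C := fun y hy => LieSubmodule.mem_comap.2 (by
      rw [show f y = 0 from quotMk_eq_zero.2 hy]
      exact LieSubmodule.zero_mem _)
    have hCN := hN.2 h hNC
    refine hB ((LieSubmodule.eq_bot_iff _).2 fun b hb => ?_)
    obtain ⟨y, hy⟩ := quotMk_surjective N (subIncl A b)
    have hyC : y ∈ C := LieSubmodule.mem_comap.2 (by
      rw [show f y = _ from hy]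
      exact LieSubmodule.mem_map_of_mem hb)
    have := quotMk_eq_zero.2 (hCN hyC)
    rw [hy] at this
    exact subIncl_injective A (this.trans (map_zero _).symm)
  have hle : A ≤ B.map (subIncl A) :=
    LieSubmodule.lieSpan_le.2 (Set.singleton_subset_iff.2 (LieSubmodule.mem_comap.1 hmC))
  refine eq_top_iff.2 fun a _ => ?_
  obtain ⟨b, hb, hab⟩ := (LieSubmodule.mem_map _).1 (hle (subIncl_mem A a))
  rwa [← subIncl_injective A hab]

theorem isPolynomial_sub {V M : LieRep k L} (hM : V.isPolynomial M)
    (A : LieSubmodule k L M.carrier) : V.isPolynomial (sub A) := by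
  obtain ⟨I, d, h⟩ := hM
  exact ⟨I, d, h.of_injective (subIncl A) (subIncl_injective A)⟩

theorem isPolynomial_of_surjective {V M N : LieRep k L} (hM : V.isPolynomial M)
    (f : M.carrier →ₗ⁅k, L⁆ N.carrier) (hf : Function.Surjective f) : V.isPolynomial N := by
  obtain ⟨I, d, h⟩ := hM
  exact ⟨I, d, h.of_surjective f hf⟩

theorem isPolynomial_quot {V M : LieRep k L} (hM : V.isPolynomial M)
    (A : LieSubmodule k L M.carrier) : V.isPolynomial (quot A) :=
  isPolynomial_of_surjective hM (quotMk A) (quotMk_surjective A)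

theorem isPolynomial_directSum (V : LieRep k L) {I : Type u} (d : I → ℕ) :
    V.isPolynomial (directSum fun i => V.tensorPow (Fin (d i))) :=
  ⟨I, d, IsSubquotient.refl _⟩

open Classical in
/-- The inclusion of a summand into a direct sum of representations. -/
noncomputable def sumOf {I : Type u} (M : I → LieRep k L) (i : I) :
    (M i).carrier →ₗ⁅k, L⁆ (directSum M).carrier :=
  DirectSum.lieModuleOf k I L (fun i => (M i).carrier) i

/-- The projection from a direct sum of representations onto a summand. -/
noncomputable def sumProj {I : Type u} (M : I → LieRep k L) (i : I) :
    (directSum M).carrier →ₗ⁅k, L⁆ (M i).carrier :=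
  DirectSum.lieModuleComponent k I L (fun i => (M i).carrier) i

theorem sum_ext {I : Type u} {M : I → LieRep k L} {z w : (directSum M).carrier}
    (h : ∀ i, sumProj M i z = sumProj M i w) : z = w := DFinsupp.ext h

theorem sum_induction {I : Type u} {M : I → LieRep k L} {p : (directSum M).carrier → Prop}
    (h0 : p 0) (hadd : ∀ z w, p z → p w → p (z + w)) (z : (directSum M).carrier)
    (hof : ∀ i, p (sumOf M i (sumProj M i z))) : p z := by
  classical
  have h : z = ∑ i ∈ DFinsupp.support z, sumOf M i (sumProj M i z) :=
    (DirectSum.sum_support_of z).symm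
  rw [h]
  exact Finset.sum_induction _ p hadd h0 fun i _ => hof i

end

end LieRep

/-! ### Tail regularity of polynomial representations -/

namespace LinearOperad

section

variable {k : Type u} [Field k] {P : LinearOperad k} {n : ℕ} {I : Type u} (d : I → ℕ)

variable (P n) in
/-- The inclusion of a direct sum of tensor powers of `V_n` into that of tensor powers of `V`. -/
noncomputable def sumIncl :
    (LieRep.directSum fun i => (P.VRep n).tensorPow (Fin (d i))).carrier →ₗ[k]
      (LieRep.directSum fun i => P.VInfRep.tensorPow (Fin (d i))).carrier :=
  DFinsupp.mapRange.linearMap fun i => P.tensorIncl n (Fin (d i))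

theorem sumProj_sumIncl (y) (i : I) :
    LieRep.sumProj (fun i => P.VInfRep.tensorPow (Fin (d i))) i (P.sumIncl n d y) =
      P.tensorIncl n (Fin (d i))
        (LieRep.sumProj (fun i => (P.VRep n).tensorPow (Fin (d i))) i y) :=
  DFinsupp.mapRange_apply (fun i => P.tensorIncl n (Fin (d i))) (fun _ => map_zero _) y i

theorem sumIncl_sumOf (i : I) (y) :
    P.sumIncl n d (LieRep.sumOf (fun i => (P.VRep n).tensorPow (Fin (d i))) i y) =
      LieRep.sumOf (fun i => P.VInfRep.tensorPow (Fin (d i))) i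
        (P.tensorIncl n (Fin (d i)) y) := by
  classical
  exact DFinsupp.mapRange_single (f := fun i => P.tensorIncl n (Fin (d i)))
    (hf := fun _ => map_zero _)

theorem sumIncl_injective : Function.Injective (P.sumIncl n d) := fun y z h =>
  LieRep.sum_ext fun i => tensorIncl_injective (by
    rw [← sumProj_sumIncl, ← sumProj_sumIncl, h])

theorem sumIncl_lie (δ : P.hFin n) (y) :
    P.sumIncl n d ⁅δ, y⁆ = ⁅P.extend n δ, P.sumIncl n d y⁆ :=
  LieRep.sum_ext fun i => by
    rw [sumProj_sumIncl, LieModuleHom.map_lie, LieModuleHom.map_lie, sumProj_sumIncl,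
      tensorIncl_lie]

theorem lie_sumIncl_eq_zero {δ : P.hInf} (h : δ ∈ P.tailDer n) (y) :
    ⁅δ, P.sumIncl n d y⁆ = 0 :=
  LieRep.sum_ext fun i => by
    rw [LieModuleHom.map_lie, sumProj_sumIncl, lie_tensorIncl_eq_zero h, map_zero]

theorem sumIncl_mem_tailInv (y) : P.sumIncl n d y ∈ tailInv (k := k)
    (LieRep.directSum fun i => P.VInfRep.tensorPow (Fin (d i))).carrier n :=
  fun g => lie_sumIncl_eq_zero d (glTail_mem_tailDer g) y

variable [CharZero k]

omit [CharZero k] in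
theorem isWeightModule_directSum : IsWeightModule k
    (LieRep.directSum fun i => P.VInfRep.tensorPow (Fin (d i))).carrier := by
  refine Submodule.eq_top_iff'.2 fun z => ?_
  refine LieRep.sum_induction (Submodule.zero_mem _) (fun _ _ => Submodule.add_mem _) z fun i => ?_
  obtain ⟨v, hv, hv0, hvz⟩ := (isWeightModule_tensorPow (P := P)
    (ι := Fin (d i))).exists_finsupp (LieRep.sumProj _ i z)
  rw [← hvz, Finsupp.sum, map_sum]
  refine Submodule.sum_mem _ fun a ha => Submodule.subset_span
    ⟨a, hv0 a (Finsupp.mem_support_iff.1 ha), ?_⟩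
  exact wtSpace_map (glHom (LieRep.sumOf (fun i => P.VInfRep.tensorPow (Fin (d i))) i)) (hv a)

theorem exists_sumIncl_eq {m : (LieRep.directSum fun i => P.VInfRep.tensorPow (Fin (d i))).carrier}
    (hm : m ∈ tailInv (k := k)
      (LieRep.directSum fun i => P.VInfRep.tensorPow (Fin (d i))).carrier n) :
    ∃ y, P.sumIncl n d y = m := by
  change m ∈ LinearMap.range (P.sumIncl n d)
  refine LieRep.sum_induction (Submodule.zero_mem _) (fun _ _ => Submodule.add_mem _) m fun i => ?_
  obtain ⟨y, hy⟩ := exists_tensorIncl_eq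
    (tailInv_map (glHom (LieRep.sumProj (fun i => P.VInfRep.tensorPow (Fin (d i))) i)) hm)
  exact ⟨LieRep.sumOf (fun i => (P.VRep n).tensorPow (Fin (d i))) i y,
    (sumIncl_sumOf d i y).trans (congrArg _ hy)⟩

/-- The compatibility of an `𝔥`-module with the decomposition of `𝔥` relative to `𝔤𝔩_{∞-n}`. -/
structure IsTailRegular (n : ℕ) (M : LieRep k P.hInf) : Prop where
  isWeightModule : IsWeightModule k M.carrier
  lie_eq_zero : ∀ {δ : P.hInf}, δ ∈ P.tailDer n → ∀ {m : M.carrier},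
    m ∈ tailInv (k := k) M.carrier n → ⁅δ, m⁆ = 0
  lie_mem : ∀ {δ : P.hInf}, δ ∈ P.posDer n → ∀ m : M.carrier,
    ⁅δ, m⁆ ∈ tailPos (k := k) M.carrier n

theorem isTailRegular_directSum :
    IsTailRegular n (LieRep.directSum fun i => P.VInfRep.tensorPow (Fin (d i))) where
  isWeightModule := isWeightModule_directSum d
  lie_eq_zero h m hm := by
    obtain ⟨y, rfl⟩ := exists_sumIncl_eq d hm
    exact lie_sumIncl_eq_zero d h y
  lie_mem {δ} h m := by
    refine LieRep.sum_induction (p := fun m => ⁅δ, m⁆ ∈ tailPos (k := k)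
      (LieRep.directSum fun i => P.VInfRep.tensorPow (Fin (d i))).carrier n) ?_ ?_ m fun i => ?_
    · rw [lie_zero]
      exact Submodule.zero_mem _
    · intro z w hz hw
      rw [lie_add]
      exact Submodule.add_mem _ hz hw
    · rw [← LieModuleHom.map_lie]
      exact tailPos_map (glHom (LieRep.sumOf (fun i => P.VInfRep.tensorPow (Fin (d i))) i))
        (tensorPow_lie_mem_tailPos h _)

/-- The point to check is that an element of `A` lying in `tailPos` of `M` lies in `tailPos` of `A`;
it holds because `A` is itself a weight module. -/
theorem IsTailRegular.sub {M : LieRep k P.hInf} (hM : IsTailRegular n M)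
    (A : LieSubmodule k P.hInf M.carrier) : IsTailRegular n (LieRep.sub A) := by
  have hA : IsWeightModule k (LieRep.sub A).carrier := hM.isWeightModule.lieSubmodule (glSub A)
  refine ⟨hA, fun h m hm => ?_, fun h m => ?_⟩
  · refine LieRep.subIncl_injective A ?_
    rw [LieModuleHom.map_lie, map_zero]
    exact hM.lie_eq_zero h (tailInv_map (glHom (LieRep.subIncl A)) hm)
  · refine hA.mem_tailPos_of_injective (glHom (LieRep.subIncl A)) (LieRep.subIncl_injective A) ?_
    change LieRep.subIncl A _ ∈ _
    rw [LieModuleHom.map_lie]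
    exact hM.lie_mem h _

theorem IsTailRegular.of_surjective {M N : LieRep k P.hInf} (hM : IsTailRegular n M)
    (f : M.carrier →ₗ⁅k, P.hInf⁆ N.carrier) (hf : Function.Surjective f) : IsTailRegular n N := by
  refine ⟨hM.isWeightModule.of_surjective (glHom f) hf, fun h m hm => ?_, fun h m => ?_⟩
  · obtain ⟨m, hm', rfl⟩ := hM.isWeightModule.exists_tailInv_preimage (glHom f) hm (hf m)
    change ⁅_, f m⁆ = 0
    rw [← LieModuleHom.map_lie, hM.lie_eq_zero h hm', map_zero]
  · obtain ⟨m, rfl⟩ := hf m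
    rw [← LieModuleHom.map_lie]
    exact tailPos_map (glHom f) (hM.lie_mem h m)

/-- Tail regularity holds for sums of tensor powers and passes to submodules and quotients. -/
theorem isTailRegular_of_isPolynomial {M : LieRep k P.hInf} (hM : P.VInfRep.isPolynomial M)
    (n : ℕ) : IsTailRegular n M := by
  obtain ⟨I, d, A, f, hf⟩ := hM
  exact ((isTailRegular_directSum d).sub A).of_surjective f hf

/-- The invariants in the submodule generated by an `𝔥_n`-stable space of invariants. -/
theorem IsTailRegular.mem_of_mem_lieSpan {M : LieRep k P.hInf} (hM : IsTailRegular n M)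
    {B : Submodule k M.carrier} (hB : B ≤ tailInv (k := k) M.carrier n)
    (hst : ∀ (δ : P.hFin n), ∀ b ∈ B, ⁅P.extend n δ, b⁆ ∈ B) {m : M.carrier}
    (hm : m ∈ LieSubmodule.lieSpan k P.hInf (B : Set M.carrier))
    (hmi : m ∈ tailInv (k := k) M.carrier n) : m ∈ B := by
  -- The generated submodule lies in `B + tailPos`: `tailDer` kills `B`, and `headDer`, contained in
  -- `𝔥_n + posDer`, preserves `B + tailPos`.
  have h1 := mem_of_mem_lieSpan_of_sup_eq_top (P.headDer_sup_tailDer n) (B := B)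
    (C := B ⊔ tailPos (k := k) M.carrier n)
    (fun z hz b hb => by
      rw [hM.lie_eq_zero hz (hB hb)]
      exact Submodule.zero_mem _) le_sup_left ?_ hm
  · obtain ⟨b, hb, s, hs, rfl⟩ := Submodule.mem_sup.1 h1
    have := Submodule.sub_mem _ hmi (hB hb)
    rw [add_sub_cancel_left] at this
    rw [tailInv_disjoint_tailPos this hs, add_zero]
    exact hb
  · intro δ hδ c hc
    obtain ⟨δ', hδ'⟩ := exists_sub_extend_mem_posDer hδ
    have e : ⁅δ, c⁆ = ⁅P.extend n δ', c⁆ + ⁅δ - P.extend n δ', c⁆ := by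
      rw [← add_lie, add_sub_cancel]
    rw [e]
    refine Submodule.add_mem _ ?_ (Submodule.mem_sup_right (hM.lie_mem hδ' c))
    obtain ⟨b, hb, s, hs, rfl⟩ := Submodule.mem_sup.1 hc
    rw [lie_add]
    refine Submodule.add_mem_sup (hst δ' b hb) ?_
    -- `𝔥_n` preserves `tailPos`. It commutes with `E_jj` for `j ≥ n`, so `⁅P.extend n δ', x⁆` is
    -- again an eigenvector of `E_jj` with eigenvalue `a_j ≠ 0`. It need not be a weight vector, but
    -- it is in the image of `E_jj`, and `posDer` maps into `tailPos`.
    have hle : tailPos (k := k) M.carrier n ≤ (tailPos (k := k) M.carrier n).comap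
        (LieModule.toEnd k P.hInf M.carrier (P.extend n δ')) := by
      refine Submodule.span_le.2 ?_
      rintro x ⟨a, ⟨j, hj, ha⟩, hx⟩
      change ⁅P.extend n δ', x⁆ ∈ tailPos (k := k) M.carrier n
      have h2 : ⁅P.glToH (matUnit k j j), ⁅P.extend n δ', x⁆⁆ = (a j : k) • ⁅P.extend n δ', x⁆ := by
        have h3 := lie_glToH_extend (⟨_, matUnit_mem_glTail hj hj⟩ : glTail k n) δ'
        rw [leibniz_lie]
        erw [h3]
        rw [zero_lie, zero_add, ← gl_lie, hx j, lie_smul]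
      have h4 := Submodule.smul_mem _ (a j : k)⁻¹
        (hM.lie_mem (matUnit_mem_posDer (P := P) hj j) ⁅P.extend n δ', x⁆)
      rwa [h2, smul_smul, inv_mul_cancel₀ (by exact_mod_cast ha), one_smul] at h4
    exact hle hs

end

end LinearOperad

/-! ### The functor of invariants: polynomiality, lifting of objects and morphisms, kernel -/

namespace LinearOperad

section

variable {k : Type u} [Field k] {P : LinearOperad k} {n : ℕ}

/-- The inclusion of the invariants of a representation. -/
noncomputable def gammaVal (M : LieRep k P.hInf) :
    ((P.Gamma n).obj M).carrier →ₗ[k] M.carrier := (P.invariants n M).subtype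

theorem gammaVal_injective (M : LieRep k P.hInf) :
    Function.Injective (gammaVal (n := n) M) := Subtype.val_injective

theorem gammaVal_mem (M : LieRep k P.hInf) (m : ((P.Gamma n).obj M).carrier) :
    gammaVal M m ∈ tailInv (k := k) M.carrier n := m.2

theorem exists_gammaVal_eq {M : LieRep k P.hInf} {m : M.carrier}
    (h : m ∈ tailInv (k := k) M.carrier n) : ∃ x, gammaVal (n := n) M x = m := ⟨⟨m, h⟩, rfl⟩

theorem gammaVal_lie (M : LieRep k P.hInf) (δ : P.hFin n) (m : ((P.Gamma n).obj M).carrier) :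
    gammaVal M ⁅δ, m⁆ = ⁅P.extend n δ, gammaVal M m⁆ := rfl

/-- The action of the functor `Γ_n` on a homomorphism. -/
noncomputable def gammaMap (n : ℕ) {M N : LieRep k P.hInf}
    (f : M.carrier →ₗ⁅k, P.hInf⁆ N.carrier) :
    ((P.Gamma n).obj M).carrier →ₗ⁅k, P.hFin n⁆ ((P.Gamma n).obj N).carrier :=
  (P.Gamma n).map (show M ⟶ N from f)

theorem gammaVal_map {M N : LieRep k P.hInf} (f : M.carrier →ₗ⁅k, P.hInf⁆ N.carrier)
    (m : ((P.Gamma n).obj M).carrier) : gammaVal N (gammaMap n f m) = f (gammaVal M m) := rfl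

/-- A homomorphism into the invariants from an equivariant linear map. -/
def gammaLift {X : LieRep k (P.hFin n)} {M : LieRep k P.hInf} (φ : X.carrier →ₗ[k] M.carrier)
    (hφ : ∀ x, φ x ∈ tailInv (k := k) M.carrier n)
    (hφ' : ∀ (δ : P.hFin n) x, φ ⁅δ, x⁆ = ⁅P.extend n δ, φ x⁆) :
    X.carrier →ₗ⁅k, P.hFin n⁆ ((P.Gamma n).obj M).carrier where
  toFun x := ⟨φ x, hφ x⟩
  map_add' x y := Subtype.ext (map_add φ x y)
  map_smul' c x := Subtype.ext (map_smul φ c x)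
  map_lie' {δ x} := Subtype.ext (hφ' δ x)

theorem mem_tailInv_of_injective {M N : LieRep k P.hInf} (f : M.carrier →ₗ⁅k, P.hInf⁆ N.carrier)
    (hf : Function.Injective f) {m : M.carrier} (h : f m ∈ tailInv (k := k) N.carrier n) :
    m ∈ tailInv (k := k) M.carrier n := fun g =>
  hf ((f.map_lie (P.glToH g.1) m).trans ((h g).trans (map_zero f).symm))

theorem gammaMap_injective {M N : LieRep k P.hInf} (f : M.carrier →ₗ⁅k, P.hInf⁆ N.carrier)
    (hf : Function.Injective f) : Function.Injective (gammaMap n f) := fun m m' h =>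
  gammaVal_injective M (hf (by rw [← gammaVal_map, ← gammaVal_map, h]))

variable [CharZero k]

theorem gammaMap_surjective {M N : LieRep k P.hInf} (hM : IsWeightModule k M.carrier)
    (f : M.carrier →ₗ⁅k, P.hInf⁆ N.carrier)
    (hf : Function.Surjective f) : Function.Surjective (gammaMap n f) := fun x => by
  obtain ⟨m, hm, h⟩ := hM.exists_tailInv_preimage (glHom f) (gammaVal_mem N x) (hf _)
  obtain ⟨m, rfl⟩ := exists_gammaVal_eq hm
  exact ⟨m, gammaVal_injective N h⟩

/-- The invariants of a sum of tensor powers of `V` form the same sum for `V_n`, so those of a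
submodule `A` are a submodule of the latter; by exactness the invariants of a quotient of `A` are a
quotient of these. -/
theorem isPolynomial_gamma {M : LieRep k P.hInf} (hM : P.VInfRep.isPolynomial M) (n : ℕ) :
    (P.VRep n).isPolynomial ((P.Gamma n).obj M) := by
  obtain ⟨I, d, A, f, hf⟩ := hM
  let An : LieSubmodule k (P.hFin n)
      (LieRep.directSum fun i => (P.VRep n).tensorPow (Fin (d i))).carrier :=
    { A.toSubmodule.comap (P.sumIncl n d) with
      lie_mem := fun {δ y} hy => by
        change P.sumIncl n d ⁅δ, y⁆ ∈ A
        rw [sumIncl_lie]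
        exact A.lie_mem hy }
  let φ : (LieRep.sub An).carrier →ₗ[k] (LieRep.sub A).carrier :=
    (P.sumIncl n d).restrict (p := An.toSubmodule) (q := A.toSubmodule) fun y hy => hy
  have hφ : ∀ y, LieRep.subIncl A (φ y) = P.sumIncl n d (LieRep.subIncl An y) := fun _ => rfl
  have hφi : ∀ y, φ y ∈ tailInv (k := k) (LieRep.sub A).carrier n := fun y =>
    mem_tailInv_of_injective (LieRep.subIncl A) (LieRep.subIncl_injective A) (by
      rw [hφ]
      exact sumIncl_mem_tailInv d _)
  have hφl : ∀ (δ : P.hFin n) y, φ ⁅δ, y⁆ = ⁅P.extend n δ, φ y⁆ := fun δ y =>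
    LieRep.subIncl_injective A (by
      rw [LieModuleHom.map_lie, hφ, hφ, LieModuleHom.map_lie, sumIncl_lie])
  refine LieRep.isPolynomial_of_surjective
    (LieRep.isPolynomial_sub ((P.VRep n).isPolynomial_directSum d) An)
    ((gammaMap n (show (LieRep.sub A).carrier →ₗ⁅k, P.hInf⁆ M.carrier from f)).comp
      (gammaLift φ hφi hφl)) ?_
  have hA : IsWeightModule k (LieRep.sub A).carrier :=
    (isTailRegular_directSum (n := n) d).sub A |>.isWeightModule
  refine (gammaMap_surjective hA _ hf).comp fun x => ?_
  obtain ⟨y, hy⟩ := exists_sumIncl_eq d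
    (tailInv_map (glHom (LieRep.subIncl A)) (gammaVal_mem (LieRep.sub A) x))
  have hyA : y ∈ An := by
    change P.sumIncl n d y ∈ A
    rw [hy]
    exact LieRep.subIncl_mem A _
  exact ⟨⟨y, hyA⟩, gammaVal_injective _ (LieRep.subIncl_injective A hy)⟩

/-- Write `N` as the quotient of `A` by a submodule, inside a sum of tensor powers of `V_n`. The two
`𝔥`-submodules that they generate have them as invariants, so by exactness the quotient has
invariants `N`. -/
theorem exists_gamma_iso {N : LieRep k (P.hFin n)} (hN : (P.VRep n).isPolynomial N) :
    ∃ M : LieRep k P.hInf, P.VInfRep.isPolynomial M ∧ Nonempty ((P.Gamma n).obj M ≅ N) := by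
  obtain ⟨I, d, A, f, hf⟩ := hN
  let S := LieRep.directSum fun i => P.VInfRep.tensorPow (Fin (d i))
  have hS : IsTailRegular n S := isTailRegular_directSum d
  let f' : (LieRep.sub A).carrier →ₗ⁅k, P.hFin n⁆ N.carrier := f
  let ψ : (LieRep.sub A).carrier →ₗ[k] S.carrier :=
    P.sumIncl n d ∘ₗ (LieRep.subIncl A).toLinearMap
  have hψinj : Function.Injective ψ := (sumIncl_injective d).comp (LieRep.subIncl_injective A)
  have hψi : ∀ a, ψ a ∈ tailInv (k := k) S.carrier n := fun a => sumIncl_mem_tailInv d _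
  have hψl : ∀ (δ : P.hFin n) a, ψ ⁅δ, a⁆ = ⁅P.extend n δ, ψ a⁆ := fun δ a => by
    change P.sumIncl n d (LieRep.subIncl A ⁅δ, a⁆) = _
    rw [LieModuleHom.map_lie, sumIncl_lie]
    rfl
  let B₁ : Submodule k S.carrier := LinearMap.range ψ
  let B₂ : Submodule k S.carrier := (LinearMap.ker f'.toLinearMap).map ψ
  have hB₁ : ∀ {m}, m ∈ LieSubmodule.lieSpan k P.hInf (B₁ : Set S.carrier) →
      m ∈ tailInv (k := k) S.carrier n → m ∈ B₁ := fun h h' => by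
    refine hS.mem_of_mem_lieSpan ?_ ?_ h h'
    · rintro _ ⟨a, rfl⟩
      exact hψi a
    · rintro δ _ ⟨a, rfl⟩
      exact ⟨⁅δ, a⁆, hψl δ a⟩
  have hB₂ : ∀ {m}, m ∈ LieSubmodule.lieSpan k P.hInf (B₂ : Set S.carrier) →
      m ∈ tailInv (k := k) S.carrier n → m ∈ B₂ := fun h h' => by
    refine hS.mem_of_mem_lieSpan ?_ ?_ h h'
    · rintro _ ⟨a, -, rfl⟩
      exact hψi a
    · rintro δ _ ⟨a, ha, rfl⟩
      refine ⟨⁅δ, a⁆, ?_, hψl δ a⟩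
      change f' ⁅δ, a⁆ = 0
      rw [f'.map_lie, show f' a = 0 from ha, lie_zero]
  let A₁ := LieSubmodule.lieSpan k P.hInf (B₁ : Set S.carrier)
  let A₂ := LieSubmodule.lieSpan k P.hInf (B₂ : Set S.carrier)
  let C := A₂.comap (LieRep.subIncl A₁)
  have hpol := LieRep.isPolynomial_sub (P.VInfRep.isPolynomial_directSum d) A₁
  refine ⟨LieRep.quot C, LieRep.isPolynomial_quot hpol C, ?_⟩
  let φ : (LieRep.sub A).carrier →ₗ[k] (LieRep.sub A₁).carrier :=
    ψ.codRestrict A₁.toSubmodule fun a => LieSubmodule.subset_lieSpan ⟨a, rfl⟩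
  have hφ : ∀ a, LieRep.subIncl A₁ (φ a) = ψ a := fun _ => rfl
  have hφi : ∀ a, φ a ∈ tailInv (k := k) (LieRep.sub A₁).carrier n := fun a =>
    mem_tailInv_of_injective (LieRep.subIncl A₁) (LieRep.subIncl_injective A₁) (hψi a)
  have hφl : ∀ (δ : P.hFin n) a, φ ⁅δ, a⁆ = ⁅P.extend n δ, φ a⁆ := fun δ a =>
    LieRep.subIncl_injective A₁ (by rw [LieModuleHom.map_lie, hφ, hφ, hψl])
  let F := (gammaMap n (LieRep.quotMk C)).comp (gammaLift φ hφi hφl)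
  have hF : Function.Surjective F := by
    refine (gammaMap_surjective (isTailRegular_of_isPolynomial hpol n).isWeightModule _
      (LieRep.quotMk_surjective C)).comp fun x => ?_
    obtain ⟨a, ha⟩ := hB₁ (LieRep.subIncl_mem A₁ (gammaVal _ x))
      (tailInv_map (glHom (LieRep.subIncl A₁)) (gammaVal_mem (LieRep.sub A₁) x))
    exact ⟨a, gammaVal_injective _ (LieRep.subIncl_injective A₁ ha)⟩
  obtain ⟨e, -⟩ := LieModuleHom.exists_equiv_of_ker_eq F f' hF hf fun a => by
    constructor
    · intro h
      have h1 := congrArg (gammaVal (LieRep.quot C)) h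
      change LieRep.quotMk C (φ a) = 0 at h1
      obtain ⟨b, hb, hab⟩ := hB₂ (LieSubmodule.mem_comap.1 (LieRep.quotMk_eq_zero.1 h1)) (hψi a)
      rw [← hψinj hab]
      exact hb
    · intro h
      refine gammaVal_injective (LieRep.quot C) (LieRep.quotMk_eq_zero.2 ?_)
      exact LieSubmodule.mem_comap.2 (LieSubmodule.subset_lieSpan ⟨a, h, rfl⟩)
  exact ⟨LieRep.isoOfEquiv e⟩

/-- `E` is the `𝔥`-submodule of `M × N` generated by the graph of `g`. Its invariants are just the
graph, so on invariants the first projection is bijective and the second is `g` after the first. -/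
theorem exists_gamma_roof {M N : LieRep k P.hInf} (hM : P.VInfRep.isPolynomial M)
    (hN : P.VInfRep.isPolynomial N)
    (g : ((P.Gamma n).obj M).carrier →ₗ⁅k, P.hFin n⁆ ((P.Gamma n).obj N).carrier) :
    ∃ (E : LieRep k P.hInf) (s : E.carrier →ₗ⁅k, P.hInf⁆ M.carrier)
      (t : E.carrier →ₗ⁅k, P.hInf⁆ N.carrier), P.VInfRep.isPolynomial E ∧
      Function.Bijective (gammaMap n s) ∧ ∀ e, g (gammaMap n s e) = gammaMap n t e := by
  let X := M.prod N
  have hX : P.VInfRep.isPolynomial X := P.VInfRep.isPolynomial_prod hM hN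
  let γ : ((P.Gamma n).obj M).carrier →ₗ[k] X.carrier :=
    (gammaVal M).prod (gammaVal N ∘ₗ g.toLinearMap)
  have hγi : ∀ m, γ m ∈ tailInv (k := k) X.carrier n := fun m h =>
    Prod.ext (gammaVal_mem M m h) (gammaVal_mem N (g m) h)
  have hγl : ∀ (δ : P.hFin n) m, γ ⁅δ, m⁆ = ⁅P.extend n δ, γ m⁆ := fun δ m =>
    Prod.ext rfl (congrArg (gammaVal N) (g.map_lie δ m))
  let B : Submodule k X.carrier := LinearMap.range γ
  let A := LieSubmodule.lieSpan k P.hInf (B : Set X.carrier)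
  let s := (LieRep.fst M N).comp (LieRep.subIncl A)
  let t := (LieRep.snd M N).comp (LieRep.subIncl A)
  have key : ∀ e : ((P.Gamma n).obj (LieRep.sub A)).carrier, ∃ m,
      γ m = LieRep.subIncl A (gammaVal _ e) := fun e => by
    refine (isTailRegular_of_isPolynomial hX n).mem_of_mem_lieSpan (B := B) ?_ ?_
      (LieRep.subIncl_mem A _)
      (tailInv_map (glHom (LieRep.subIncl A)) (gammaVal_mem (LieRep.sub A) e))
    · rintro _ ⟨m, rfl⟩
      exact hγi m
    · rintro δ _ ⟨m, rfl⟩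
      exact ⟨⁅δ, m⁆, hγl δ m⟩
  have hs : ∀ e m, γ m = LieRep.subIncl A (gammaVal _ e) → gammaMap n s e = m ∧
      gammaMap n t e = g m := fun e m h =>
    ⟨gammaVal_injective M (congrArg Prod.fst h).symm,
      gammaVal_injective N (congrArg Prod.snd h).symm⟩
  refine ⟨LieRep.sub A, s, t, LieRep.isPolynomial_sub hX A, ⟨fun e e' h => ?_, fun m => ?_⟩,
    fun e => ?_⟩
  · obtain ⟨m, hm⟩ := key e
    obtain ⟨m', hm'⟩ := key e'
    refine gammaVal_injective _ (LieRep.subIncl_injective A ?_)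
    rw [← hm, ← hm', ← (hs e m hm).1, ← (hs e' m' hm').1, h]
  · obtain ⟨x, hx⟩ := LieRep.exists_subIncl_eq (A := A)
      (LieSubmodule.subset_lieSpan ⟨m, rfl⟩ : γ m ∈ A)
    obtain ⟨e, he⟩ := exists_gammaVal_eq (mem_tailInv_of_injective (LieRep.subIncl A)
      (LieRep.subIncl_injective A) (m := x) (by rw [hx]; exact hγi m))
    exact ⟨e, (hs e m (by rw [he, hx])).1⟩
  · obtain ⟨m, hm⟩ := key e
    rw [(hs e m hm).1, (hs e m hm).2]

/-- A polynomial representation lies in `𝒦_n` if and only if it has no nonzero invariants. -/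
theorem serreK_iff (M : P.VInfRep.PolRep) :
    P.serreK n M ↔ ∀ m ∈ tailInv (k := k) M.obj.carrier n, m = 0 := by
  have hM : IsWeightModule k M.obj.carrier :=
    (isTailRegular_of_isPolynomial M.property n).isWeightModule
  have hM' : IsWeightModule k (M.obj.res P.glToH).carrier := hM
  constructor
  · intro hK m hm
    by_contra h0
    -- A nonzero invariant survives in some simple subquotient, where it stays invariant; but
    -- `S_μ(W)` with more than `n` rows has no nonzero invariants.
    obtain ⟨Y, T, f, g, t, hT, hf, hg, ht, hgt⟩ :=
      LieRep.exists_isIrreducible (M.obj.res P.glToH) (m := m) h0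
    have htY : g t ∈ tailInv (k := k) Y.carrier n := by
      rw [hgt]
      exact tailInv_map f hm
    have htT : t ∈ tailInv (k := k) T.carrier n := fun x => hg (by
      rw [LieModuleHom.map_lie, htY x, map_zero])
    obtain ⟨μ, hμ, ⟨e⟩⟩ := hK T hT
      (((LieRep.IsSubquotient.refl _).of_surjective f hf).of_injective g hg)
    have h1 := eq_zero_of_mem_tailInv_schur μ hμ
      (tailInv_map (show T.carrier →ₗ⁅k, glInf k⁆ ((WRep k).schur μ).carrier from e.hom) htT)
    have h2 := LieModuleHom.congr_fun (show (LieModuleHom.comp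
      (show ((WRep k).schur μ).carrier →ₗ⁅k, glInf k⁆ T.carrier from e.inv)
      (show T.carrier →ₗ⁅k, glInf k⁆ ((WRep k).schur μ).carrier from e.hom)) =
        LieModuleHom.id from e.hom_inv_id) t
    rw [LieModuleHom.comp_apply, h1, map_zero] at h2
    exact ht h2.symm
  · rintro h0 T hT ⟨A, f, hf⟩
    have hA := hM'.lieSubmodule A
    obtain ⟨μ, v, hiso, hv0, a, hva, haμ⟩ := exists_iso_schur (hA.of_surjective f hf) hT
    refine ⟨μ, ?_, hiso⟩
    -- If `μ` had at most `n` rows, the weight of `v` would vanish at all indices `≥ n`; then `v`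
    -- would be invariant and would lift to a nonzero invariant of `M`.
    by_contra! hle
    have hvi : v ∈ tailInv (k := k) T.carrier n := by
      refine (hA.of_surjective f hf).mem_tailInv (fun j hj => ?_) hva
      rw [haμ, Nat.cast_eq_zero]
      by_contra! hne
      have h1 : (j, 0) ∈ μ := YoungDiagram.mem_iff_lt_rowLen.2 (Nat.pos_of_ne_zero hne)
      have h2 := YoungDiagram.mem_iff_lt_colLen.1 h1
      omega
    obtain ⟨b, hb, rfl⟩ := hA.exists_tailInv_preimage f hvi (hf v)
    refine hv0 ?_
    have : b = 0 := Subtype.ext (h0 _ (tailInv_map A.incl hb))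
    rw [this, map_zero]

end

end LinearOperad

/-! ### Exactness in the category of polynomial representations -/

namespace LieRep

section

variable {k : Type u} [Field k] {L : Type u} [LieRing L] [LieAlgebra k L] {V : LieRep k L}

/-- The homomorphism underlying a morphism of polynomial representations. -/
def polHom {X Y : V.PolRep} (f : X ⟶ Y) : X.obj.carrier →ₗ⁅k, L⁆ Y.obj.carrier := f.hom

/-- The morphism of polynomial representations given by a homomorphism. -/
def polMk {X Y : V.PolRep} (f : X.obj.carrier →ₗ⁅k, L⁆ Y.obj.carrier) : X ⟶ Y :=
  ObjectProperty.homMk (show X.obj ⟶ Y.obj from f)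

theorem polHom_ext {X Y : V.PolRep} {f g : X ⟶ Y} (h : ∀ x, polHom f x = polHom g x) : f = g :=
  ObjectProperty.hom_ext _ (LieModuleHom.ext h)

instance : PreservesFiniteLimits V.isPolynomial.ι :=
  have := V.isPolynomial.preservesKernels_ι
  Functor.preservesFiniteLimits_of_preservesKernels _

instance : PreservesFiniteColimits V.isPolynomial.ι :=
  have := V.isPolynomial.preservesCokernels_ι
  Functor.preservesFiniteColimits_of_preservesCokernels _

/-- The functor to modules over the enveloping algebra is exact and faithful, so short exactness can
be tested there. -/
theorem shortExact_iff (S : ShortComplex V.PolRep) : S.ShortExact ↔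
    Function.Injective (polHom S.f) ∧ Function.Surjective (polHom S.g) ∧
      ∀ x, polHom S.g x = 0 → ∃ y, polHom S.f y = x := by
  let F := V.isPolynomial.ι ⋙ toEnv k L
  rw [← CategoryTheory.ShortExact.shortExact_map_iff F]
  constructor
  · intro h
    exact ⟨h.moduleCat_injective_f, h.moduleCat_surjective_g,
      (ShortComplex.moduleCat_exact_iff _).1 h.exact⟩
  · rintro ⟨h1, h2, h3⟩
    exact
      { exact := (ShortComplex.moduleCat_exact_iff (S.map F)).2 h3
        mono_f := (ModuleCat.mono_iff_injective (F.map S.f)).2 h1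
        epi_g := (ModuleCat.epi_iff_surjective (F.map S.g)).2 h2 }

theorem isZero_iff (X : V.PolRep) : IsZero X ↔ ∀ x : X.obj.carrier, x = 0 := by
  rw [IsZero.iff_id_eq_zero]
  constructor
  · intro h x
    exact LieModuleHom.congr_fun (congrArg polHom h) x
  · intro h
    exact polHom_ext h

theorem isIso_of_bijective {X Y : V.PolRep} (f : X ⟶ Y) (h : Function.Bijective (polHom f)) :
    IsIso f := by
  let F := V.isPolynomial.ι ⋙ toEnv k L
  have : IsIso (F.map f) := (ConcreteCategory.isIso_iff_bijective _).2 h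
  exact isIso_of_reflects_iso f F

theorem mono_iff {X Y : V.PolRep} (f : X ⟶ Y) : Mono f ↔ Function.Injective (polHom f) := by
  let F := V.isPolynomial.ι ⋙ toEnv k L
  rw [← F.mono_map_iff_mono]
  exact ModuleCat.mono_iff_injective _

end

end LieRep

/-! ### The equivalence with the Serre quotient -/

namespace LinearOperad

section

variable {k : Type u} [Field k] [CharZero k] (P : LinearOperad k) (n : ℕ)

/-- The specialization functor `Γ_n` on polynomial representations. -/
noncomputable abbrev gammaFun : P.VInfRep.PolRep ⥤ (P.VRep n).PolRep :=
  P.gammaPol n fun M => isPolynomial_gamma M.property n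

instance : (P.gammaFun n).Additive where
  map_add := rfl

theorem gammaFun_shortExact {S : ShortComplex P.VInfRep.PolRep} (hS : S.ShortExact) :
    (S.map (P.gammaFun n)).ShortExact := by
  rw [LieRep.shortExact_iff] at hS ⊢
  obtain ⟨h1, h2, h3⟩ := hS
  have hw : ∀ X : P.VInfRep.PolRep, IsWeightModule k X.obj.carrier := fun X =>
    (isTailRegular_of_isPolynomial X.property n).isWeightModule
  refine ⟨gammaMap_injective (LieRep.polHom S.f) h1,
    gammaMap_surjective (hw _) (LieRep.polHom S.g) h2, fun x hx => ?_⟩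
  obtain ⟨y, hy⟩ := h3 (gammaVal S.X₂.obj x) (congrArg (gammaVal S.X₃.obj) hx)
  obtain ⟨y, rfl⟩ := exists_gammaVal_eq (mem_tailInv_of_injective (LieRep.polHom S.f) h1
    (by rw [hy]; exact gammaVal_mem _ x))
  exact ⟨y, gammaVal_injective S.X₂.obj hy⟩

theorem gammaFun_exact :
    PreservesFiniteLimits (P.gammaFun n) ∧ PreservesFiniteColimits (P.gammaFun n) :=
  ((P.gammaFun n).exact_tfae.out 0 3).1 fun _ => P.gammaFun_shortExact n

instance : PreservesFiniteLimits (P.gammaFun n) := (P.gammaFun_exact n).1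

instance : PreservesFiniteColimits (P.gammaFun n) := (P.gammaFun_exact n).2

/-- Being the kernel of an exact functor makes `𝒦_n` a Serre class and makes `Γ_n` invert the
morphisms with kernel and cokernel in it. -/
theorem serreK_eq_kernel : P.serreK n = (P.gammaFun n).kernel := by
  ext M
  rw [serreK_iff]
  refine Iff.trans ⟨fun h x => ?_, fun h m hm => ?_⟩
    (LieRep.isZero_iff ((P.gammaFun n).obj M)).symm
  · exact gammaVal_injective M.obj (h _ (gammaVal_mem M.obj x))
  · obtain ⟨x, rfl⟩ := exists_gammaVal_eq hm
    exact (congrArg (gammaVal M.obj) (h x)).trans (map_zero _)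

instance : (P.serreK n).IsSerreClass := by
  rw [serreK_eq_kernel]
  exact inferInstanceAs (ObjectProperty.inverseImage (IsZero (C := (P.VRep n).PolRep))
    (P.gammaFun n)).IsSerreClass

instance : (P.gammaFun n).EssSurj where
  mem_essImage N := by
    obtain ⟨M, hM, ⟨e⟩⟩ := exists_gamma_iso N.property
    exact ⟨⟨M, hM⟩, ⟨ObjectProperty.isoMk _ e⟩⟩

theorem isInvertedBy_gammaFun : (P.serreK n).isoModSerre.IsInvertedBy (P.gammaFun n) :=
  ((P.serreK n).isoModSerre_isInvertedBy_iff (P.gammaFun n)).2 (P.serreK_eq_kernel n).le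

theorem isEquivalence_lift_gammaFun :
    (Localization.Construction.lift (P.gammaFun n) (P.isInvertedBy_gammaFun n)).IsEquivalence := by
  refine Abelian.isEquivalence_lift_of_exact (P.gammaFun n) (fun {M N} g => ?_) (P.serreK n)
    (fun X => by rw [serreK_eq_kernel]; rfl) _
  obtain ⟨E, s, t, hE, hs, hst⟩ := exists_gamma_roof M.property N.property (LieRep.polHom g)
  refine ⟨⟨E, hE⟩, LieRep.polMk s, LieRep.polMk t, LieRep.isIso_of_bijective _ hs, ?_⟩
  exact LieRep.polHom_ext hst

end

end LinearOperad

/-! ### Polynomial representations form a Grothendieck category -/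

namespace LieRep

section

variable {k : Type u} [Field k] {L : Type u} [LieRing L] [LieAlgebra k L] {V : LieRep k L}

open scoped DirectSum

open Classical in
/-- The homomorphism from a direct sum given by its components. -/
noncomputable def sumDesc {I : Type u} {M : I → LieRep k L} {N : LieRep k L}
    (φ : ∀ i, (M i).carrier →ₗ⁅k, L⁆ N.carrier) : (directSum M).carrier →ₗ⁅k, L⁆ N.carrier :=
  let f : (directSum M).carrier →ₗ[k] N.carrier :=
    DirectSum.toModule k I N.carrier fun i => (φ i).toLinearMap
  have hf : ∀ i m, f (sumOf M i m) = φ i m := fun i m =>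
    DirectSum.toModule_lof k (M := fun i => (M i).carrier) (φ := fun i => (φ i).toLinearMap) i m
  { f with
    map_lie' := fun {x z} => by
      change f ⁅x, z⁆ = ⁅x, f z⁆
      refine sum_induction (p := fun z => f ⁅x, z⁆ = ⁅x, f z⁆) ?_ ?_ z fun i => ?_
      · rw [lie_zero, map_zero, lie_zero]
      · intro z w hz hw
        rw [lie_add, map_add, map_add, lie_add, hz, hw]
      · rw [← LieModuleHom.map_lie, hf, hf, LieModuleHom.map_lie] }

theorem sumDesc_sumOf {I : Type u} {M : I → LieRep k L} {N : LieRep k L}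
    (φ : ∀ i, (M i).carrier →ₗ⁅k, L⁆ N.carrier) (i : I) (m : (M i).carrier) :
    sumDesc φ (sumOf M i m) = φ i m := by
  classical
  exact DirectSum.toModule_lof k (M := fun i => (M i).carrier)
    (φ := fun i => (φ i).toLinearMap) i m

/-- The sum of the submodules `A j` embeds in one direct sum of tensor powers indexed by pairs, and
it maps onto the sum of the `M j`. -/
theorem isPolynomial_directSum_of_forall {J : Type u} {M : J → LieRep k L}
    (hM : ∀ j, V.isPolynomial (M j)) : V.isPolynomial (directSum M) := by
  classical
  choose I d A f hf using hM
  let X := fun j => directSum fun i => V.tensorPow (Fin (d j i))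
  let Y := directSum fun s : Σ j, I j => V.tensorPow (Fin (d s.1 s.2))
  let Z := directSum fun j => sub (A j)
  let F : Z.carrier → Y.carrier := fun z =>
    DFinsupp.sigmaUncurry (DFinsupp.mapRange (fun j => subIncl (A j)) (fun _ => map_zero _) z)
  have hF : ∀ z j i, sumProj (fun s : Σ j, I j => V.tensorPow (Fin (d s.1 s.2))) ⟨j, i⟩ (F z) =
      sumProj (fun i => V.tensorPow (Fin (d j i))) i
        (subIncl (A j) (sumProj (fun j => sub (A j)) j z)) := fun z j i => rfl
  let Φ : Z.carrier →ₗ⁅k, L⁆ Y.carrier :=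
    { toFun := F
      map_add' := fun z w => sum_ext fun ⟨j, i⟩ => by
        rw [hF, map_add, map_add, map_add, map_add, hF, hF]
      map_smul' := fun c z => sum_ext fun ⟨j, i⟩ => by
        rw [hF, map_smul, map_smul, map_smul, RingHom.id_apply, map_smul, hF]
      map_lie' := fun {x z} => sum_ext fun ⟨j, i⟩ => by
        rw [hF, LieModuleHom.map_lie, LieModuleHom.map_lie, LieModuleHom.map_lie,
          LieModuleHom.map_lie, hF] }
  have hΦ : Function.Injective Φ := fun z w h => sum_ext fun j =>
    subIncl_injective (A j) (sum_ext fun i => by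
      rw [← hF, ← hF]
      exact congrArg _ h)
  have hZ : V.isPolynomial Z := ⟨_, _, (IsSubquotient.refl Y).of_injective Φ hΦ⟩
  let f' : ∀ j, (sub (A j)).carrier →ₗ⁅k, L⁆ (M j).carrier := f
  let Ψ : Z.carrier →ₗ⁅k, L⁆ (directSum M).carrier := sumDesc fun j => (sumOf M j).comp (f' j)
  refine isPolynomial_of_surjective hZ Ψ fun z => ?_
  rw [← LieModuleHom.mem_range]
  refine sum_induction (LieSubmodule.zero_mem _) (fun _ _ => add_mem) z fun j => ?_
  obtain ⟨a, ha⟩ := hf j (sumProj M j z)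
  refine (LieModuleHom.mem_range _ _).2 
    ⟨sumOf (fun j => sub (A j)) j a, (sumDesc_sumOf (fun j => (sumOf M j).comp (f' j)) j _).trans ?_⟩
  exact congrArg (sumOf M j) ha

theorem isPolynomial_of_generates {J : Type u} {M : J → LieRep k L}
    (hM : ∀ j, V.isPolynomial (M j)) {N : LieRep k L}
    (φ : ∀ j, (M j).carrier →ₗ⁅k, L⁆ N.carrier)
    (h : ∀ R : LieSubmodule k L N.carrier, (∀ j m, φ j m ∈ R) → R = ⊤) : V.isPolynomial N := by
  refine isPolynomial_of_surjective (isPolynomial_directSum_of_forall hM) (sumDesc φ) ?_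
  rw [← LieModuleHom.range_eq_top]
  exact h _ fun j m => (LieModuleHom.mem_range _ _).2 ⟨_, sumDesc_sumOf φ j m⟩

instance (J : Type u) [SmallCategory J] : V.isPolynomial.IsClosedUnderColimitsOfShape J where
  colimitsOfShape_le := by
    rintro X ⟨p⟩
    let φ : ∀ j, (p.diag.obj j).carrier →ₗ⁅k, L⁆ X.carrier := fun j => p.ι.app j
    refine isPolynomial_of_generates (fun j => p.prop_diag_obj j) φ fun R hR => ?_
    -- A colimit is generated by the images of its terms, since the projection modulo these images
    -- vanishes on every term.
    have h0 : (show X ⟶ quot R from quotMk R) = (show X ⟶ quot R from 0) :=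
      p.isColimit.hom_ext fun j => LieModuleHom.ext fun m => quotMk_eq_zero.2 (hR j m)
    exact eq_top_iff.2 fun x _ => quotMk_eq_zero.1 (LieModuleHom.congr_fun h0 x)

instance : IsGrothendieckAbelian.{u} (LieRep k L) :=
  IsGrothendieckAbelian.of_equivalence (toEnv k L).asEquivalence.symm

instance : HasColimitsOfSize.{u, u} V.PolRep where
  has_colimits_of_shape _ _ := inferInstance

instance : AB5OfSize.{u, u} V.PolRep where
  ofShape J _ _ := HasExactColimitsOfShape.domain_of_functor J V.isPolynomial.ι

/-- Every element of a direct sum lies in a finite subsum. -/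
theorem exists_sumDesc_sumOf_eq {I : Type u} (M : I → LieRep k L) (z : (directSum M).carrier) :
    ∃ (r : ℕ) (σ : Fin r → I) (w : (directSum fun q : ULift.{u} (Fin r) => M (σ q.down)).carrier),
      sumDesc (fun q : ULift.{u} (Fin r) => sumOf M (σ q.down)) w = z := by
  classical
  have h : z = ∑ i ∈ DFinsupp.support z, sumOf M i (sumProj M i z) :=
    (DirectSum.sum_support_of z).symm
  let e := (DFinsupp.support z).equivFin
  refine ⟨_, fun q => (e.symm q).1,
    ∑ q, sumOf _ q (sumProj M (e.symm q.down).1 z), ?_⟩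
  rw [map_sum]
  simp only [sumDesc_sumOf]
  conv_rhs => rw [h, ← Finset.sum_coe_sort]
  exact Fintype.sum_equiv (Equiv.ulift.trans e.symm) _ _ fun _ => rfl

/-- Each element of a polynomial representation is hit by a submodule of a finite direct sum of
tensor powers. Finiteness limits the exponents to `Fin r → ℕ`, so these submodules form a small
family, and their coproduct separates. -/
instance : HasSeparator V.PolRep := by
  let T : ∀ r, (Fin r → ℕ) → LieRep k L := fun r d =>
    directSum fun q : ULift.{u} (Fin r) => V.tensorPow (Fin (d q.down))
  let G : (Σ (r : ℕ) (d : Fin r → ℕ), LieSubmodule k L (T r d).carrier) → V.PolRep := fun s =>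
    ⟨sub s.2.2, isPolynomial_sub (isPolynomial_directSum V _) s.2.2⟩
  have hG : (ObjectProperty.ofObj G).IsSeparating := by
    intro X Y f g h
    refine polHom_ext fun x => ?_
    obtain ⟨I, d, A, F, hF⟩ := X.property
    obtain ⟨a, rfl⟩ := hF x
    obtain ⟨r, σ, w, hw⟩ := exists_sumDesc_sumOf_eq (fun i => V.tensorPow (Fin (d i))) a.1
    let E := sumDesc (fun q : ULift.{u} (Fin r) =>
      sumOf (fun i => V.tensorPow (Fin (d i))) (σ q.down))
    let B : LieSubmodule k L (T r (d ∘ σ)).carrier := A.comap E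
    have hwB : w ∈ B := LieSubmodule.mem_comap.2 (by
      change sumDesc _ w ∈ A
      rw [hw]
      exact a.2)
    let E' : (sub B).carrier →ₗ⁅k, L⁆ (sub A).carrier :=
      (E.comp (subIncl B)).codRestrict A fun b => b.2
    let F' : (sub A).carrier →ₗ⁅k, L⁆ X.obj.carrier := F
    let e : G ⟨r, d ∘ σ, B⟩ ⟶ X := polMk (F'.comp E')
    have he : polHom e ⟨w, hwB⟩ = F a := congrArg F' (subIncl_injective A hw)
    have := LieModuleHom.congr_fun (congrArg polHom (h _ (ObjectProperty.ofObj_apply G _) e))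
      ⟨w, hwB⟩
    change polHom f (polHom e _) = polHom g (polHom e _) at this
    rwa [he] at this
  have := hG.isSeparator_coproduct
  exact ⟨⟨_, this⟩⟩

theorem isGrothendieckAbelian_polRep : IsGrothendieckAbelian.{u} V.PolRep where

end

end LieRep

/-! ### Noetherian objects and separating families in terms of submodules -/

namespace LieRep

section

variable {k : Type u} [Field k] {L : Type u} [LieRing L] [LieAlgebra k L] {V : LieRep k L}

/-- A homomorphism factors through an injective homomorphism whose range contains its own. -/
theorem exists_comp_eq {A B M : LieRep k L} (f : A.carrier →ₗ⁅k, L⁆ M.carrier)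
    (g : B.carrier →ₗ⁅k, L⁆ M.carrier) (hg : Function.Injective g)
    (h : ∀ a, ∃ b, g b = f a) : ∃ φ : A.carrier →ₗ⁅k, L⁆ B.carrier, ∀ a, g (φ a) = f a := by
  choose φ hφ using h
  exact ⟨{ toFun := φ
           map_add' := fun x y => hg (by rw [map_add, hφ, hφ, hφ, map_add])
           map_smul' := fun c x => hg (by rw [RingHom.id_apply, map_smul, hφ, hφ, map_smul])
           map_lie' := fun {x m} => hg (by
            rw [LieModuleHom.map_lie, hφ, hφ, LieModuleHom.map_lie]) }, hφ⟩

theorem subobject_le_of_range_le {X : V.PolRep} {S T : Subobject X}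
    (h : (polHom S.arrow).range ≤ (polHom T.arrow).range) : S ≤ T := by
  obtain ⟨φ, hφ⟩ := exists_comp_eq (polHom S.arrow) (polHom T.arrow)
    ((mono_iff T.arrow).1 inferInstance)
    fun a => (LieModuleHom.mem_range _ _).1 (h ((LieModuleHom.mem_range _ _).2 ⟨a, rfl⟩))
  exact Subobject.le_of_comm (polMk φ) (polHom_ext hφ)

theorem range_le_of_subobject_le {X : V.PolRep} {S T : Subobject X} (h : S ≤ T) :
    (polHom S.arrow).range ≤ (polHom T.arrow).range := by
  intro x hx
  obtain ⟨a, rfl⟩ := (LieModuleHom.mem_range _ _).1 hx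
  exact (LieModuleHom.mem_range _ _).2
    ⟨polHom (Subobject.ofLE S T h) a,
      LieModuleHom.congr_fun (congrArg polHom (Subobject.ofLE_arrow h)) a⟩

theorem isNoetherianObject_of_wellFoundedGT {X : V.PolRep}
    [WellFoundedGT (LieSubmodule k L X.obj.carrier)] : IsNoetherianObject X := by
  have : StrictMono fun S : Subobject X => (polHom S.arrow).range :=
    strictMono_of_le_iff_le fun S T => ⟨range_le_of_subobject_le, subobject_le_of_range_le⟩
  exact ⟨this.wellFoundedGT⟩

/-- The subobject given by a submodule. -/
noncomputable def toSubobject {X : V.PolRep} (A : LieSubmodule k L X.obj.carrier) : Subobject X :=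
  let i : (⟨sub A, isPolynomial_sub X.property A⟩ : V.PolRep) ⟶ X := polMk (subIncl A)
  have : Mono i := (mono_iff i).2 (subIncl_injective A)
  Subobject.mk i

theorem wellFoundedGT_of_isNoetherianObject {X : V.PolRep} [IsNoetherianObject X] :
    WellFoundedGT (LieSubmodule k L X.obj.carrier) := by
  have : StrictMono fun A : LieSubmodule k L X.obj.carrier => toSubobject A := by
    refine strictMono_of_le_iff_le fun A B => ?_
    let i : (⟨sub A, isPolynomial_sub X.property A⟩ : V.PolRep) ⟶ X := polMk (subIncl A)
    let j : (⟨sub B, isPolynomial_sub X.property B⟩ : V.PolRep) ⟶ X := polMk (subIncl B)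
    have hi : Mono i := (mono_iff i).2 (subIncl_injective A)
    have hj : Mono j := (mono_iff j).2 (subIncl_injective B)
    refine ⟨fun h => ?_, fun h a ha => ?_⟩
    · obtain ⟨φ, hφ⟩ := exists_comp_eq (subIncl A) (subIncl B) (subIncl_injective B)
        fun a => exists_subIncl_eq (h (subIncl_mem A a))
      exact Subobject.mk_le_mk_of_comm (f₁ := i) (f₂ := j) (polMk φ) (polHom_ext hφ)
    · have h1 : Subobject.ofMkLEMk i j h ≫ j = i := Subobject.ofMkLEMk_comp h
      have h2 := LieModuleHom.congr_fun (congrArg polHom h1) ⟨a, ha⟩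
      change subIncl B (polHom (Subobject.ofMkLEMk i j h) ⟨a, ha⟩) = a at h2
      rw [← h2]
      exact subIncl_mem B _
  exact this.wellFoundedGT

/-- The images of morphisms from a separating family generate. -/
theorem eq_top_of_isSeparating {I : Type u} {G : I → V.PolRep}
    (hG : (ObjectProperty.ofObj G).IsSeparating) {X : V.PolRep}
    (R : LieSubmodule k L X.obj.carrier) (h : ∀ i (f : G i ⟶ X) x, polHom f x ∈ R) : R = ⊤ := by
  let q : X ⟶ (⟨quot R, isPolynomial_quot X.property R⟩ : V.PolRep) := polMk (quotMk R)
  have hq : q = 0 := hG q 0 fun _ hY f => by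
    obtain ⟨i⟩ := hY
    exact polHom_ext fun x => quotMk_eq_zero.2 (h i f x)
  exact eq_top_iff.2 fun x _ => quotMk_eq_zero.1 (LieModuleHom.congr_fun (congrArg polHom hq) x)

end

end LieRep

/-! ### Transfer of local noetherianity -/

namespace LinearOperad

section

variable {k : Type u} [Field k] [CharZero k] {P : LinearOperad k} {n : ℕ}

/-- A submodule of `Γ_n X` is recovered, as invariants, from the `𝔥`-submodule it generates; so
submodules of `Γ_n X` embed, as an ordered set, in those of `X`. -/
theorem isNoetherianObject_gammaFun (X : P.VInfRep.PolRep) [IsNoetherianObject X] :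
    IsNoetherianObject ((P.gammaFun n).obj X) := by
  have := LieRep.wellFoundedGT_of_isNoetherianObject (X := X)
  let Y := (P.Gamma n).obj X.obj
  let F : LieSubmodule k (P.hFin n) Y.carrier → LieSubmodule k P.hInf X.obj.carrier := fun B =>
    LieSubmodule.lieSpan k P.hInf (B.toSubmodule.map (gammaVal X.obj) : Set X.obj.carrier)
  have hF : StrictMono F := by
    refine strictMono_of_le_iff_le fun A B =>
      ⟨fun h => LieSubmodule.lieSpan_mono (Submodule.map_mono h), fun h a ha => ?_⟩
    obtain ⟨b, hb, hab⟩ := (isTailRegular_of_isPolynomial X.property n).mem_of_mem_lieSpan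
      (B := B.toSubmodule.map (gammaVal X.obj)) (by
        rintro _ ⟨b, -, rfl⟩
        exact gammaVal_mem X.obj b) (by
        rintro δ _ ⟨b, hb, rfl⟩
        exact ⟨⁅δ, b⁆, B.lie_mem hb, gammaVal_lie X.obj δ b⟩)
      (h (LieSubmodule.subset_lieSpan ⟨a, ha, rfl⟩)) (gammaVal_mem X.obj a)
    rwa [← gammaVal_injective X.obj hab]
  have : WellFoundedGT (LieSubmodule k (P.hFin n) ((P.gammaFun n).obj X).obj.carrier) :=
    hF.wellFoundedGT
  exact LieRep.isNoetherianObject_of_wellFoundedGT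

/-- After replacing `X` by `Γ_n M`, let `D` be the space of invariants of `M` on which the two
morphisms agree. All maps `G i ⟶ M` land in `D + tailPos`, because their invariant parts come from
`Γ_n (G i)`. Their images span `M`, and an invariant in `D + tailPos` lies in `D`. -/
theorem isSeparating_gammaFun {I : Type u} {G : I → P.VInfRep.PolRep}
    (hG : (ObjectProperty.ofObj G).IsSeparating) :
    (ObjectProperty.ofObj fun i => (P.gammaFun n).obj (G i)).IsSeparating := by
  intro X Y f g h
  let M := (P.gammaFun n).objPreimage X
  let e : (P.gammaFun n).obj M ≅ X := (P.gammaFun n).objObjPreimageIso X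
  rw [← cancel_epi e.hom]
  let D : Submodule k M.obj.carrier :=
    (LinearMap.eqLocus (LieRep.polHom (e.hom ≫ f)).toLinearMap
      (LieRep.polHom (e.hom ≫ g)).toLinearMap).map (gammaVal M.obj)
  have hD : ∀ i (φ : G i ⟶ M) x, LieRep.polHom φ x ∈
      D ⊔ tailPos (k := k) M.obj.carrier n := by
    intro i φ x
    obtain ⟨r, hr, s, hs, rfl⟩ :=
      (isTailRegular_of_isPolynomial (G i).property n).isWeightModule.exists_add n x
    rw [map_add]
    obtain ⟨y, rfl⟩ := exists_gammaVal_eq hr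
    refine Submodule.add_mem_sup ?_ (tailPos_map (glHom (LieRep.polHom φ)) hs)
    refine ⟨gammaMap n (LieRep.polHom φ) y, ?_, rfl⟩
    have := h _ (ObjectProperty.ofObj_apply _ i) ((P.gammaFun n).map φ ≫ e.hom)
    rw [Category.assoc, Category.assoc] at this
    exact LieModuleHom.congr_fun (congrArg LieRep.polHom this) y
  let R : LieSubmodule k P.hInf M.obj.carrier :=
    ⨆ q : Σ i, (G i ⟶ M), (LieRep.polHom q.2).range
  have hR : R = ⊤ := LieRep.eq_top_of_isSeparating hG R fun i φ x =>
    le_iSup (fun q : Σ i, (G i ⟶ M) => (LieRep.polHom q.2).range) ⟨i, φ⟩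
      ((LieModuleHom.mem_range _ _).2 ⟨x, rfl⟩)
  have hRD : R.toSubmodule ≤ D ⊔ tailPos (k := k) M.obj.carrier n := by
    rw [LieSubmodule.iSup_toSubmodule]
    refine iSup_le fun q m hm => ?_
    obtain ⟨x, rfl⟩ := (LieModuleHom.mem_range _ _).1 hm
    exact hD q.1 q.2 x
  refine LieRep.polHom_ext fun x => ?_
  have hx : gammaVal M.obj x ∈ R.toSubmodule := by
    rw [hR]
    trivial
  obtain ⟨_, ⟨y, hy, rfl⟩, s, hs, hxs⟩ := Submodule.mem_sup.1 (hRD hx)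
  have hs0 : s = 0 := tailInv_disjoint_tailPos (by
    have := Submodule.sub_mem _ (gammaVal_mem M.obj x) (gammaVal_mem M.obj y)
    rwa [← hxs, add_sub_cancel_left] at this) hs
  rw [hs0, add_zero] at hxs
  rw [← gammaVal_injective M.obj hxs]
  exact hy

theorem isLocallyNoetherian_polRep_VRep (h : IsLocallyNoetherian P.VInfRep.PolRep) (n : ℕ) :
    IsLocallyNoetherian (P.VRep n).PolRep := by
  obtain ⟨-, I, G, hG, hG'⟩ := h
  exact ⟨LieRep.isGrothendieckAbelian_polRep, I, fun i => (P.gammaFun n).obj (G i),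
    fun i => have := hG i; isNoetherianObject_gammaFun (G i), isSeparating_gammaFun hG'⟩

end

end LinearOperad

theorem mainTheorem7 {k : Type u} [Field k] [CharZero k] (P : LinearOperad k) (n : ℕ) :
    (∃ (hpol : ∀ M : P.VInfRep.PolRep, (P.VRep n).isPolynomial ((P.Gamma n).obj M.obj))
      (hserre : (P.serreK n).IsSerreClass)
      (hinv : (P.serreK n).isoModSerre.IsInvertedBy (P.gammaPol n hpol)),
      (Localization.Construction.lift (P.gammaPol n hpol) hinv).IsEquivalence) ∧
    (IsLocallyNoetherian P.VInfRep.PolRep → IsLocallyNoetherian (P.VRep n).PolRep) := by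
  exact ⟨⟨fun M => LinearOperad.isPolynomial_gamma M.property n, inferInstance,
    P.isInvertedBy_gammaFun n, P.isEquivalence_lift_gammaFun n⟩,
    fun h => LinearOperad.isLocallyNoetherian_polRep_VRep h n⟩
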